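/- **Conventions.** $\Bbbk$ is a field of characteristic $0$; dg vector spaces are $\mathbb Z$-graded with differential of degree $+1$; signs follow the Koszul rule; $\uparrow$ is the suspension (raising the degree by $1$); $A^{\#}$ is the linear dual, with differential $(d\varphi)(x)=(-1)^{|\varphi|}\varphi(dx)$. For finite sets $C,D$ and $G\in\mathbb N_0$ put $\chi=2G+|C|+|D|-2$; only triples $(C,D,\chi)$ with $\chi>0$ (stable) are considered. **Properads.** A properad $\mathcal P$ (biased, without unit) consists of dg vector spaces $\mathcal P(C,D,\chi)$ ($C$ = outputs, $D$ = inputs), of degree $0$ chain maps $\mathcal P(\rho,\sigma):\mathcal P(C,D,\chi)\to\mathcal P(C',D',\chi)$ for bijections $\rho:C\to C'$, $\sigma:D\to D'$, and of degree $0$ chain maps $${}_B\overset{\eta}{\circ}_A:\ \mathcal P(C_1,D_1\sqcup B,\chi_1)\otimes\mathcal P(C_2\sqcup A,D_2,\chi_2)\to\mathcal P(C_1\sqcup C_2,D_1\sqcup D_2,\chi)$$ for bijections $\eta:B\to A$ of finite nonempty sets, where $\chi=\chi(\chi_1,\chi_2,A,B,\eta)>0$ is determined by a composition law $G=G(G_1,G_2,A,B,\eta)$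 of the genus grading. They satisfy functoriality, equivariance, and associativity of the composition of three elements $x,y,z$ (the middle one glued to both others, with or without a gluing of $x$ to $z$; two elements glued to a common third one but not to each other are exchanged with the Koszul sign). The composition law is such that both sides of each axiom lie in the same component, and each $G$ is of the form $G(G_1,G_2,A,B,\eta)$ for only finitely many $(G_1,G_2,|A|)$. Morphisms of properads are the families of degree $0$ chain maps that commute with all $\mathcal P(\rho,\sigma)$ and all ${}_B\overset{\eta}{\circ}_A$. For a dg vector space $V$, the endomorphism properad is $\mathcal E_V(C,D,\chi)=\mathrm{Hom}_{\Bbbk}(\bigodot_D V,\bigodot_C V)$ (graded Hom between unordered tensor products), with $d f=d\circ f-(-1)^{|f|}f\circ d$, with $(\rho,\sigma)$ acting by $f\mapsto\bar\rho\, f\,\bar\sigma^{-1}$, and with $g\circ f$ given by $(g\otimes\mathrm{id}_{C_2})\,\overline{\eta^{-1}}\,(\mathrm{id}_{D_1}\otimes f)$; its genus grading is composed by the law of $\mathcal P$. An algebra over a properad $\mathcal Q$ on $V$ is a morphism of properads $\mathcal Q\to\mathcal E_V$. Let every $\mathcal P(C,D,\chi)$ be finite dimensional. The cobar complex $C\mathcal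 P$ is the free properad on the suspended dual $\uparrow\mathcal P^{\#}$ of the underlying bimodule, where $(\rho,\sigma)$ acts on $\mathcal P^{\#}$ by $\mathcal P(\rho^{-1},\sigma^{-1})^{\#}$, with the differential $\partial$ which is the derivation of degree $1$ determined by $$\partial(\uparrow\varphi)=\ \uparrow(d\varphi)+\sum\frac{1}{|A|!}\,({}_B\overset{\eta}{\circ}_A)_{C\mathcal P}\,(\uparrow\otimes\uparrow)\,({}_B\overset{\eta}{\circ}_A)^{\#}_{\mathcal P}(\varphi),\qquad \varphi\in\mathcal P(C,D,\chi)^{\#}.$$ The sum, here and below, is over all $C_1\sqcup C_2=C$, $D_1\sqcup D_2=D$, all $\chi_1,\chi_2>0$, and all $\eta:B\xrightarrow{\sim}A$ up to relabelling of the auxiliary nonempty finite sets $B$, $A$ (so one $\eta$ for each size $|A|=|B|\ge1$), such that $\chi(\chi_1,\chi_2,A,B,\eta)=\chi$. **Theorem.** For every properad $\mathcal P$ with finite dimensional components and every dg vector space $V$, the assignment $F\mapsto\alpha$, $\alpha(C,D,\chi)(\varphi)=F(\uparrow\varphi)$, is a bijection from the set of algebras $F$ over $C\mathcal P$ on $V$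 to the set of collections of linear maps of degree $1$ $$\alpha(C,D,\chi):\mathcal P(C,D,\chi)^{\#}\to\mathcal E_V(C,D,\chi),\qquad C,D\text{ finite sets},\ \chi>0,$$ (no compatibility with the differential is required) such that $$\mathcal E_V(\rho,\sigma)\circ\alpha(C,D,\chi)=\alpha(C',D',\chi)\circ\mathcal P(\rho^{-1},\sigma^{-1})^{\#}$$ for all pairs of bijections $(\rho,\sigma):(C,D)\to(C',D')$, and $$d\circ\alpha(C,D,\chi)=\alpha(C,D,\chi)\circ d_{\mathcal P^{\#}}+\sum\frac1{|A|!}\,({}_B\overset{\eta}{\circ}_A)_{\mathcal E_V}\circ\big(\alpha(C_1,D_1\sqcup B,\chi_1)\otimes\alpha(C_2\sqcup A,D_2,\chi_2)\big)\circ({}_B\overset{\eta}{\circ}_A)^{\#}_{\mathcal P}.$$ -/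

import Mathlib

open scoped TensorProduct DirectSum

universe k u v w

/-! ## Signs and finite sets -/

/-- The Koszul sign `(-1) ^ n` as a scalar. -/
def koszul (K : Type k) [Field K] (n : ℤ) : K := ((n.negOnePow : ℤˣ) : ℤ)

/-- `(α ⊔ β) ⊔ γ ≃ (α ⊔ γ) ⊔ β`. -/
def sumRightComm (α β γ : Type) : (α ⊕ β) ⊕ γ ≃ (α ⊕ γ) ⊕ β :=
  ((Equiv.sumAssoc α β γ).trans (Equiv.sumCongr (Equiv.refl α) (Equiv.sumComm β γ))).trans
    (Equiv.sumAssoc α γ β).symm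

/-- `α ⊔ (β ⊔ γ) ≃ β ⊔ (α ⊔ γ)`. -/
def sumLeftComm (α β γ : Type) : α ⊕ (β ⊕ γ) ≃ β ⊕ (α ⊕ γ) :=
  ((Equiv.sumAssoc α β γ).symm.trans (Equiv.sumCongr (Equiv.sumComm α β) (Equiv.refl γ))).trans
    (Equiv.sumAssoc β α γ)

/-! ## Stable directed corollas -/

/-- The Euler characteristic `χ = 2 G + |C| + |D| - 2`. -/
noncomputable def eulerChar (C D : Type) (G : ℕ) : ℤ :=
  2 * (G : ℤ) + (Nat.card C : ℤ) + (Nat.card D : ℤ) - 2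

/-- A stable directed corolla `(C, D, χ)`: a finite set `C` of outputs, a finite set `D` of inputs
and a genus `G`, such that `χ = 2 G + |C| + |D| - 2` is positive. (For given `C`, `D`, the genus
and the Euler characteristic determine each other.) -/
structure Corolla where
  out : Type
  inp : Type
  [finite_out : Finite out]
  [finite_inp : Finite inp]
  genus : ℕ
  stable : 0 < eulerChar out inp genus

attribute [instance] Corolla.finite_out Corolla.finite_inp

/-- A composition law for the genus grading: the genus `G(G₁, G₂, A, B, η)` of a composition along
`η : B ≃ A`. The law has to be such that both sides of each axiom of a properad lie in the same
component (`congr`, `assoc`, `upper`, `lower`), that the composition of stable corollas is stable,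
and that every genus is the value of the law on finitely many triples `(G₁, G₂, |A|)` only.
By `congr` the genus depends on `A`, `B`, `η` only through `|A| = |B|`. -/
structure GenusLaw where
  genus : ℕ → ℕ → ∀ {B A : Type}, (B ≃ A) → ℕ
  congr : ∀ (G₁ G₂ : ℕ) {B A B' A' : Type} [Finite B] [Nonempty B]
    (η : B ≃ A) (σ : B ≃ B') (ρ : A ≃ A'),
    genus G₁ G₂ ((σ.symm.trans η).trans ρ) = genus G₁ G₂ η
  assoc : ∀ (G₁ G₂ G₃ : ℕ) {B₁ A₁ B₂ A₂ B₃ A₃ : Type} [Finite B₁] [Finite B₂] [Finite B₃]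
    [Nonempty B₁] [Nonempty B₂] (η₁ : B₁ ≃ A₁) (η₂ : B₂ ≃ A₂) (η₃ : B₃ ≃ A₃),
    genus (genus G₁ G₂ η₁) G₃ (Equiv.sumCongr η₃ η₂) =
      genus G₁ (genus G₂ G₃ η₂) (Equiv.sumCongr η₁ η₃)
  upper : ∀ (G₁ G₂ G₃ : ℕ) {B₁ A₁ B₂ A₂ : Type} [Finite B₁] [Finite B₂]
    [Nonempty B₁] [Nonempty B₂] (η₁ : B₁ ≃ A₁) (η₂ : B₂ ≃ A₂),
    genus G₁ (genus G₂ G₃ η₂) η₁ = genus G₂ (genus G₁ G₃ η₁) η₂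
  lower : ∀ (G₁ G₂ G₃ : ℕ) {B₁ A₁ B₂ A₂ : Type} [Finite B₁] [Finite B₂]
    [Nonempty B₁] [Nonempty B₂] (η₁ : B₁ ≃ A₁) (η₂ : B₂ ≃ A₂),
    genus (genus G₁ G₂ η₁) G₃ η₂ = genus (genus G₁ G₃ η₂) G₂ η₁
  stable : ∀ {C₁ D₁ C₂ D₂ B A : Type} [Finite C₁] [Finite D₁] [Finite C₂] [Finite D₂]
    [Finite B] [Finite A] [Nonempty B] (η : B ≃ A) {G₁ G₂ : ℕ},
    0 < eulerChar C₁ (D₁ ⊕ B) G₁ → 0 < eulerChar (C₂ ⊕ A) D₂ G₂ →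
    0 < eulerChar (C₁ ⊕ C₂) (D₁ ⊕ D₂) (genus G₁ G₂ η)
  finite : ∀ G : ℕ, {t : ℕ × ℕ × ℕ |
    genus t.1 t.2.1 (Equiv.refl (Fin (t.2.2 + 1))) = G}.Finite

/-! ## Properads -/

/-- The bare operations of a (bigraded) properad: scalars, the action of pairs of bijections and
the compositions `x ∘ y` along `η : B ≃ A`, which glue the inputs `B` of the first argument to the
outputs `A` of the second one. -/
structure Operations (K : Type k) (law : GenusLaw) where
  obj : Corolla → ℤ → Type u
  smul : ∀ {X : Corolla} {n : ℤ}, K → obj X n → obj X n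
  act : ∀ {X Y : Corolla} (_ : X.out ≃ Y.out) (_ : X.inp ≃ Y.inp) (_ : X.genus = Y.genus)
    {n : ℤ}, obj X n → obj Y n
  comp : ∀ {C₁ D₁ C₂ D₂ B A : Type} [Finite C₁] [Finite D₁] [Finite C₂] [Finite D₂]
    [Finite B] [Finite A] [Nonempty B] (η : B ≃ A) {G₁ G₂ : ℕ}
    (h₁ : 0 < eulerChar C₁ (D₁ ⊕ B) G₁) (h₂ : 0 < eulerChar (C₂ ⊕ A) D₂ G₂)
    {i j n : ℤ} (_ : i + j = n),
    obj ⟨C₁, D₁ ⊕ B, G₁, h₁⟩ i → obj ⟨C₂ ⊕ A, D₂, G₂, h₂⟩ j →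
      obj ⟨C₁ ⊕ C₂, D₁ ⊕ D₂, law.genus G₁ G₂ η, law.stable η h₁ h₂⟩ n

/-- The axioms of a properad, as the relation between the left hand side and the right hand side
of each of them: functoriality, equivariance, and associativity for the composition of three
elements `x`, `y`, `z`, where in `assoc` the sets `B₃`, `A₃` may be empty (`B₁` is glued to `A₁`
between `x` and `y`, `B₂` to `A₂` between `y` and `z`, `B₃` to `A₃` between `x` and `z`), in `upper`
`x` and `y` are not connected to each other, and in `lower` `y` and `z` are not connected to each
other. In the last two cases two arguments are exchanged, with the Koszul sign. -/
inductive Operations.Axiom {K : Type k} [Field K] {law : GenusLaw}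
    (Q : Operations.{k, u} K law) : ∀ {X : Corolla} {n : ℤ}, Q.obj X n → Q.obj X n → Prop
  | act_id {X : Corolla} {n : ℤ} (x : Q.obj X n) :
      Q.Axiom (Q.act (Equiv.refl X.out) (Equiv.refl X.inp) rfl x) x
  | act_act {X Y Z : Corolla} {n : ℤ} (ρ : X.out ≃ Y.out) (σ : X.inp ≃ Y.inp)
      (hG : X.genus = Y.genus) (ρ' : Y.out ≃ Z.out) (σ' : Y.inp ≃ Z.inp)
      (hG' : Y.genus = Z.genus) (x : Q.obj X n) :
      Q.Axiom (Q.act (ρ.trans ρ') (σ.trans σ') (hG.trans hG') x) (Q.act ρ' σ' hG' (Q.act ρ σ hG x))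
  | equivariance {C₁ D₁ C₂ D₂ B A C₁' D₁' C₂' D₂' B' A' : Type}
      [Finite C₁] [Finite D₁] [Finite C₂] [Finite D₂] [Finite B] [Finite A] [Nonempty B]
      [Finite C₁'] [Finite D₁'] [Finite C₂'] [Finite D₂'] [Finite B'] [Finite A'] [Nonempty B']
      (η : B ≃ A) {G₁ G₂ : ℕ}
      (h₁ : 0 < eulerChar C₁ (D₁ ⊕ B) G₁) (h₂ : 0 < eulerChar (C₂ ⊕ A) D₂ G₂)
      (h₁' : 0 < eulerChar C₁' (D₁' ⊕ B') G₁) (h₂' : 0 < eulerChar (C₂' ⊕ A') D₂' G₂)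
      (ρ₁ : C₁ ≃ C₁') (σ₁ : D₁ ≃ D₁') (σB : B ≃ B')
      (ρ₂ : C₂ ≃ C₂') (ρA : A ≃ A') (σ₂ : D₂ ≃ D₂')
      {i j n : ℤ} (hn : i + j = n)
      (x : Q.obj ⟨C₁, D₁ ⊕ B, G₁, h₁⟩ i) (y : Q.obj ⟨C₂ ⊕ A, D₂, G₂, h₂⟩ j) :
      Q.Axiom
        (Q.act (X := ⟨C₁ ⊕ C₂, D₁ ⊕ D₂, law.genus G₁ G₂ η, law.stable η h₁ h₂⟩)
          (Y := ⟨C₁' ⊕ C₂', D₁' ⊕ D₂', law.genus G₁ G₂ ((σB.symm.trans η).trans ρA),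
            law.stable ((σB.symm.trans η).trans ρA) h₁' h₂'⟩)
          (Equiv.sumCongr ρ₁ ρ₂) (Equiv.sumCongr σ₁ σ₂) (law.congr G₁ G₂ η σB ρA).symm
          (Q.comp η h₁ h₂ hn x y))
        (Q.comp ((σB.symm.trans η).trans ρA) h₁' h₂' hn
          (Q.act (X := ⟨C₁, D₁ ⊕ B, G₁, h₁⟩) (Y := ⟨C₁', D₁' ⊕ B', G₁, h₁'⟩)
            ρ₁ (Equiv.sumCongr σ₁ σB) rfl x)
          (Q.act (X := ⟨C₂ ⊕ A, D₂, G₂, h₂⟩) (Y := ⟨C₂' ⊕ A', D₂', G₂, h₂'⟩)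
            (Equiv.sumCongr ρ₂ ρA) σ₂ rfl y))
  | assoc {C₁ D₁ C₂ D₂ C₃ D₃ B₁ A₁ B₂ A₂ B₃ A₃ : Type}
      [Finite C₁] [Finite D₁] [Finite C₂] [Finite D₂] [Finite C₃] [Finite D₃]
      [Finite B₁] [Finite A₁] [Finite B₂] [Finite A₂] [Finite B₃] [Finite A₃]
      [Nonempty B₁] [Nonempty B₂] (η₁ : B₁ ≃ A₁) (η₂ : B₂ ≃ A₂) (η₃ : B₃ ≃ A₃) {G₁ G₂ G₃ : ℕ}
      (h₁ : 0 < eulerChar C₁ ((D₁ ⊕ B₃) ⊕ B₁) G₁) (h₁' : 0 < eulerChar C₁ (D₁ ⊕ (B₁ ⊕ B₃)) G₁)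
      (h₂ : 0 < eulerChar (C₂ ⊕ A₁) (D₂ ⊕ B₂) G₂)
      (h₃ : 0 < eulerChar (C₃ ⊕ (A₃ ⊕ A₂)) D₃ G₃) (h₃' : 0 < eulerChar ((C₃ ⊕ A₃) ⊕ A₂) D₃ G₃)
      (h₁₂ : 0 < eulerChar (C₁ ⊕ C₂) ((D₁ ⊕ D₂) ⊕ (B₃ ⊕ B₂)) (law.genus G₁ G₂ η₁))
      (h₂₃ : 0 < eulerChar ((C₂ ⊕ C₃) ⊕ (A₁ ⊕ A₃)) (D₂ ⊕ D₃) (law.genus G₂ G₃ η₂))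
      {i j l ij jl n : ℤ} (hij : i + j = ij) (hjl : j + l = jl)
      (hn : ij + l = n) (hn' : i + jl = n)
      (x : Q.obj ⟨C₁, (D₁ ⊕ B₃) ⊕ B₁, G₁, h₁⟩ i)
      (y : Q.obj ⟨C₂ ⊕ A₁, D₂ ⊕ B₂, G₂, h₂⟩ j)
      (z : Q.obj ⟨C₃ ⊕ (A₃ ⊕ A₂), D₃, G₃, h₃⟩ l) :
      Q.Axiom
        (Q.act
          (X := ⟨(C₁ ⊕ C₂) ⊕ C₃, (D₁ ⊕ D₂) ⊕ D₃, _, law.stable (Equiv.sumCongr η₃ η₂) h₁₂ h₃⟩)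
          (Y := ⟨C₁ ⊕ (C₂ ⊕ C₃), D₁ ⊕ (D₂ ⊕ D₃), _, law.stable (Equiv.sumCongr η₁ η₃) h₁' h₂₃⟩)
          (Equiv.sumAssoc C₁ C₂ C₃) (Equiv.sumAssoc D₁ D₂ D₃) (law.assoc G₁ G₂ G₃ η₁ η₂ η₃)
          (Q.comp (Equiv.sumCongr η₃ η₂) h₁₂ h₃ hn
            (Q.act (X := ⟨C₁ ⊕ C₂, (D₁ ⊕ B₃) ⊕ (D₂ ⊕ B₂), _, law.stable η₁ h₁ h₂⟩)
              (Y := ⟨C₁ ⊕ C₂, (D₁ ⊕ D₂) ⊕ (B₃ ⊕ B₂), _, h₁₂⟩)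
              (Equiv.refl _) (Equiv.sumSumSumComm D₁ B₃ D₂ B₂) rfl
              (Q.comp η₁ h₁ h₂ hij x y))
            z))
        (Q.comp (Equiv.sumCongr η₁ η₃) h₁' h₂₃ hn'
          (Q.act (X := ⟨C₁, (D₁ ⊕ B₃) ⊕ B₁, G₁, h₁⟩) (Y := ⟨C₁, D₁ ⊕ (B₁ ⊕ B₃), G₁, h₁'⟩)
            (Equiv.refl _)
            ((Equiv.sumAssoc D₁ B₃ B₁).trans
              (Equiv.sumCongr (Equiv.refl D₁) (Equiv.sumComm B₃ B₁))) rfl x)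
          (Q.act (X := ⟨(C₂ ⊕ A₁) ⊕ (C₃ ⊕ A₃), D₂ ⊕ D₃, _, law.stable η₂ h₂ h₃'⟩)
            (Y := ⟨(C₂ ⊕ C₃) ⊕ (A₁ ⊕ A₃), D₂ ⊕ D₃, _, h₂₃⟩)
            (Equiv.sumSumSumComm C₂ A₁ C₃ A₃) (Equiv.refl _) rfl
            (Q.comp η₂ h₂ h₃' hjl y
              (Q.act (X := ⟨C₃ ⊕ (A₃ ⊕ A₂), D₃, G₃, h₃⟩) (Y := ⟨(C₃ ⊕ A₃) ⊕ A₂, D₃, G₃, h₃'⟩)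
                (Equiv.sumAssoc C₃ A₃ A₂).symm (Equiv.refl _) rfl z))))
  | upper {C₁ D₁ C₂ D₂ C₃ D₃ B₁ A₁ B₂ A₂ : Type}
      [Finite C₁] [Finite D₁] [Finite C₂] [Finite D₂] [Finite C₃] [Finite D₃]
      [Finite B₁] [Finite A₁] [Finite B₂] [Finite A₂]
      [Nonempty B₁] [Nonempty B₂] (η₁ : B₁ ≃ A₁) (η₂ : B₂ ≃ A₂) {G₁ G₂ G₃ : ℕ}
      (h₁ : 0 < eulerChar C₁ (D₁ ⊕ B₁) G₁) (h₂ : 0 < eulerChar C₂ (D₂ ⊕ B₂) G₂)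
      (h₃ : 0 < eulerChar ((C₃ ⊕ A₁) ⊕ A₂) D₃ G₃) (h₃' : 0 < eulerChar ((C₃ ⊕ A₂) ⊕ A₁) D₃ G₃)
      (h₂₃ : 0 < eulerChar ((C₂ ⊕ C₃) ⊕ A₁) (D₂ ⊕ D₃) (law.genus G₂ G₃ η₂))
      (h₁₃ : 0 < eulerChar ((C₁ ⊕ C₃) ⊕ A₂) (D₁ ⊕ D₃) (law.genus G₁ G₃ η₁))
      {i j l il jl n : ℤ} (hjl : j + l = jl) (hil : i + l = il)
      (hn : i + jl = n) (hn' : j + il = n)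
      (x : Q.obj ⟨C₁, D₁ ⊕ B₁, G₁, h₁⟩ i) (y : Q.obj ⟨C₂, D₂ ⊕ B₂, G₂, h₂⟩ j)
      (z : Q.obj ⟨(C₃ ⊕ A₁) ⊕ A₂, D₃, G₃, h₃⟩ l) :
      Q.Axiom
        (Q.act
          (X := ⟨C₁ ⊕ (C₂ ⊕ C₃), D₁ ⊕ (D₂ ⊕ D₃), _, law.stable η₁ h₁ h₂₃⟩)
          (Y := ⟨C₂ ⊕ (C₁ ⊕ C₃), D₂ ⊕ (D₁ ⊕ D₃), _, law.stable η₂ h₂ h₁₃⟩)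
          (sumLeftComm C₁ C₂ C₃) (sumLeftComm D₁ D₂ D₃) (law.upper G₁ G₂ G₃ η₁ η₂)
          (Q.comp η₁ h₁ h₂₃ hn x
            (Q.act (X := ⟨C₂ ⊕ (C₃ ⊕ A₁), D₂ ⊕ D₃, _, law.stable η₂ h₂ h₃⟩)
              (Y := ⟨(C₂ ⊕ C₃) ⊕ A₁, D₂ ⊕ D₃, _, h₂₃⟩)
              (Equiv.sumAssoc C₂ C₃ A₁).symm (Equiv.refl _) rfl
              (Q.comp η₂ h₂ h₃ hjl y z))))
        (Q.smul (koszul K (i * j)) (Q.comp η₂ h₂ h₁₃ hn' y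
          (Q.act (X := ⟨C₁ ⊕ (C₃ ⊕ A₂), D₁ ⊕ D₃, _, law.stable η₁ h₁ h₃'⟩)
            (Y := ⟨(C₁ ⊕ C₃) ⊕ A₂, D₁ ⊕ D₃, _, h₁₃⟩)
            (Equiv.sumAssoc C₁ C₃ A₂).symm (Equiv.refl _) rfl
            (Q.comp η₁ h₁ h₃' hil x
              (Q.act (X := ⟨(C₃ ⊕ A₁) ⊕ A₂, D₃, G₃, h₃⟩) (Y := ⟨(C₃ ⊕ A₂) ⊕ A₁, D₃, G₃, h₃'⟩)
                (sumRightComm C₃ A₁ A₂) (Equiv.refl _) rfl z)))))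
  | lower {C₁ D₁ C₂ D₂ C₃ D₃ B₁ A₁ B₂ A₂ : Type}
      [Finite C₁] [Finite D₁] [Finite C₂] [Finite D₂] [Finite C₃] [Finite D₃]
      [Finite B₁] [Finite A₁] [Finite B₂] [Finite A₂]
      [Nonempty B₁] [Nonempty B₂] (η₁ : B₁ ≃ A₁) (η₂ : B₂ ≃ A₂) {G₁ G₂ G₃ : ℕ}
      (h₁ : 0 < eulerChar C₁ ((D₁ ⊕ B₂) ⊕ B₁) G₁) (h₁' : 0 < eulerChar C₁ ((D₁ ⊕ B₁) ⊕ B₂) G₁)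
      (h₂ : 0 < eulerChar (C₂ ⊕ A₁) D₂ G₂) (h₃ : 0 < eulerChar (C₃ ⊕ A₂) D₃ G₃)
      (h₁₂ : 0 < eulerChar (C₁ ⊕ C₂) ((D₁ ⊕ D₂) ⊕ B₂) (law.genus G₁ G₂ η₁))
      (h₁₃ : 0 < eulerChar (C₁ ⊕ C₃) ((D₁ ⊕ D₃) ⊕ B₁) (law.genus G₁ G₃ η₂))
      {i j l ij il n : ℤ} (hij : i + j = ij) (hil : i + l = il)
      (hn : ij + l = n) (hn' : il + j = n)
      (x : Q.obj ⟨C₁, (D₁ ⊕ B₂) ⊕ B₁, G₁, h₁⟩ i)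
      (y : Q.obj ⟨C₂ ⊕ A₁, D₂, G₂, h₂⟩ j) (z : Q.obj ⟨C₃ ⊕ A₂, D₃, G₃, h₃⟩ l) :
      Q.Axiom
        (Q.act
          (X := ⟨(C₁ ⊕ C₂) ⊕ C₃, (D₁ ⊕ D₂) ⊕ D₃, _, law.stable η₂ h₁₂ h₃⟩)
          (Y := ⟨(C₁ ⊕ C₃) ⊕ C₂, (D₁ ⊕ D₃) ⊕ D₂, _, law.stable η₁ h₁₃ h₂⟩)
          (sumRightComm C₁ C₂ C₃) (sumRightComm D₁ D₂ D₃) (law.lower G₁ G₂ G₃ η₁ η₂)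
          (Q.comp η₂ h₁₂ h₃ hn
            (Q.act (X := ⟨C₁ ⊕ C₂, (D₁ ⊕ B₂) ⊕ D₂, _, law.stable η₁ h₁ h₂⟩)
              (Y := ⟨C₁ ⊕ C₂, (D₁ ⊕ D₂) ⊕ B₂, _, h₁₂⟩)
              (Equiv.refl _) (sumRightComm D₁ B₂ D₂) rfl
              (Q.comp η₁ h₁ h₂ hij x y)) z))
        (Q.smul (koszul K (j * l)) (Q.comp η₁ h₁₃ h₂ hn'
          (Q.act (X := ⟨C₁ ⊕ C₃, (D₁ ⊕ B₁) ⊕ D₃, _, law.stable η₂ h₁' h₃⟩)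
            (Y := ⟨C₁ ⊕ C₃, (D₁ ⊕ D₃) ⊕ B₁, _, h₁₃⟩)
            (Equiv.refl _) (sumRightComm D₁ B₁ D₃) rfl
            (Q.comp η₂ h₁' h₃ hil
              (Q.act (X := ⟨C₁, (D₁ ⊕ B₂) ⊕ B₁, G₁, h₁⟩) (Y := ⟨C₁, (D₁ ⊕ B₁) ⊕ B₂, G₁, h₁'⟩)
                (Equiv.refl _) (sumRightComm D₁ B₂ B₁) rfl x) z)) y))

/-- The data of a properad in dg vector spaces: for every stable corolla `(C, D, χ)` a graded vector
space with an endomorphism of degree `+1`, the linear actions of the pairs of bijections and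
the bilinear compositions, all of degree `0`. -/
structure ProperadData (K : Type k) [Field K] (law : GenusLaw) where
  obj : Corolla → ℤ → Type u
  [addCommGroup : ∀ X n, AddCommGroup (obj X n)]
  [module : ∀ X n, Module K (obj X n)]
  d : ∀ (X : Corolla) {n m : ℤ} (_ : n + 1 = m), obj X n →ₗ[K] obj X m
  act : ∀ {X Y : Corolla} (_ : X.out ≃ Y.out) (_ : X.inp ≃ Y.inp) (_ : X.genus = Y.genus)
    (n : ℤ), obj X n →ₗ[K] obj Y n
  comp : ∀ {C₁ D₁ C₂ D₂ B A : Type} [Finite C₁] [Finite D₁] [Finite C₂] [Finite D₂]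
    [Finite B] [Finite A] [Nonempty B] (η : B ≃ A) {G₁ G₂ : ℕ}
    (h₁ : 0 < eulerChar C₁ (D₁ ⊕ B) G₁) (h₂ : 0 < eulerChar (C₂ ⊕ A) D₂ G₂)
    {i j n : ℤ} (_ : i + j = n),
    obj ⟨C₁, D₁ ⊕ B, G₁, h₁⟩ i →ₗ[K] obj ⟨C₂ ⊕ A, D₂, G₂, h₂⟩ j →ₗ[K]
      obj ⟨C₁ ⊕ C₂, D₁ ⊕ D₂, law.genus G₁ G₂ η, law.stable η h₁ h₂⟩ n

attribute [instance] ProperadData.addCommGroup ProperadData.module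

/-- The underlying bare operations. -/
def ProperadData.toOperations {K : Type k} [Field K] {law : GenusLaw}
    (Q : ProperadData.{k, u} K law) : Operations.{k, u} K law where
  obj := Q.obj
  smul := fun c x => c • x
  act := fun ρ σ hG n x => Q.act ρ σ hG n x
  comp := fun η _ _ h₁ h₂ _ _ _ hn x y => Q.comp η h₁ h₂ hn x y

/-- A properad in dg vector spaces over `K` (without unit, with stable components only), with genus
grading composed by `law`. -/
structure Properad (K : Type k) [Field K] (law : GenusLaw) extends ProperadData.{k, u} K law where
  ax : ∀ {X : Corolla} {n : ℤ} (x y : obj X n), toProperadData.toOperations.Axiom x y → x = y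
  d_d : ∀ (X : Corolla) {n m l : ℤ} (h : n + 1 = m) (h' : m + 1 = l) (x : obj X n),
    d X h' (d X h x) = 0
  d_act : ∀ {X Y : Corolla} (ρ : X.out ≃ Y.out) (σ : X.inp ≃ Y.inp) (hG : X.genus = Y.genus)
    {n m : ℤ} (h : n + 1 = m) (x : obj X n), d Y h (act ρ σ hG n x) = act ρ σ hG m (d X h x)
  d_comp : ∀ {C₁ D₁ C₂ D₂ B A : Type} [Finite C₁] [Finite D₁] [Finite C₂] [Finite D₂]
    [Finite B] [Finite A] [Nonempty B] (η : B ≃ A) {G₁ G₂ : ℕ}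
    (h₁ : 0 < eulerChar C₁ (D₁ ⊕ B) G₁) (h₂ : 0 < eulerChar (C₂ ⊕ A) D₂ G₂)
    {i i' j j' n m : ℤ} (hi : i + 1 = i') (hj : j + 1 = j') (hn : i + j = n) (hm : n + 1 = m)
    (x : obj ⟨C₁, D₁ ⊕ B, G₁, h₁⟩ i) (y : obj ⟨C₂ ⊕ A, D₂, G₂, h₂⟩ j),
    d _ hm (comp η h₁ h₂ hn x y) =
      comp η h₁ h₂ (by omega) (d _ hi x) y +
        koszul K i • comp η h₁ h₂ (by omega) x (d _ hj y)

/-- A morphism of properads: linear maps of degree `0` that commute with the differentials, the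
actions of pairs of bijections and the compositions. -/
@[ext]
structure ProperadData.Hom {K : Type k} [Field K] {law : GenusLaw}
    (Q : ProperadData.{k, u} K law) (R : ProperadData.{k, v} K law) where
  app : ∀ (X : Corolla) (n : ℤ), Q.obj X n →ₗ[K] R.obj X n
  app_d : ∀ (X : Corolla) {n m : ℤ} (h : n + 1 = m) (x : Q.obj X n),
    app X m (Q.d X h x) = R.d X h (app X n x)
  app_act : ∀ {X Y : Corolla} (ρ : X.out ≃ Y.out) (σ : X.inp ≃ Y.inp) (hG : X.genus = Y.genus)
    (n : ℤ) (x : Q.obj X n), app Y n (Q.act ρ σ hG n x) = R.act ρ σ hG n (app X n x)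
  app_comp : ∀ {C₁ D₁ C₂ D₂ B A : Type} [Finite C₁] [Finite D₁] [Finite C₂] [Finite D₂]
    [Finite B] [Finite A] [Nonempty B] (η : B ≃ A) {G₁ G₂ : ℕ}
    (h₁ : 0 < eulerChar C₁ (D₁ ⊕ B) G₁) (h₂ : 0 < eulerChar (C₂ ⊕ A) D₂ G₂)
    {i j n : ℤ} (hn : i + j = n)
    (x : Q.obj ⟨C₁, D₁ ⊕ B, G₁, h₁⟩ i) (y : Q.obj ⟨C₂ ⊕ A, D₂, G₂, h₂⟩ j),
    app _ n (Q.comp η h₁ h₂ hn x y) = R.comp η h₁ h₂ hn (app _ i x) (app _ j y)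

/-! ## The linear dual and the quadratic operator -/

/-- Every component `P(C, D, χ)`, as a dg vector space, is finite dimensional. -/
class ProperadData.FiniteDimensional {K : Type k} [Field K] {law : GenusLaw}
    (P : ProperadData.{k, u} K law) : Prop where
  finite : ∀ X : Corolla, Module.Finite K (⨁ n : ℤ, P.obj X n)

instance ProperadData.finite_obj {K : Type k} [Field K] {law : GenusLaw}
    (P : ProperadData.{k, u} K law) [hP : P.FiniteDimensional] (X : Corolla) (n : ℤ) :
    Module.Finite K (P.obj X n) :=
  haveI := hP.finite X
  Module.Finite.of_surjective (DirectSum.component K ℤ (fun n => P.obj X n) n)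
    (fun x => ⟨DirectSum.lof K ℤ (fun n => P.obj X n) n x, DirectSum.component.lof_self K n x⟩)

/-- The component of degree `n` of the linear dual `P(C, D, χ)^#`. -/
abbrev ProperadData.Dual {K : Type k} [Field K] {law : GenusLaw}
    (P : ProperadData.{k, u} K law) (X : Corolla) (n : ℤ) : Type (max k u) :=
  Module.Dual K (P.obj X (-n))

/-- The differential of the dual: `(d φ)(x) = (-1) ^ |φ| φ (d x)`. -/
def ProperadData.dualD {K : Type k} [Field K] {law : GenusLaw} (P : ProperadData.{k, u} K law)
    (X : Corolla) {n m : ℤ} (h : n + 1 = m) : P.Dual X n →ₗ[K] P.Dual X m :=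
  koszul K n • (P.d X (show -m + 1 = -n by omega)).dualMap

/-- The map `P(ρ⁻¹, σ⁻¹)^# : P(C, D, χ)^# → P(C', D', χ)^#`, for bijections `ρ : C ≃ C'` and
`σ : D ≃ D'`. -/
def ProperadData.dualAct {K : Type k} [Field K] {law : GenusLaw} (P : ProperadData.{k, u} K law)
    {X Y : Corolla} (ρ : X.out ≃ Y.out) (σ : X.inp ≃ Y.inp) (hG : X.genus = Y.genus) (n : ℤ) :
    P.Dual X n →ₗ[K] P.Dual Y n :=
  (P.act ρ.symm σ.symm hG.symm (-n)).dualMap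

/-- The ways to obtain a stable corolla `X = (C, D, χ)` by a composition of stable corollas
`(C₁, D₁ ⊔ B, χ₁)` and `(C₂ ⊔ A, D₂, χ₂)` along `η : B ≃ A`, where `C = C₁ ⊔ C₂` and
`D = D₁ ⊔ D₂`, up to bijections of the auxiliary sets `B` and `A`: these are represented
by `B = A = Fin (r + 1)` and `η` the identity. -/
@[ext]
structure Splitting (law : GenusLaw) (X : Corolla) where
  out₁ : Set X.out
  inp₁ : Set X.inp
  genus₁ : ℕ
  genus₂ : ℕ
  r : ℕ
  stable₁ : 0 < eulerChar out₁ (inp₁ ⊕ Fin (r + 1)) genus₁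
  stable₂ : 0 < eulerChar (↥(out₁ᶜ) ⊕ Fin (r + 1)) ↥(inp₁ᶜ) genus₂
  genus_eq : law.genus genus₁ genus₂ (Equiv.refl (Fin (r + 1))) = X.genus

namespace Splitting

variable {law : GenusLaw} {X : Corolla}

/-- A stable corolla splits in finitely many ways. -/
instance finite : Finite (Splitting law X) := by
  have := (law.finite X.genus).to_subtype
  let f : Splitting law X → (Set X.out × Set X.inp) × {t : ℕ × ℕ × ℕ |
      law.genus t.1 t.2.1 (Equiv.refl (Fin (t.2.2 + 1))) = X.genus} :=
    fun s => ((s.out₁, s.inp₁), ⟨(s.genus₁, s.genus₂, s.r), s.genus_eq⟩)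
  refine Finite.of_injective f fun s t h => ?_
  simp only [f, Prod.mk.injEq, Subtype.mk.injEq] at h
  exact Splitting.ext h.1.1 h.1.2 h.2.1 h.2.2.1 h.2.2.2

/-- The corolla `(C₁, D₁ ⊔ B, χ₁)`. -/
abbrev left (s : Splitting law X) : Corolla :=
  ⟨s.out₁, s.inp₁ ⊕ Fin (s.r + 1), s.genus₁, s.stable₁⟩

/-- The corolla `(C₂ ⊔ A, D₂, χ₂)`. -/
abbrev right (s : Splitting law X) : Corolla :=
  ⟨↥(s.out₁ᶜ) ⊕ Fin (s.r + 1), ↥(s.inp₁ᶜ), s.genus₂, s.stable₂⟩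

open Classical in
/-- The composition `∘ : Q(C₁, D₁ ⊔ B, χ₁) ⊗ Q(C₂ ⊔ A, D₂, χ₂) → Q(C, D, χ)` of a splitting. -/
noncomputable def comp {K : Type k} [Field K] (s : Splitting law X) (Q : ProperadData.{k, u} K law)
    {i j n : ℤ} (hn : i + j = n) : Q.obj s.left i ⊗[K] Q.obj s.right j →ₗ[K] Q.obj X n :=
  (Q.act (X := ⟨s.out₁ ⊕ ↥(s.out₁ᶜ), s.inp₁ ⊕ ↥(s.inp₁ᶜ), _,
      law.stable (Equiv.refl (Fin (s.r + 1))) s.stable₁ s.stable₂⟩)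
    (Equiv.Set.sumCompl s.out₁) (Equiv.Set.sumCompl s.inp₁) s.genus_eq n).comp
    (TensorProduct.lift (Q.comp (Equiv.refl (Fin (s.r + 1))) s.stable₁ s.stable₂ hn))

/-- The dual `∘^# : P(C, D, χ)^# → P(C₁, D₁ ⊔ B, χ₁)^# ⊗ P(C₂ ⊔ A, D₂, χ₂)^#` of the composition of
a splitting, its component in bidegree `(i, j)`. An element `φ₁ ⊗ φ₂` of the target stands for the
functional `x ⊗ y ↦ (-1) ^ (|φ₂| |x|) φ₁ x * φ₂ y`. -/
noncomputable def dualComp {K : Type k} [Field K] (s : Splitting law X)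
    (P : ProperadData.{k, u} K law) [P.FiniteDimensional] {i j n : ℤ} (hn : i + j = n) :
    P.Dual X n →ₗ[K] P.Dual s.left i ⊗[K] P.Dual s.right j :=
  koszul K (i * j) •
    (TensorProduct.dualDistribEquiv K (P.obj s.left (-i)) (P.obj s.right (-j))).symm.toLinearMap.comp
      (s.comp P (show -i + -j = -n by omega)).dualMap

end Splitting

/-- Collections of linear maps `α(C, D, χ) : P(C, D, χ)^# → Q(C, D, χ)` of degree `1`. -/
abbrev DegreeOneMaps {K : Type k} [Field K] {law : GenusLaw}
    (P : ProperadData.{k, u} K law) (Q : ProperadData.{k, v} K law) : Type (max 1 k u v) :=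
  ∀ (X : Corolla) {n m : ℤ} (_ : n + 1 = m), P.Dual X n →ₗ[K] Q.obj X m

/-- The summand `(1 / |A|!) ∘_Q (α ⊗ α) ∘_P^#` of a splitting, restricted to the elements whose
image under `∘_P^#` has bidegree `(i, j)`. By the Koszul rule for maps of degree one,
`(α ⊗ α)(φ₁ ⊗ φ₂) = (-1) ^ |φ₁| α φ₁ ⊗ α φ₂`. -/
noncomputable def quadraticTerm {K : Type k} [Field K] {law : GenusLaw}
    (P : ProperadData.{k, u} K law) [P.FiniteDimensional] (Q : ProperadData.{k, v} K law)
    (α : DegreeOneMaps P Q) (X : Corolla) (s : Splitting law X) {i j n m : ℤ}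
    (hn : i + j = n) (hm : n + 2 = m) : P.Dual X n →ₗ[K] Q.obj X m :=
  (((s.r + 1).factorial : K)⁻¹ * koszul K i) •
    ((s.comp Q (show (i + 1) + (j + 1) = m by omega)).comp
      (TensorProduct.map (α s.left (rfl : i + 1 = i + 1)) (α s.right (rfl : j + 1 = j + 1)))).comp
      (s.dualComp P hn)

/-- The quadratic operator `∑ (1 / |A|!) ∘_Q (α ⊗ α) ∘_P^#`, the sum being over all splittings of
`(C, D, χ)` (and over all bidegrees). -/
noncomputable def quadratic {K : Type k} [Field K] {law : GenusLaw}
    (P : ProperadData.{k, u} K law) [P.FiniteDimensional] (Q : ProperadData.{k, v} K law)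
    (α : DegreeOneMaps P Q) (X : Corolla) {n m : ℤ} (hm : n + 2 = m) :
    P.Dual X n →ₗ[K] Q.obj X m :=
  ∑ᶠ (s : Splitting law X) (i : ℤ), quadraticTerm P Q α X s (show i + (n - i) = n by omega) hm

/-- Equivariance: `Q(ρ, σ) ∘ α(C, D, χ) = α(C', D', χ) ∘ P(ρ⁻¹, σ⁻¹)^#`. -/
def DegreeOneMaps.Equivariant {K : Type k} [Field K] {law : GenusLaw}
    {P : ProperadData.{k, u} K law} {Q : ProperadData.{k, v} K law} (α : DegreeOneMaps P Q) :
    Prop :=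
  ∀ {X Y : Corolla} (ρ : X.out ≃ Y.out) (σ : X.inp ≃ Y.inp) (hG : X.genus = Y.genus)
    {n m : ℤ} (h : n + 1 = m) (φ : P.Dual X n),
    Q.act ρ σ hG m (α X h φ) = α Y h (P.dualAct ρ σ hG n φ)

/-- The equation `d ∘ α = α ∘ d_{P^#} + ∑ (1 / |A|!) ∘_Q (α ⊗ α) ∘_P^#`. -/
def DegreeOneMaps.MasterEquation {K : Type k} [Field K] {law : GenusLaw}
    {P : ProperadData.{k, u} K law} [P.FiniteDimensional] {Q : ProperadData.{k, v} K law}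
    (α : DegreeOneMaps P Q) : Prop :=
  ∀ (X : Corolla) {n m l : ℤ} (h : n + 1 = m) (h' : m + 1 = l) (φ : P.Dual X n),
    Q.d X h' (α X h φ) =
      α X h' (P.dualD X h φ) + quadratic P Q α X (show n + 2 = l by omega) φ

/-! ## The free properad on the suspended dual -/

/-- Formal expressions of degree `n` in the suspended dual of `P`: an element `φ` of degree `n` of
the dual gives a generator `↑φ` of degree `n + 1`. -/
inductive FreeTerm {K : Type k} [Field K] {law : GenusLaw} (P : ProperadData.{k, u} K law) :
    Corolla → ℤ → Type (max 1 k u)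
  | gen {X : Corolla} {n m : ℤ} (h : n + 1 = m) (φ : P.Dual X n) : FreeTerm P X m
  | zero {X : Corolla} {n : ℤ} : FreeTerm P X n
  | add {X : Corolla} {n : ℤ} (x y : FreeTerm P X n) : FreeTerm P X n
  | smul {X : Corolla} {n : ℤ} (c : K) (x : FreeTerm P X n) : FreeTerm P X n
  | act {X Y : Corolla} (ρ : X.out ≃ Y.out) (σ : X.inp ≃ Y.inp) (hG : X.genus = Y.genus)
      {n : ℤ} (x : FreeTerm P X n) : FreeTerm P Y n
  | comp {C₁ D₁ C₂ D₂ B A : Type} [Finite C₁] [Finite D₁] [Finite C₂] [Finite D₂]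
      [Finite B] [Finite A] [Nonempty B] (η : B ≃ A) {G₁ G₂ : ℕ}
      (h₁ : 0 < eulerChar C₁ (D₁ ⊕ B) G₁) (h₂ : 0 < eulerChar (C₂ ⊕ A) D₂ G₂)
      {i j n : ℤ} (hn : i + j = n)
      (x : FreeTerm P ⟨C₁, D₁ ⊕ B, G₁, h₁⟩ i) (y : FreeTerm P ⟨C₂ ⊕ A, D₂, G₂, h₂⟩ j) :
      FreeTerm P ⟨C₁ ⊕ C₂, D₁ ⊕ D₂, law.genus G₁ G₂ η, law.stable η h₁ h₂⟩ n

/-- The operations on formal expressions. -/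
def FreeTerm.operations {K : Type k} [Field K] {law : GenusLaw} (P : ProperadData.{k, u} K law) :
    Operations.{k, max 1 k u} K law where
  obj := FreeTerm P
  smul := FreeTerm.smul
  act := FreeTerm.act
  comp := fun η _ _ h₁ h₂ _ _ _ hn x y => FreeTerm.comp η h₁ h₂ hn x y

/-- The smallest congruence on formal expressions such that the quotient consists of vector spaces
with linear actions and bilinear compositions, satisfies the axioms of a properad, and such that
the generators depend linearly and equivariantly on the elements of the dual of `P`. -/
inductive FreeTerm.Rel {K : Type k} [Field K] {law : GenusLaw} (P : ProperadData.{k, u} K law) :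
    ∀ {X : Corolla} {n : ℤ}, FreeTerm P X n → FreeTerm P X n → Prop
  -- equivalence relation
  | refl {X : Corolla} {n : ℤ} (x : FreeTerm P X n) : Rel P x x
  | symm {X : Corolla} {n : ℤ} {x y : FreeTerm P X n} : Rel P x y → Rel P y x
  | trans {X : Corolla} {n : ℤ} {x y z : FreeTerm P X n} : Rel P x y → Rel P y z → Rel P x z
  -- compatibility with the operations
  | add {X : Corolla} {n : ℤ} {x x' y y' : FreeTerm P X n} :
      Rel P x x' → Rel P y y' → Rel P (x.add y) (x'.add y')
  | smul {X : Corolla} {n : ℤ} (c : K) {x x' : FreeTerm P X n} :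
      Rel P x x' → Rel P (x.smul c) (x'.smul c)
  | act {X Y : Corolla} (ρ : X.out ≃ Y.out) (σ : X.inp ≃ Y.inp) (hG : X.genus = Y.genus)
      {n : ℤ} {x x' : FreeTerm P X n} : Rel P x x' → Rel P (x.act ρ σ hG) (x'.act ρ σ hG)
  | comp {C₁ D₁ C₂ D₂ B A : Type} [Finite C₁] [Finite D₁] [Finite C₂] [Finite D₂]
      [Finite B] [Finite A] [Nonempty B] (η : B ≃ A) {G₁ G₂ : ℕ}
      (h₁ : 0 < eulerChar C₁ (D₁ ⊕ B) G₁) (h₂ : 0 < eulerChar (C₂ ⊕ A) D₂ G₂)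
      {i j n : ℤ} (hn : i + j = n)
      {x x' : FreeTerm P ⟨C₁, D₁ ⊕ B, G₁, h₁⟩ i} {y y' : FreeTerm P ⟨C₂ ⊕ A, D₂, G₂, h₂⟩ j} :
      Rel P x x' → Rel P y y' → Rel P (.comp η h₁ h₂ hn x y) (.comp η h₁ h₂ hn x' y')
  -- vector spaces
  | add_assoc {X : Corolla} {n : ℤ} (x y z : FreeTerm P X n) :
      Rel P ((x.add y).add z) (x.add (y.add z))
  | add_comm {X : Corolla} {n : ℤ} (x y : FreeTerm P X n) : Rel P (x.add y) (y.add x)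
  | zero_add {X : Corolla} {n : ℤ} (x : FreeTerm P X n) : Rel P (FreeTerm.zero.add x) x
  | one_smul {X : Corolla} {n : ℤ} (x : FreeTerm P X n) : Rel P (x.smul 1) x
  | mul_smul {X : Corolla} {n : ℤ} (a b : K) (x : FreeTerm P X n) :
      Rel P (x.smul (a * b)) ((x.smul b).smul a)
  | smul_add {X : Corolla} {n : ℤ} (a : K) (x y : FreeTerm P X n) :
      Rel P ((x.add y).smul a) ((x.smul a).add (y.smul a))
  | add_smul {X : Corolla} {n : ℤ} (a b : K) (x : FreeTerm P X n) :
      Rel P (x.smul (a + b)) ((x.smul a).add (x.smul b))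
  | zero_smul {X : Corolla} {n : ℤ} (x : FreeTerm P X n) : Rel P (x.smul 0) FreeTerm.zero
  -- linearity of the operations
  | act_add {X Y : Corolla} (ρ : X.out ≃ Y.out) (σ : X.inp ≃ Y.inp) (hG : X.genus = Y.genus)
      {n : ℤ} (x y : FreeTerm P X n) :
      Rel P ((x.add y).act ρ σ hG) ((x.act ρ σ hG).add (y.act ρ σ hG))
  | act_smul {X Y : Corolla} (ρ : X.out ≃ Y.out) (σ : X.inp ≃ Y.inp) (hG : X.genus = Y.genus)
      {n : ℤ} (c : K) (x : FreeTerm P X n) :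
      Rel P ((x.smul c).act ρ σ hG) ((x.act ρ σ hG).smul c)
  | add_comp {C₁ D₁ C₂ D₂ B A : Type} [Finite C₁] [Finite D₁] [Finite C₂] [Finite D₂]
      [Finite B] [Finite A] [Nonempty B] (η : B ≃ A) {G₁ G₂ : ℕ}
      (h₁ : 0 < eulerChar C₁ (D₁ ⊕ B) G₁) (h₂ : 0 < eulerChar (C₂ ⊕ A) D₂ G₂)
      {i j n : ℤ} (hn : i + j = n)
      (x x' : FreeTerm P ⟨C₁, D₁ ⊕ B, G₁, h₁⟩ i) (y : FreeTerm P ⟨C₂ ⊕ A, D₂, G₂, h₂⟩ j) :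
      Rel P (.comp η h₁ h₂ hn (x.add x') y)
        ((FreeTerm.comp η h₁ h₂ hn x y).add (.comp η h₁ h₂ hn x' y))
  | smul_comp {C₁ D₁ C₂ D₂ B A : Type} [Finite C₁] [Finite D₁] [Finite C₂] [Finite D₂]
      [Finite B] [Finite A] [Nonempty B] (η : B ≃ A) {G₁ G₂ : ℕ}
      (h₁ : 0 < eulerChar C₁ (D₁ ⊕ B) G₁) (h₂ : 0 < eulerChar (C₂ ⊕ A) D₂ G₂)
      {i j n : ℤ} (hn : i + j = n) (c : K)
      (x : FreeTerm P ⟨C₁, D₁ ⊕ B, G₁, h₁⟩ i) (y : FreeTerm P ⟨C₂ ⊕ A, D₂, G₂, h₂⟩ j) :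
      Rel P (.comp η h₁ h₂ hn (x.smul c) y) ((FreeTerm.comp η h₁ h₂ hn x y).smul c)
  | comp_add {C₁ D₁ C₂ D₂ B A : Type} [Finite C₁] [Finite D₁] [Finite C₂] [Finite D₂]
      [Finite B] [Finite A] [Nonempty B] (η : B ≃ A) {G₁ G₂ : ℕ}
      (h₁ : 0 < eulerChar C₁ (D₁ ⊕ B) G₁) (h₂ : 0 < eulerChar (C₂ ⊕ A) D₂ G₂)
      {i j n : ℤ} (hn : i + j = n)
      (x : FreeTerm P ⟨C₁, D₁ ⊕ B, G₁, h₁⟩ i) (y y' : FreeTerm P ⟨C₂ ⊕ A, D₂, G₂, h₂⟩ j) :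
      Rel P (.comp η h₁ h₂ hn x (y.add y'))
        ((FreeTerm.comp η h₁ h₂ hn x y).add (.comp η h₁ h₂ hn x y'))
  | comp_smul {C₁ D₁ C₂ D₂ B A : Type} [Finite C₁] [Finite D₁] [Finite C₂] [Finite D₂]
      [Finite B] [Finite A] [Nonempty B] (η : B ≃ A) {G₁ G₂ : ℕ}
      (h₁ : 0 < eulerChar C₁ (D₁ ⊕ B) G₁) (h₂ : 0 < eulerChar (C₂ ⊕ A) D₂ G₂)
      {i j n : ℤ} (hn : i + j = n) (c : K)
      (x : FreeTerm P ⟨C₁, D₁ ⊕ B, G₁, h₁⟩ i) (y : FreeTerm P ⟨C₂ ⊕ A, D₂, G₂, h₂⟩ j) :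
      Rel P (.comp η h₁ h₂ hn x (y.smul c)) ((FreeTerm.comp η h₁ h₂ hn x y).smul c)
  -- the axioms of a properad
  | ax {X : Corolla} {n : ℤ} (x y : FreeTerm P X n) :
      (FreeTerm.operations P).Axiom x y → Rel P x y
  -- linearity and equivariance of the generators
  | gen_add {X : Corolla} {n m : ℤ} (h : n + 1 = m) (φ ψ : P.Dual X n) :
      Rel P (.gen h (φ + ψ)) ((FreeTerm.gen h φ).add (.gen h ψ))
  | gen_smul {X : Corolla} {n m : ℤ} (h : n + 1 = m) (c : K) (φ : P.Dual X n) :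
      Rel P (.gen h (c • φ)) ((FreeTerm.gen h φ).smul c)
  | gen_act {X Y : Corolla} (ρ : X.out ≃ Y.out) (σ : X.inp ≃ Y.inp) (hG : X.genus = Y.genus)
      {n m : ℤ} (h : n + 1 = m) (φ : P.Dual X n) :
      Rel P ((FreeTerm.gen h φ).act ρ σ hG) (.gen h (P.dualAct ρ σ hG n φ))

/-- The setoid of `FreeTerm.Rel`. -/
def FreeTerm.setoid {K : Type k} [Field K] {law : GenusLaw} (P : ProperadData.{k, u} K law)
    (X : Corolla) (n : ℤ) : Setoid (FreeTerm P X n) :=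
  ⟨FreeTerm.Rel P, ⟨.refl, .symm, .trans⟩⟩

/-- The components of the free properad generated by the suspended dual of `P`. -/
def FreeProperad {K : Type k} [Field K] {law : GenusLaw} (P : ProperadData.{k, u} K law)
    (X : Corolla) (n : ℤ) : Type (max 1 k u) :=
  Quotient (FreeTerm.setoid P X n)

namespace FreeProperad

variable {K : Type k} [Field K] {law : GenusLaw} {P : ProperadData.{k, u} K law}

/-- The class of a formal expression. -/
def mk {X : Corolla} {n : ℤ} (x : FreeTerm P X n) : FreeProperad P X n :=
  Quotient.mk (FreeTerm.setoid P X n) x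

theorem sound {X : Corolla} {n : ℤ} {x y : FreeTerm P X n} (h : FreeTerm.Rel P x y) :
    mk x = mk y :=
  Quotient.sound h

theorem ind {X : Corolla} {n : ℤ} {p : FreeProperad P X n → Prop} (h : ∀ x, p (mk x))
    (x : FreeProperad P X n) : p x :=
  Quotient.ind h x

instance (X : Corolla) (n : ℤ) : Zero (FreeProperad P X n) := ⟨mk .zero⟩

instance (X : Corolla) (n : ℤ) : Add (FreeProperad P X n) :=
  ⟨Quotient.map₂ FreeTerm.add fun _ _ h _ _ h' => .add h h'⟩

instance (X : Corolla) (n : ℤ) : SMul K (FreeProperad P X n) :=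
  ⟨fun c => Quotient.map (FreeTerm.smul c) fun _ _ h => .smul c h⟩

instance addCommMonoid (X : Corolla) (n : ℤ) : AddCommMonoid (FreeProperad P X n) where
  add_assoc x y z := by
    induction x using ind; induction y using ind; induction z using ind
    exact sound (.add_assoc _ _ _)
  zero_add x := by
    induction x using ind
    exact sound (.zero_add _)
  add_zero x := by
    induction x using ind
    exact sound ((FreeTerm.Rel.add_comm _ _).trans (.zero_add _))
  add_comm x y := by
    induction x using ind; induction y using ind
    exact sound (.add_comm _ _)
  nsmul := nsmulRec

instance module' (X : Corolla) (n : ℤ) : Module K (FreeProperad P X n) where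
  one_smul x := by
    induction x using ind
    exact sound (.one_smul _)
  mul_smul a b x := by
    induction x using ind
    exact sound (.mul_smul _ _ _)
  smul_add a x y := by
    induction x using ind; induction y using ind
    exact sound (.smul_add _ _ _)
  add_smul a b x := by
    induction x using ind
    exact sound (.add_smul _ _ _)
  zero_smul x := by
    induction x using ind
    exact sound (.zero_smul _)
  smul_zero a := by
    refine sound ((FreeTerm.Rel.smul a (.symm (.zero_smul .zero))).trans
      ((FreeTerm.Rel.mul_smul _ _ _).symm.trans ?_))
    rw [mul_zero]
    exact .zero_smul _

instance addCommGroup (X : Corolla) (n : ℤ) : AddCommGroup (FreeProperad P X n) :=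
  Module.addCommMonoidToAddCommGroup K

instance module (X : Corolla) (n : ℤ) : Module K (FreeProperad P X n) :=
  module' X n

/-- The action of a pair of bijections. -/
def act {X Y : Corolla} (ρ : X.out ≃ Y.out) (σ : X.inp ≃ Y.inp) (hG : X.genus = Y.genus) (n : ℤ) :
    FreeProperad P X n →ₗ[K] FreeProperad P Y n where
  toFun := Quotient.map (FreeTerm.act ρ σ hG) fun _ _ h => .act ρ σ hG h
  map_add' x y := by
    induction x using ind; induction y using ind
    exact sound (.act_add _ _ _ _ _)
  map_smul' c x := by
    induction x using ind
    exact sound (.act_smul _ _ _ _ _)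

/-- The composition along `η`. -/
def comp {C₁ D₁ C₂ D₂ B A : Type} [Finite C₁] [Finite D₁] [Finite C₂] [Finite D₂]
    [Finite B] [Finite A] [Nonempty B] (η : B ≃ A) {G₁ G₂ : ℕ}
    (h₁ : 0 < eulerChar C₁ (D₁ ⊕ B) G₁) (h₂ : 0 < eulerChar (C₂ ⊕ A) D₂ G₂)
    {i j n : ℤ} (hn : i + j = n) :
    FreeProperad P ⟨C₁, D₁ ⊕ B, G₁, h₁⟩ i →ₗ[K] FreeProperad P ⟨C₂ ⊕ A, D₂, G₂, h₂⟩ j →ₗ[K]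
      FreeProperad P ⟨C₁ ⊕ C₂, D₁ ⊕ D₂, law.genus G₁ G₂ η, law.stable η h₁ h₂⟩ n :=
  LinearMap.mk₂ K
    (Quotient.map₂ (FreeTerm.comp η h₁ h₂ hn) fun _ _ h _ _ h' => .comp η h₁ h₂ hn h h')
    (fun x x' y => by
      induction x using ind; induction x' using ind; induction y using ind
      exact sound (.add_comp _ _ _ _ _ _ _))
    (fun c x y => by
      induction x using ind; induction y using ind
      exact sound (.smul_comp _ _ _ _ _ _ _))
    (fun x y y' => by
      induction x using ind; induction y using ind; induction y' using ind
      exact sound (.comp_add _ _ _ _ _ _ _))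
    (fun c x y => by
      induction x using ind; induction y using ind
      exact sound (.comp_smul _ _ _ _ _ _ _))

/-- The inclusion `φ ↦ ↑φ` of the generators, a linear map of degree `1`. -/
def gen {X : Corolla} {n m : ℤ} (h : n + 1 = m) : P.Dual X n →ₗ[K] FreeProperad P X m where
  toFun φ := mk (.gen h φ)
  map_add' _ _ := sound (.gen_add _ _ _)
  map_smul' _ _ := sound (.gen_smul _ _ _)

variable (P) in
/-- The free graded properad generated by the suspended dual of `P`, with zero differential. -/
def graded : ProperadData.{k, max 1 k u} K law where
  obj := FreeProperad P
  d := fun _ _ _ _ => 0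
  act := act
  comp := comp

theorem mk_add {X : Corolla} {n : ℤ} (x y : FreeTerm P X n) : mk (x.add y) = mk x + mk y := rfl

theorem mk_smul {X : Corolla} {n : ℤ} (c : K) (x : FreeTerm P X n) :
    mk (x.smul c) = c • mk x := rfl

theorem gen_equivariant {X Y : Corolla} (ρ : X.out ≃ Y.out) (σ : X.inp ≃ Y.inp)
    (hG : X.genus = Y.genus) {n m : ℤ} (h : n + 1 = m) (φ : P.Dual X n) :
    act ρ σ hG m (gen h φ) = gen h (P.dualAct ρ σ hG n φ) :=
  sound (.gen_act _ _ _ _ _)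

/-- The free properad satisfies the axioms of a properad. -/
theorem ax {X : Corolla} {n : ℤ} (x y : (graded P).toOperations.obj X n)
    (h : (graded P).toOperations.Axiom x y) : x = y := by
  cases h with
  | act_id x =>
    induction y using ind
    exact sound (.ax _ _ (.act_id _))
  | act_act ρ σ hG ρ' σ' hG' x =>
    induction x using ind
    exact sound (.ax _ _ (.act_act _ _ _ _ _ _ _))
  | equivariance η h₁ h₂ h₁' h₂' ρ₁ σ₁ σB ρ₂ ρA σ₂ hn x y =>
    induction x using ind; induction y using ind
    exact sound (.ax _ _ (.equivariance η h₁ h₂ h₁' h₂' ρ₁ σ₁ σB ρ₂ ρA σ₂ hn _ _))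
  | assoc η₁ η₂ η₃ h₁ h₁' h₂ h₃ h₃' h₁₂ h₂₃ hij hjl hn hn' x y z =>
    induction x using ind; induction y using ind; induction z using ind
    exact sound (.ax _ _ (.assoc η₁ η₂ η₃ h₁ h₁' h₂ h₃ h₃' h₁₂ h₂₃ hij hjl hn hn' _ _ _))
  | upper η₁ η₂ h₁ h₂ h₃ h₃' h₂₃ h₁₃ hjl hil hn hn' x y z =>
    induction x using ind; induction y using ind; induction z using ind
    exact sound (.ax _ _ (.upper η₁ η₂ h₁ h₂ h₃ h₃' h₂₃ h₁₃ hjl hil hn hn' _ _ _))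
  | lower η₁ η₂ h₁ h₁' h₂ h₃ h₁₂ h₁₃ hij hil hn hn' x y z =>
    induction x using ind; induction y using ind; induction z using ind
    exact sound (.ax _ _ (.lower η₁ η₂ h₁ h₁' h₂ h₃ h₁₂ h₁₃ hij hil hn hn' _ _ _))

end FreeProperad

/-! ## The quadratic operator is equivariant -/

namespace Splitting

variable {law : GenusLaw} {X Y : Corolla}

theorem eulerChar_congr {C C' D D' : Type} (ρ : C ≃ C') (σ : D ≃ D') (G : ℕ) :
    eulerChar C D G = eulerChar C' D' G := by
  rw [eulerChar, eulerChar, Nat.card_congr ρ, Nat.card_congr σ]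

/-- The bijection of a subset with its image. -/
def outEquiv (s : Set X.out) (ρ : X.out ≃ Y.out) : s ≃ ↥(ρ.symm ⁻¹' s) :=
  ρ.subtypeEquiv fun a => by simp

/-- The bijection of a subset with its image. -/
def inpEquiv (s : Set X.inp) (σ : X.inp ≃ Y.inp) : s ≃ ↥(σ.symm ⁻¹' s) :=
  σ.subtypeEquiv fun a => by simp

/-- Transport of a splitting along bijections. -/
def map (ρ : X.out ≃ Y.out) (σ : X.inp ≃ Y.inp) (hG : X.genus = Y.genus) (s : Splitting law X) :
    Splitting law Y where
  out₁ := ρ.symm ⁻¹' s.out₁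
  inp₁ := σ.symm ⁻¹' s.inp₁
  genus₁ := s.genus₁
  genus₂ := s.genus₂
  r := s.r
  stable₁ := by
    rw [← eulerChar_congr (outEquiv s.out₁ ρ)
      (Equiv.sumCongr (inpEquiv s.inp₁ σ) (Equiv.refl (Fin (s.r + 1))))]
    exact s.stable₁
  stable₂ := by
    rw [← Set.preimage_compl, ← Set.preimage_compl,
      ← eulerChar_congr (Equiv.sumCongr (outEquiv s.out₁ᶜ ρ) (Equiv.refl (Fin (s.r + 1))))
      (inpEquiv s.inp₁ᶜ σ)]
    exact s.stable₂
  genus_eq := s.genus_eq.trans hG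

/-- Transport of splittings is bijective. -/
def mapEquiv (ρ : X.out ≃ Y.out) (σ : X.inp ≃ Y.inp) (hG : X.genus = Y.genus) :
    Splitting law X ≃ Splitting law Y where
  toFun := map ρ σ hG
  invFun := map ρ.symm σ.symm hG.symm
  left_inv s := by
    ext <;> simp [map]
  right_inv s := by
    ext <;> simp [map]

end Splitting

namespace ProperadData

variable {K : Type k} [Field K] {law : GenusLaw}

theorem act_act_of_ax {Q : ProperadData.{k, u} K law}
    (hQ : ∀ {X : Corolla} {n : ℤ} (x y : Q.toOperations.obj X n), Q.toOperations.Axiom x y → x = y)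
    {X Y Z : Corolla} {n : ℤ} (ρ : X.out ≃ Y.out) (σ : X.inp ≃ Y.inp)
    (hG : X.genus = Y.genus) (ρ' : Y.out ≃ Z.out) (σ' : Y.inp ≃ Z.inp)
    (hG' : Y.genus = Z.genus) (x : Q.obj X n) :
    Q.act ρ' σ' hG' n (Q.act ρ σ hG n x) = Q.act (ρ.trans ρ') (σ.trans σ') (hG.trans hG') n x :=
  (hQ _ _ (Operations.Axiom.act_act (Q := Q.toOperations) ρ σ hG ρ' σ' hG' x)).symm

/-- The action of a pair of bijections as a linear equivalence. -/
def actEquiv {Q : ProperadData.{k, u} K law}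
    (hQ : ∀ {X : Corolla} {n : ℤ} (x y : Q.toOperations.obj X n), Q.toOperations.Axiom x y → x = y)
    {X Y : Corolla} (ρ : X.out ≃ Y.out) (σ : X.inp ≃ Y.inp) (hG : X.genus = Y.genus) (n : ℤ) :
    Q.obj X n ≃ₗ[K] Q.obj Y n :=
  LinearEquiv.ofLinearMap (Q.act ρ σ hG n) (Q.act ρ.symm σ.symm hG.symm n)
    (by
      ext x
      have := hQ _ _ (Operations.Axiom.act_id (Q := Q.toOperations) x)
      simp only [LinearMap.comp_apply, act_act_of_ax hQ, Equiv.symm_trans_self]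
      exact this)
    (by
      ext x
      have := hQ _ _ (Operations.Axiom.act_id (Q := Q.toOperations) x)
      simp only [LinearMap.comp_apply, act_act_of_ax hQ, Equiv.self_trans_symm]
      exact this)

end ProperadData

section

variable {K : Type k} [Field K] {law : GenusLaw} {X Y : Corolla}

open Classical in
theorem Splitting.act_comp {Q : ProperadData.{k, u} K law}
    (hQ : ∀ {X : Corolla} {n : ℤ} (x y : Q.toOperations.obj X n), Q.toOperations.Axiom x y → x = y)
    (ρ : X.out ≃ Y.out) (σ : X.inp ≃ Y.inp) (hG : X.genus = Y.genus)
    (s : Splitting law X) {i j n : ℤ} (hn : i + j = n)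
    (x : Q.obj s.left i) (y : Q.obj s.right j) :
    Q.act ρ σ hG n (s.comp Q hn (x ⊗ₜ y)) =
      (s.map ρ σ hG).comp Q hn
        (Q.act (X := s.left) (Y := (s.map ρ σ hG).left) (Splitting.outEquiv s.out₁ ρ)
            (Equiv.sumCongr (Splitting.inpEquiv s.inp₁ σ) (Equiv.refl _)) rfl i x ⊗ₜ
          Q.act (X := s.right) (Y := (s.map ρ σ hG).right)
            (Equiv.sumCongr (Splitting.outEquiv s.out₁ᶜ ρ) (Equiv.refl _))
            (Splitting.inpEquiv s.inp₁ᶜ σ) rfl j y) := by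
  have key := hQ _ _ (Operations.Axiom.equivariance (Q := Q.toOperations)
    (Equiv.refl (Fin (s.r + 1))) s.stable₁ s.stable₂ (s.map ρ σ hG).stable₁ (s.map ρ σ hG).stable₂
    (Splitting.outEquiv s.out₁ ρ) (Splitting.inpEquiv s.inp₁ σ) (Equiv.refl _)
    (Splitting.outEquiv s.out₁ᶜ ρ) (Equiv.refl _) (Splitting.inpEquiv s.inp₁ᶜ σ) hn x y)
  simp only [Splitting.comp, LinearMap.comp_apply, TensorProduct.lift.tmul]
  refine Eq.trans ?_ (congrArg (fun t => Q.act (X := ⟨(s.map ρ σ hG).out₁ ⊕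
      ↥((s.map ρ σ hG).out₁ᶜ), (s.map ρ σ hG).inp₁ ⊕ ↥((s.map ρ σ hG).inp₁ᶜ), _,
      law.stable (Equiv.refl (Fin (s.r + 1))) (s.map ρ σ hG).stable₁ (s.map ρ σ hG).stable₂⟩)
    (Y := Y) (Equiv.Set.sumCompl (s.map ρ σ hG).out₁)
    (Equiv.Set.sumCompl (s.map ρ σ hG).inp₁) (s.map ρ σ hG).genus_eq n t) key)
  erw [ProperadData.act_act_of_ax hQ, ProperadData.act_act_of_ax hQ]
  congr 2
  · ext a
    rcases a with a | a <;> rfl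
  · ext a
    rcases a with a | a <;> rfl

theorem Splitting.dualComp_dualAct {P : ProperadData.{k, u} K law} [P.FiniteDimensional]
    (hP : ∀ {X : Corolla} {n : ℤ} (x y : P.toOperations.obj X n), P.toOperations.Axiom x y → x = y)
    (ρ : X.out ≃ Y.out) (σ : X.inp ≃ Y.inp) (hG : X.genus = Y.genus)
    (s : Splitting law X) {i j n : ℤ} (hn : i + j = n) (φ : P.Dual X n) :
    (s.map ρ σ hG).dualComp P hn (P.dualAct ρ σ hG n φ) =
      TensorProduct.map
        (P.dualAct (X := s.left) (Y := (s.map ρ σ hG).left) (Splitting.outEquiv s.out₁ ρ)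
            (Equiv.sumCongr (Splitting.inpEquiv s.inp₁ σ) (Equiv.refl _)) rfl i)
        (P.dualAct (X := s.right) (Y := (s.map ρ σ hG).right)
            (Equiv.sumCongr (Splitting.outEquiv s.out₁ᶜ ρ) (Equiv.refl _))
            (Splitting.inpEquiv s.inp₁ᶜ σ) rfl j)
        (s.dualComp P hn φ) := by
  simp only [Splitting.dualComp, LinearMap.smul_apply, LinearMap.comp_apply, map_smul]
  congr 1
  have hmap : ∀ {M N M' N' : Type u} [AddCommGroup M] [Module K M] [AddCommGroup N] [Module K N]
      [AddCommGroup M'] [Module K M'] [AddCommGroup N'] [Module K N'] (f : M' →ₗ[K] M)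
      (g : N' →ₗ[K] N) (t : Module.Dual K M ⊗[K] Module.Dual K N),
      TensorProduct.dualDistrib K M' N' (TensorProduct.map f.dualMap g.dualMap t) =
        (TensorProduct.dualDistrib K M N t).comp (TensorProduct.map f g) := by
    intro M N M' N' _ _ _ _ _ _ _ _ f g t
    induction t with
    | zero => simp
    | add a b ha hb => simp only [map_add, ha, hb, LinearMap.add_comp]
    | tmul a b => ext x y; simp
  apply (TensorProduct.dualDistribEquiv K _ _).injective
  simp only [LinearEquiv.coe_coe, LinearEquiv.apply_symm_apply]
  have h2 : ∀ {M N : Type u} [AddCommGroup M] [Module K M] [AddCommGroup N] [Module K N]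
      [Module.Finite K M] [Module.Finite K N] (t : Module.Dual K M ⊗[K] Module.Dual K N),
      TensorProduct.dualDistribEquiv K M N t = TensorProduct.dualDistrib K M N t :=
    fun _ => rfl
  rw [h2]
  simp only [ProperadData.dualAct]
  rw [hmap, ← h2, LinearEquiv.apply_symm_apply]
  ext x y
  let eL := ProperadData.actEquiv hP (X := s.left) (Y := (s.map ρ σ hG).left)
    (Splitting.outEquiv s.out₁ ρ)
    (Equiv.sumCongr (Splitting.inpEquiv s.inp₁ σ) (Equiv.refl _)) rfl (-i)
  let eR := ProperadData.actEquiv hP (X := s.right) (Y := (s.map ρ σ hG).right)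
    (Equiv.sumCongr (Splitting.outEquiv s.out₁ᶜ ρ) (Equiv.refl _))
    (Splitting.inpEquiv s.inp₁ᶜ σ) rfl (-j)
  let e := ProperadData.actEquiv hP ρ σ hG (-n)
  have key := Splitting.act_comp hP ρ σ hG s (show -i + -j = -n by omega) (eL.symm x) (eR.symm y)
  have key' : e (s.comp P (show -i + -j = -n by omega) (eL.symm x ⊗ₜ eR.symm y)) =
      (s.map ρ σ hG).comp P (show -i + -j = -n by omega) (eL (eL.symm x) ⊗ₜ eR (eR.symm y)) := key
  rw [eL.apply_symm_apply, eR.apply_symm_apply] at key'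
  have key'' := congrArg e.symm key'
  rw [e.symm_apply_apply] at key''
  exact congrArg φ key''.symm

theorem act_quadraticTerm {P : ProperadData.{k, u} K law} [P.FiniteDimensional]
    (hP : ∀ {X : Corolla} {n : ℤ} (x y : P.toOperations.obj X n), P.toOperations.Axiom x y → x = y)
    {Q : ProperadData.{k, v} K law}
    (hQ : ∀ {X : Corolla} {n : ℤ} (x y : Q.toOperations.obj X n), Q.toOperations.Axiom x y → x = y)
    {α : DegreeOneMaps P Q} (hα : α.Equivariant)
    (ρ : X.out ≃ Y.out) (σ : X.inp ≃ Y.inp) (hG : X.genus = Y.genus)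
    (s : Splitting law X) {i j n m : ℤ} (hn : i + j = n) (hm : n + 2 = m) (φ : P.Dual X n) :
    Q.act ρ σ hG m (quadraticTerm P Q α X s hn hm φ) =
      quadraticTerm P Q α Y (s.map ρ σ hG) hn hm (P.dualAct ρ σ hG n φ) := by
  simp only [quadraticTerm, LinearMap.smul_apply, LinearMap.comp_apply, map_smul]
  rw [Splitting.dualComp_dualAct hP]
  refine congrArg (fun t => (((s.r + 1).factorial : K)⁻¹ * koszul K i) • t) ?_
  generalize s.dualComp P hn φ = t
  induction t with
  | zero => simp
  | add a b ha hb => simp only [map_add, ha, hb]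
  | tmul a b =>
    simp only [TensorProduct.map_tmul]
    rw [Splitting.act_comp hQ]
    exact congrArg₂ (fun a b => (s.map ρ σ hG).comp Q (show (i + 1) + (j + 1) = m by omega)
      (a ⊗ₜ b)) (hα _ _ _ _ _) (hα _ _ _ _ _)

theorem act_quadratic {P : ProperadData.{k, u} K law} [P.FiniteDimensional]
    (hP : ∀ {X : Corolla} {n : ℤ} (x y : P.toOperations.obj X n), P.toOperations.Axiom x y → x = y)
    {Q : ProperadData.{k, v} K law}
    (hQ : ∀ {X : Corolla} {n : ℤ} (x y : Q.toOperations.obj X n), Q.toOperations.Axiom x y → x = y)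
    {α : DegreeOneMaps P Q} (hα : α.Equivariant)
    (ρ : X.out ≃ Y.out) (σ : X.inp ≃ Y.inp) (hG : X.genus = Y.genus)
    {n m : ℤ} (hm : n + 2 = m) (φ : P.Dual X n) :
    Q.act ρ σ hG m (quadratic P Q α X hm φ) =
      quadratic P Q α Y hm (P.dualAct ρ σ hG n φ) := by
  let e := ProperadData.actEquiv hQ ρ σ hG m
  let f : P.Dual X n ≃ₗ[K] P.Dual Y n := (ProperadData.actEquiv hP ρ σ hG (-n)).symm.dualMap
  let Θ : (P.Dual X n →ₗ[K] Q.obj X m) ≃+ (P.Dual Y n →ₗ[K] Q.obj Y m) :=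
    (f.arrowCongr e).toAddEquiv
  have hΘ : ∀ g ψ, Θ g (f ψ) = e (g ψ) := fun g ψ => by
    simp [Θ, LinearEquiv.arrowCongr_apply]
  have key : Θ (quadratic P Q α X hm) = quadratic P Q α Y hm := by
    simp only [quadratic]
    rw [AddEquiv.map_finsum, ← finsum_comp_equiv (Splitting.mapEquiv ρ σ hG)]
    refine finsum_congr fun s => ?_
    rw [AddEquiv.map_finsum]
    refine finsum_congr fun i => ?_
    ext ψ
    obtain ⟨ψ, rfl⟩ := f.surjective ψ
    rw [hΘ]
    exact act_quadraticTerm hP hQ hα ρ σ hG s _ hm ψ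
  have := hΘ (quadratic P Q α X hm) φ
  rw [key] at this
  exact this.symm

end

/-! ## The cobar complex -/

namespace FreeProperad

variable {K : Type k} [Field K] {law : GenusLaw}

theorem dualD_dualAct (P : Properad.{k, u} K law)
    {X Y : Corolla} (ρ : X.out ≃ Y.out) (σ : X.inp ≃ Y.inp) (hG : X.genus = Y.genus)
    {n m : ℤ} (h : n + 1 = m) (φ : P.Dual X n) :
    P.dualD Y h (P.dualAct ρ σ hG n φ) = P.dualAct ρ σ hG m (P.dualD X h φ) := by
  ext x
  simp [ProperadData.dualD, ProperadData.dualAct, P.d_act]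

/-- The quadratic part `∑ (1 / |A|!) ∘ (↑ ⊗ ↑) (∘_P^# φ)` of the differential of a generator. -/
noncomputable def quadraticGen (P : ProperadData.{k, u} K law) [P.FiniteDimensional] (X : Corolla)
    {n m : ℤ} (h : n + 2 = m) : P.Dual X n →ₗ[K] FreeProperad P X m :=
  quadratic P (graded P) (fun _ _ _ h' => gen h') X h

/-- The derivation of degree `1` on formal expressions whose value on a generator `↑φ` is
`↑(d φ) + ∑ (1 / |A|!) ∘ (↑ ⊗ ↑) (∘_P^# φ)`. -/
noncomputable def termD (P : ProperadData.{k, u} K law) [P.FiniteDimensional] :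
    ∀ {X : Corolla} {n : ℤ}, FreeTerm P X n → FreeProperad P X (n + 1)
  | X, _, .gen (n := n) (m := m) h φ =>
      gen (n := m) rfl (P.dualD X h φ) +
        quadraticGen P X (show n + 2 = m + 1 by omega) φ
  | _, _, .zero => 0
  | _, _, .add x y => termD P x + termD P y
  | _, _, .smul c x => c • termD P x
  | _, _, .act ρ σ hG x => act ρ σ hG _ (termD P x)
  | _, _, @FreeTerm.comp _ _ _ _ _ _ _ _ _ _ _ _ _ _ _ _ _ η _ _ h₁ h₂ i j n hn x y =>
      comp η h₁ h₂ (show (i + 1) + j = n + 1 by omega) (termD P x) (mk y) +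
        koszul K i • comp η h₁ h₂ (show i + (j + 1) = n + 1 by omega) (mk x) (termD P y)

theorem koszul_add_one (n : ℤ) : koszul K (n + 1) = - koszul K n := by
  simp [koszul, Int.negOnePow_succ]

theorem koszul_add (n m : ℤ) : koszul K (n + m) = koszul K n * koszul K m := by
  simp [koszul, Int.negOnePow_add]

theorem koszul_mul_self (n : ℤ) : koszul K n * koszul K n = 1 := by
  rw [← koszul_add, koszul, Int.negOnePow_even _ (Even.add_self n)]; simp

theorem act_act' (P : ProperadData.{k, u} K law) {X Y Z : Corolla} {n : ℤ}
    (ρ : X.out ≃ Y.out) (σ : X.inp ≃ Y.inp)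
    (hG : X.genus = Y.genus) (ρ' : Y.out ≃ Z.out) (σ' : Y.inp ≃ Z.inp)
    (hG' : Y.genus = Z.genus) (x : FreeProperad P X n) :
    act (ρ.trans ρ') (σ.trans σ') (hG.trans hG') n x = act ρ' σ' hG' n (act ρ σ hG n x) :=
  ax _ _ (.act_act (Q := (graded P).toOperations) ρ σ hG ρ' σ' hG' x)

theorem act_id' (P : ProperadData.{k, u} K law) {X : Corolla} {n : ℤ} (x : FreeProperad P X n) :
    act (Equiv.refl X.out) (Equiv.refl X.inp) rfl n x = x :=
  ax _ _ (.act_id (Q := (graded P).toOperations) x)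

/-- The derivation is compatible with the axioms of a properad. -/
theorem termD_ax (P : Properad.{k, u} K law) [P.FiniteDimensional] {X : Corolla} {n : ℤ}
    (x y : (FreeTerm.operations P.toProperadData).obj X n)
    (h : (FreeTerm.operations P.toProperadData).Axiom x y) :
    termD P.toProperadData (x : FreeTerm P.toProperadData X n) =
      termD P.toProperadData (y : FreeTerm P.toProperadData X n) := by
  cases h with
  | act_id x => exact act_id' _ _
  | act_act ρ σ hG ρ' σ' hG' x => exact act_act' _ _ _ _ _ _ _ _
  | equivariance η h₁ h₂ h₁' h₂' ρ₁ σ₁ σB ρ₂ ρA σ₂ hn x y =>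
    have e1 := ax _ _ (.equivariance (Q := (graded P.toProperadData).toOperations)
      η h₁ h₂ h₁' h₂' ρ₁ σ₁ σB ρ₂ ρA σ₂ (n := n + 1) (by omega) (termD _ x) (mk y))
    have e2 := ax _ _ (.equivariance (Q := (graded P.toProperadData).toOperations)
      η h₁ h₂ h₁' h₂' ρ₁ σ₁ σB ρ₂ ρA σ₂ (n := n + 1) (by omega) (mk x) (termD _ y))
    simp only [ProperadData.toOperations, graded] at e1 e2
    simp only [FreeTerm.operations, termD, map_add, map_smul]
    rw [e1, e2]
    rfl
  | assoc η₁ η₂ η₃ h₁ h₁' h₂ h₃ h₃' h₁₂ h₂₃ hij hjl hn hn' x y z =>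
    rename_i i j l ij jl
    have e1 := ax _ _ (.assoc (Q := (graded P.toProperadData).toOperations)
      η₁ η₂ η₃ h₁ h₁' h₂ h₃ h₃' h₁₂ h₂₃ (n := n + 1) (show (i + 1) + j = ij + 1 by omega) hjl
      (by omega) (by omega) (termD _ x) (mk y) (mk z))
    have e2 := ax _ _ (.assoc (Q := (graded P.toProperadData).toOperations)
      η₁ η₂ η₃ h₁ h₁' h₂ h₃ h₃' h₁₂ h₂₃ (n := n + 1) (show i + (j + 1) = ij + 1 by omega)
      (show (j + 1) + l = jl + 1 by omega) (by omega) (by omega) (mk x) (termD _ y) (mk z))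
    have e3 := ax _ _ (.assoc (Q := (graded P.toProperadData).toOperations)
      η₁ η₂ η₃ h₁ h₁' h₂ h₃ h₃' h₁₂ h₂₃ (n := n + 1) hij
      (show j + (l + 1) = jl + 1 by omega) (by omega) (by omega) (mk x) (mk y) (termD _ z))
    subst hij
    simp only [ProperadData.toOperations, graded] at e1 e2 e3
    simp only [FreeTerm.operations, termD, map_add, map_smul, LinearMap.add_apply,
      LinearMap.smul_apply, koszul_add, smul_add, smul_smul]
    rw [← add_assoc]
    exact congrArg₂ (· + ·) (congrArg₂ (· + ·) e1 (congrArg (koszul K i • ·) e2))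
      (congrArg ((koszul K i * koszul K j) • ·) e3)
  | upper η₁ η₂ h₁ h₂ h₃ h₃' h₂₃ h₁₃ hjl hil hn hn' x y z =>
    rename_i i j l il jl
    have e1 := ax _ _ (.upper (Q := (graded P.toProperadData).toOperations)
      η₁ η₂ h₁ h₂ h₃ h₃' h₂₃ h₁₃ (n := n + 1) hjl (show (i + 1) + l = il + 1 by omega)
      (by omega) (by omega) (termD _ x) (mk y) (mk z))
    have e2 := ax _ _ (.upper (Q := (graded P.toProperadData).toOperations)
      η₁ η₂ h₁ h₂ h₃ h₃' h₂₃ h₁₃ (n := n + 1) (show (j + 1) + l = jl + 1 by omega) hil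
      (by omega) (by omega) (mk x) (termD _ y) (mk z))
    have e3 := ax _ _ (.upper (Q := (graded P.toProperadData).toOperations)
      η₁ η₂ h₁ h₂ h₃ h₃' h₂₃ h₁₃ (n := n + 1) (show j + (l + 1) = jl + 1 by omega)
      (show i + (l + 1) = il + 1 by omega) (by omega) (by omega) (mk x) (mk y) (termD _ z))
    simp only [ProperadData.toOperations, graded] at e1 e2 e3
    simp only [FreeTerm.operations, termD, map_add, map_smul,
      smul_add, smul_smul]
    refine (congrArg₂ (· + ·) e1 (congrArg₂ (· + ·) (congrArg (koszul K i • ·) e2)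
      (congrArg ((koszul K i * koszul K j) • ·) e3))).trans ?_
    simp only [smul_smul]
    have s1 : koszul K ((i + 1) * j) = koszul K (i * j) * koszul K j := by
      rw [add_mul, one_mul, koszul_add]
    have s2 : koszul K i * koszul K (i * (j + 1)) = koszul K (i * j) := by
      rw [mul_add, mul_one, koszul_add, mul_left_comm, koszul_mul_self, mul_one]
    rw [s1, s2]
    rw [add_left_comm]
    refine congrArg₂ (· + ·) rfl (congrArg₂ (· + ·) rfl (congrArg₂ (· • ·) ?_ rfl))
    ring
  | lower η₁ η₂ h₁ h₁' h₂ h₃ h₁₂ h₁₃ hij hil hn hn' x y z =>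
    rename_i i j l ij il
    have e1 := ax _ _ (.lower (Q := (graded P.toProperadData).toOperations)
      η₁ η₂ h₁ h₁' h₂ h₃ h₁₂ h₁₃ (n := n + 1) (show (i + 1) + j = ij + 1 by omega)
      (show (i + 1) + l = il + 1 by omega) (by omega) (by omega) (termD _ x) (mk y) (mk z))
    have e2 := ax _ _ (.lower (Q := (graded P.toProperadData).toOperations)
      η₁ η₂ h₁ h₁' h₂ h₃ h₁₂ h₁₃ (n := n + 1) (show i + (j + 1) = ij + 1 by omega) hil
      (by omega) (by omega) (mk x) (termD _ y) (mk z))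
    have e3 := ax _ _ (.lower (Q := (graded P.toProperadData).toOperations)
      η₁ η₂ h₁ h₁' h₂ h₃ h₁₂ h₁₃ (n := n + 1) hij (show i + (l + 1) = il + 1 by omega)
      (by omega) (by omega) (mk x) (mk y) (termD _ z))
    subst hij hil
    simp only [ProperadData.toOperations, graded] at e1 e2 e3
    simp only [FreeTerm.operations, termD, map_add, map_smul, LinearMap.add_apply,
      LinearMap.smul_apply, koszul_add, smul_add, smul_smul]
    refine (congrArg₂ (· + ·) (congrArg₂ (· + ·) e1 (congrArg (koszul K i • ·) e2))
      (congrArg ((koszul K i * koszul K j) • ·) e3)).trans ?_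
    simp only [smul_smul]
    have s1 : koszul K i * koszul K ((j + 1) * l) =
        koszul K (j * l) * (koszul K i * koszul K l) := by
      rw [add_mul, one_mul, koszul_add]; ring
    have s2 : koszul K i * koszul K j * koszul K (j * (l + 1)) =
        koszul K (j * l) * koszul K i := by
      rw [mul_add, mul_one, koszul_add,
        show koszul K i * koszul K j * (koszul K (j * l) * koszul K j) =
          koszul K (j * l) * koszul K i * (koszul K j * koszul K j) by ring, koszul_mul_self, mul_one]
    rw [s1, s2, add_right_comm]
    rfl

/-- The derivation descends to the free properad. -/
theorem termD_sound (P : Properad.{k, u} K law) [P.FiniteDimensional] {X : Corolla} {n : ℤ}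
    {x y : FreeTerm P.toProperadData X n} (h : FreeTerm.Rel P.toProperadData x y) :
    termD P.toProperadData x = termD P.toProperadData y := by
  induction h with
  | refl x => rfl
  | symm _ ih => exact ih.symm
  | trans _ _ ih ih' => exact ih.trans ih'
  | add _ _ ih ih' => simp only [termD, ih, ih']
  | smul c _ ih => simp only [termD, ih]
  | act ρ σ hG _ ih => simp only [termD, ih]
  | comp η h₁ h₂ hn hx hy ih ih' => simp only [termD, ih, ih', sound hx, sound hy]
  | add_assoc x y z => simp only [termD, add_assoc]
  | add_comm x y => simp only [termD, add_comm]
  | zero_add x => simp only [termD, zero_add]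
  | one_smul x => simp only [termD, one_smul]
  | mul_smul a b x => simp only [termD, mul_smul]
  | smul_add a x y => simp only [termD, smul_add]
  | add_smul a b x => simp only [termD, add_smul]
  | zero_smul x => simp only [termD, zero_smul]
  | act_add ρ σ hG x y => simp only [termD, map_add]
  | act_smul ρ σ hG c x => simp only [termD, map_smul]
  | add_comp η h₁ h₂ hn x x' y =>
    simp only [termD, mk_add, map_add, LinearMap.add_apply, smul_add]
    exact add_add_add_comm _ _ _ _
  | smul_comp η h₁ h₂ hn c x y =>
    simp only [termD, mk_smul, map_smul, LinearMap.smul_apply, smul_add]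
    rw [smul_comm c]
  | comp_add η h₁ h₂ hn x y y' =>
    simp only [termD, mk_add, map_add, smul_add]
    exact add_add_add_comm _ _ _ _
  | comp_smul η h₁ h₂ hn c x y =>
    simp only [termD, mk_smul, map_smul, smul_add]
    rw [smul_comm c]
  | ax x y h => exact termD_ax P x y h
  | gen_add h φ ψ =>
    simp only [termD, map_add]
    exact add_add_add_comm _ _ _ _
  | gen_smul h c φ => simp only [termD, map_smul, smul_add]
  | gen_act ρ σ hG h φ =>
    simp only [termD, map_add, gen_equivariant, dualD_dualAct]
    congr 1
    exact act_quadratic (Q := graded P.toProperadData) P.ax ax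
      (fun ρ σ hG _ _ h φ => gen_equivariant ρ σ hG h φ) ρ σ hG _ φ

/-- The differential `∂` of the cobar complex: the derivation of degree `1` of the free properad
with `∂ ↑φ = ↑(d φ) + ∑ (1 / |A|!) ∘ (↑ ⊗ ↑) (∘_P^# φ)`. -/
noncomputable def d (P : Properad.{k, u} K law) [P.FiniteDimensional] (X : Corolla) {n m : ℤ}
    (h : n + 1 = m) : FreeProperad P.toProperadData X n →ₗ[K] FreeProperad P.toProperadData X m where
  toFun := Quotient.lift (fun x => h ▸ termD P.toProperadData x)
    fun x y hxy => by subst h; exact termD_sound P hxy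
  map_add' x y := by
    subst h
    induction x using ind; induction y using ind
    rfl
  map_smul' c x := by
    subst h
    induction x using ind
    rfl

end FreeProperad

/-- The cobar complex `C P`: the free properad generated by the suspended dual of `P`, with the
differential induced by the differential of `P` and the duals of the compositions of `P`. -/
noncomputable def cobar {K : Type k} [Field K] {law : GenusLaw} (P : Properad.{k, u} K law)
    [P.FiniteDimensional] : ProperadData.{k, max 1 k u} K law where
  obj := FreeProperad P.toProperadData
  d := FreeProperad.d P
  act := FreeProperad.act
  comp := FreeProperad.comp

/-! ## Unordered tensor products -/

/-- The total space of a dg vector space. -/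
abbrev DGTotal {K : Type k} [Field K] (V : CochainComplex (ModuleCat.{w} K) ℤ) : Type w :=
  ⨁ n : ℤ, V.X n

namespace DGTotal

variable {K : Type k} [Field K] (V : CochainComplex (ModuleCat.{w} K) ℤ)

/-- The element of the total space given by a homogeneous element. -/
abbrev of (n : ℤ) : V.X n →ₗ[K] DGTotal V := DirectSum.lof K ℤ (fun n => V.X n) n

/-- The projection to the part of odd degree (`b = true`) or of even degree (`b = false`). -/
def parityProj (b : Bool) : DGTotal V →ₗ[K] DGTotal V :=
  DirectSum.toModule K ℤ _ fun n => if decide (Odd n) = b then of V n else 0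

/-- The linear map `v ↦ (-1) ^ (j |v|) v`. -/
def sign (j : ℤ) : DGTotal V →ₗ[K] DGTotal V :=
  DirectSum.toModule K ℤ _ fun n => koszul K (j * n) • of V n

/-- The differential. -/
def d : DGTotal V →ₗ[K] DGTotal V :=
  DirectSum.toModule K ℤ _ fun n => (of V (n + 1)).comp (V.d n (n + 1)).hom

end DGTotal

/-- The orderings `ω` of a finite set; `ω c` is the position of `c`. -/
abbrev Arrangement (C : Type) : Type := C ≃ Fin (Nat.card C)

/-- The Koszul sign of the change from the ordering `ω` to the ordering `ω'` of elements indexed by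
`c ∈ C`, which are odd where `ε c = true`: a factor `-1` for every pair of odd elements whose order
changes. -/
noncomputable def reorderSign (K : Type k) [Field K] {C : Type} (ω ω' : Arrangement C)
    (ε : C → Bool) : K :=
  ∏ᶠ p : Sym2 C, p.lift ⟨fun c c' =>
    if ε c = true ∧ ε c' = true ∧ ¬ (ω c < ω c' ↔ ω' c < ω' c') then -1 else 1, fun c c' => by
      by_cases h : c = c'
      · subst h; rfl
      · have h1 : ω c ≠ ω c' := fun e => h (ω.injective e)
        have h2 : ω' c ≠ ω' c' := fun e => h (ω'.injective e)
        have h3 : (ω c < ω c' ↔ ω' c < ω' c') ↔ (ω c' < ω c ↔ ω' c' < ω' c) := by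
          rcases lt_or_gt_of_ne h1 with h1 | h1 <;> rcases lt_or_gt_of_ne h2 with h2 | h2 <;>
            simp [h1, h2, h1.not_gt, h2.not_gt]
        simp only [h3]
        congr 1
        exact propext and_left_comm⟩

section Unordered

variable {K : Type k} [Field K] (V : CochainComplex (ModuleCat.{w} K) ℤ)

/-- The tensor product of the copies `V_c = V`, `c ∈ C`. -/
abbrev TensorOver (C : Type) : Type (max k w) := ⨂[K] _ : C, DGTotal V

/-- The map of tensor products which multiplies a tensor of homogeneous elements by the Koszul sign
of the change from the ordering `ω` to the ordering `ω'`. -/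
noncomputable def reorder {C : Type} (ω ω' : Arrangement C) : TensorOver V C →ₗ[K] TensorOver V C :=
  ∑ᶠ ε : C → Bool, reorderSign K ω ω' ε •
    PiTensorProduct.map (R := K) fun c => DGTotal.parityProj V (ε c)

/-- The identifications that define the unordered tensor product. A pair of an ordering `ω` of `C`
and a tensor `⨂_c v_c` stands for the tensor in which the factors `v_c` are arranged in the order
`ω`; it is identified with the arrangement in any other order, up to the Koszul sign. -/
noncomputable def unorderedRelations (C : Type) : Submodule K (Arrangement C →₀ TensorOver V C) :=
  Submodule.span K {r | ∃ (ω ω' : Arrangement C) (t : TensorOver V C),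
    r = Finsupp.single ω t - Finsupp.single ω' (reorder V ω ω' t)}

/-- The unordered tensor product `⨀_C V`. -/
abbrev Unordered (C : Type) : Type (max k w) :=
  (Arrangement C →₀ TensorOver V C) ⧸ unorderedRelations V C

namespace Unordered

/-- The class of a tensor with its factors arranged in the order `ω`. -/
noncomputable def mk {C : Type} (ω : Arrangement C) : TensorOver V C →ₗ[K] Unordered V C :=
  (unorderedRelations V C).mkQ.comp (Finsupp.lsingle ω)

theorem mk_reorder {C : Type} (ω ω' : Arrangement C) (t : TensorOver V C) :
    mk V ω' (reorder V ω ω' t) = mk V ω t := by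
  symm
  rw [← sub_eq_zero]
  simp only [mk, LinearMap.comp_apply, Finsupp.lsingle_apply, ← map_sub]
  rw [Submodule.mkQ_apply, Submodule.Quotient.mk_eq_zero]
  exact Submodule.subset_span ⟨ω, ω', t, rfl⟩

theorem parityProj_parityProj (b b' : Bool) (x : DGTotal V) :
    DGTotal.parityProj V b (DGTotal.parityProj V b' x) =
      if b = b' then DGTotal.parityProj V b x else 0 := by
  have : (DGTotal.parityProj V b).comp (DGTotal.parityProj V b') =
      if b = b' then DGTotal.parityProj V b else 0 := by
    apply DirectSum.linearMap_ext
    intro n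
    ext v
    simp only [LinearMap.comp_apply, DGTotal.parityProj, DirectSum.toModule_lof]
    by_cases h : b = b'
    · subst h
      by_cases h' : decide (Odd n) = b
      · simp [h', DirectSum.toModule_lof]
      · simp [h', DirectSum.toModule_lof]
    · by_cases h' : decide (Odd n) = b'
      · have h'' : ¬ decide (Odd n) = b := fun e => h (e.symm.trans h')
        simp only [h', h]
        simp [DirectSum.toModule_lof, h'']
      · simp [h', h]
  have := LinearMap.congr_fun this x
  rw [LinearMap.comp_apply] at this
  rw [this]
  split_ifs <;> rfl

variable {V}

theorem reorder_tprod_of {C : Type} [Finite C] (ω ω' : Arrangement C) (δ : C → ℤ)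
    (v : ∀ c, V.X (δ c)) :
    reorder V ω ω' (PiTensorProduct.tprod K fun c => DGTotal.of V (δ c) (v c)) =
      reorderSign K ω ω' (fun c => decide (Odd (δ c))) •
        PiTensorProduct.tprod K fun c => DGTotal.of V (δ c) (v c) := by
  classical
  have := Fintype.ofFinite C
  rw [reorder, finsum_eq_sum_of_fintype, LinearMap.sum_apply,
    Finset.sum_eq_single (fun c => decide (Odd (δ c)))]
  · simp only [LinearMap.smul_apply, PiTensorProduct.map_tprod]
    congr 2
    funext c
    simp [DGTotal.parityProj, DirectSum.toModule_lof]
  · intro ε _ hε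
    obtain ⟨c, hc⟩ := Function.ne_iff.mp hε
    simp only [LinearMap.smul_apply, PiTensorProduct.map_tprod]
    rw [(PiTensorProduct.tprod K).map_coord_zero c, smul_zero]
    simp [DGTotal.parityProj, DirectSum.toModule_lof, Ne.symm hc]
  · simp

theorem tensorOver_ext {C : Type} [Finite C] {M : Type*} [AddCommGroup M] [Module K M]
    {f g : TensorOver V C →ₗ[K] M}
    (h : ∀ (δ : C → ℤ) (v : ∀ c, V.X (δ c)),
      f (PiTensorProduct.tprod K fun c => DGTotal.of V (δ c) (v c)) =
        g (PiTensorProduct.tprod K fun c => DGTotal.of V (δ c) (v c))) : f = g := by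
  apply PiTensorProduct.ext
  apply MultilinearMap.directSum_ext
  intro δ
  ext v
  exact h δ v

theorem reorderSign_mul {C : Type} [Finite C] (ω ω' ω'' : Arrangement C) (ε : C → Bool) :
    reorderSign K ω ω' ε * reorderSign K ω' ω'' ε = reorderSign K ω ω'' ε := by
  classical
  have := Fintype.ofFinite C
  simp only [reorderSign, finprod_eq_prod_of_fintype, ← Finset.prod_mul_distrib]
  refine Finset.prod_congr rfl fun p _ => ?_
  induction p with
  | _ c c' =>
    simp only [Sym2.lift_mk]
    by_cases h : ε c = true <;> by_cases h' : ε c' = true <;> simp only [h, h', true_and,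
      false_and, if_false, mul_one, Bool.false_eq_true]
    by_cases h1 : ω c < ω c' <;> by_cases h2 : ω' c < ω' c' <;> by_cases h3 : ω'' c < ω'' c' <;>
      simp [h1, h2, h3]

theorem reorderSign_self {C : Type} (ω : Arrangement C) (ε : C → Bool) :
    reorderSign K ω ω ε = 1 := by
  rw [reorderSign]
  refine (finprod_congr fun p => ?_).trans finprod_one
  induction p with
  | _ c c' => simp

theorem reorder_reorder {C : Type} [Finite C] (ω ω' ω'' : Arrangement C) (t : TensorOver V C) :
    reorder V ω' ω'' (reorder V ω ω' t) = reorder V ω ω'' t := by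
  have : (reorder V ω' ω'').comp (reorder V ω ω') = reorder V ω ω'' := by
    apply tensorOver_ext
    intro δ v
    rw [LinearMap.comp_apply, reorder_tprod_of, map_smul, reorder_tprod_of, reorder_tprod_of,
      smul_smul, reorderSign_mul]
  exact LinearMap.congr_fun this t

theorem reorder_self {C : Type} [Finite C] (ω : Arrangement C) (t : TensorOver V C) :
    reorder V ω ω t = t := by
  have : reorder V ω ω = LinearMap.id := by
    apply tensorOver_ext
    intro δ v
    rw [reorder_tprod_of, reorderSign_self, one_smul, LinearMap.id_apply]
  exact LinearMap.congr_fun this t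

variable (V)

/-- For every order `ω` of the factors, the unordered tensor product is canonically isomorphic to
the tensor product of the copies of `V`. -/
noncomputable def arrange {C : Type} [Finite C] (ω : Arrangement C) :
    TensorOver V C ≃ₗ[K] Unordered V C :=
  LinearEquiv.ofLinearMap (mk V ω)
    ((unorderedRelations V C).liftQ (Finsupp.lsum K fun ω' => reorder V ω' ω) (by
      rw [unorderedRelations, Submodule.span_le]
      rintro _ ⟨ω₁, ω₂, t, rfl⟩
      rw [SetLike.mem_coe, LinearMap.mem_ker, map_sub, Finsupp.lsum_single, Finsupp.lsum_single,
        reorder_reorder, sub_self]))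
    (by
      apply Submodule.linearMap_qext
      apply Finsupp.lhom_ext
      intro ω' t
      rw [LinearMap.comp_apply, LinearMap.comp_apply, Submodule.mkQ_apply,
        Submodule.liftQ_apply, Finsupp.lsum_single, mk_reorder]
      rfl)
    (by
      ext t
      simp [mk, reorder_self])

@[simp]
theorem arrange_apply {C : Type} [Finite C] (ω : Arrangement C) (t : TensorOver V C) :
    arrange V ω t = mk V ω t := rfl

theorem arrange_symm_mk {C : Type} [Finite C] (ω ω' : Arrangement C) (t : TensorOver V C) :
    (arrange V ω).symm (mk V ω' t) = reorder V ω' ω t := by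
  rw [LinearEquiv.symm_apply_eq, arrange_apply, mk_reorder]

/-- A chosen arrangement of a finite set. None of the notions below depends on the choice. -/
noncomputable def someArrangement (C : Type) [Finite C] : Arrangement C :=
  Finite.equivFin C

/-- The arrangement of `C ⊔ C'` in which the elements of `C` come first. -/
noncomputable def sumArrangement {C C' : Type} [Finite C] [Finite C'] (ω : Arrangement C)
    (ω' : Arrangement C') : Arrangement (C ⊕ C') :=
  ((Equiv.sumCongr ω ω').trans finSumFinEquiv).trans (finCongr Nat.card_sum.symm)

/-- The arrangement of `C'` that corresponds to an arrangement of `C` under a bijection. -/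
noncomputable def mapArrangement {C C' : Type} (e : C ≃ C') (ω : Arrangement C) : Arrangement C' :=
  (e.symm.trans ω).trans (finCongr (Nat.card_congr e))

/-- The map `⨀_C V → ⨀_{C'} V` given by a bijection `C ≃ C'`. -/
noncomputable def relabel {C C' : Type} [Finite C] (e : C ≃ C') :
    Unordered V C →ₗ[K] Unordered V C' :=
  (mk V (mapArrangement e (someArrangement C))).comp
    ((PiTensorProduct.reindex K (fun _ : C => DGTotal V) e).toLinearMap.comp
      (arrange V (someArrangement C)).symm.toLinearMap)

/-- The canonical isomorphism `⨀_C V ⊗ ⨀_{C'} V ≅ ⨀_{C ⊔ C'} V`. -/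
noncomputable def prodEquiv (C C' : Type) [Finite C] [Finite C'] :
    Unordered V C ⊗[K] Unordered V C' ≃ₗ[K] Unordered V (C ⊕ C') :=
  ((TensorProduct.congr (arrange V (someArrangement C)).symm
      (arrange V (someArrangement C')).symm).trans
    (PiTensorProduct.tmulEquiv K (DGTotal V))).trans
    (arrange V (sumArrangement (someArrangement C) (someArrangement C')))

/-- The elements of degree `n`: the linear combinations of tensors of homogeneous elements whose
degrees have the sum `n`. -/
noncomputable def degree (C : Type) (n : ℤ) : Submodule K (Unordered V C) :=
  Submodule.span K {t | ∃ (ω : Arrangement C) (δ : C → ℤ) (v : ∀ c, V.X (δ c)),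
    ∑ᶠ c, δ c = n ∧ t = mk V ω (PiTensorProduct.tprod K fun c => DGTotal.of V (δ c) (v c))}

/-- The linear map `t ↦ (-1) ^ (j |t|) t`. -/
noncomputable def sign (C : Type) [Finite C] (j : ℤ) : Unordered V C →ₗ[K] Unordered V C :=
  (mk V (someArrangement C)).comp
    ((PiTensorProduct.map (R := K) fun _ : C => DGTotal.sign V j).comp
      (arrange V (someArrangement C)).symm.toLinearMap)

open Classical in
/-- The differential: the sum over all `c ∈ C` of the differential of `V` applied to the factor
with index `c`, with the Koszul sign of the factors in front of it. -/
noncomputable def d (C : Type) [Finite C] : Unordered V C →ₗ[K] Unordered V C :=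
  (mk V (someArrangement C)).comp
    ((∑ᶠ c : C, PiTensorProduct.map (R := K) fun c' : C =>
        if c' = c then DGTotal.d V
        else if someArrangement C c' < someArrangement C c then DGTotal.sign V 1
        else LinearMap.id).comp
      (arrange V (someArrangement C)).symm.toLinearMap)

theorem mk_mem_degree {C : Type} (ω : Arrangement C) (δ : C → ℤ) (v : ∀ c, V.X (δ c)) {n : ℤ}
    (hn : ∑ᶠ c, δ c = n) :
    mk V ω (PiTensorProduct.tprod K fun c => DGTotal.of V (δ c) (v c)) ∈ degree V C n :=
  Submodule.subset_span ⟨ω, δ, v, hn, rfl⟩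

/-- A linear map has degree `m` if it has this degree on the tensors of homogeneous elements in a
given arrangement. -/
theorem degree_le_comap {C : Type} [Finite C] (ω : Arrangement C) {M : Type*} [AddCommGroup M]
    [Module K M] (f : Unordered V C →ₗ[K] M) (n : ℤ) (N : Submodule K M)
    (h : ∀ (δ : C → ℤ) (v : ∀ c, V.X (δ c)), ∑ᶠ c, δ c = n →
      f (mk V ω (PiTensorProduct.tprod K fun c => DGTotal.of V (δ c) (v c))) ∈ N) :
    degree V C n ≤ N.comap f := by
  rw [degree, Submodule.span_le]
  rintro _ ⟨ω', δ, v, hn, rfl⟩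
  rw [SetLike.mem_coe, Submodule.mem_comap, ← mk_reorder V ω' ω, reorder_tprod_of, map_smul,
    map_smul]
  exact N.smul_mem _ (h δ v hn)

theorem relabel_degree {C C' : Type} [Finite C] (e : C ≃ C') (n : ℤ) :
    degree V C n ≤ (degree V C' n).comap (relabel V e) := by
  apply degree_le_comap V (someArrangement C)
  intro δ v hn
  simp only [relabel, LinearMap.comp_apply, LinearEquiv.coe_coe, arrange_symm_mk, reorder_self,
    PiTensorProduct.reindex_tprod]
  exact mk_mem_degree V _ (fun c => δ (e.symm c)) (fun c => v (e.symm c))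
    ((finsum_comp_equiv e.symm).trans hn)

theorem total_sign_of (j n : ℤ) (v : V.X n) :
    DGTotal.sign V j (DGTotal.of V n v) = DGTotal.of V n (koszul K (j * n) • v) := by
  simp [DGTotal.sign, DirectSum.toModule_lof]

theorem total_d_of (n : ℤ) (v : V.X n) :
    DGTotal.d V (DGTotal.of V n v) = DGTotal.of V (n + 1) (V.d n (n + 1) v) := by
  simp [DGTotal.d, DirectSum.toModule_lof]

theorem sign_degree (C : Type) [Finite C] (j n : ℤ) :
    degree V C n ≤ (degree V C n).comap (sign V C j) := by
  apply degree_le_comap V (someArrangement C)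
  intro δ v hn
  simp only [sign, LinearMap.comp_apply, LinearEquiv.coe_coe, arrange_symm_mk, reorder_self,
    PiTensorProduct.map_tprod, total_sign_of]
  exact mk_mem_degree V _ δ _ hn

theorem d_degree (C : Type) [Finite C] {n m : ℤ} (hm : n + 1 = m) :
    degree V C n ≤ (degree V C m).comap (d V C) := by
  classical
  have := Fintype.ofFinite C
  apply degree_le_comap V (someArrangement C)
  intro δ v hn
  simp only [d, LinearMap.comp_apply, LinearEquiv.coe_coe, arrange_symm_mk, reorder_self,
    finsum_eq_sum_of_fintype, LinearMap.sum_apply, PiTensorProduct.map_tprod, map_sum]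
  refine Submodule.sum_mem _ fun c _ => ?_
  have h : ∀ c', ∃ w : V.X (if c' = c then δ c' + 1 else δ c'),
      (if c' = c then DGTotal.d V
        else if someArrangement C c' < someArrangement C c then DGTotal.sign V 1
        else LinearMap.id) (DGTotal.of V (δ c') (v c')) = DGTotal.of V _ w := by
    intro c'
    by_cases h1 : c' = c
    · rw [if_pos h1, if_pos h1]
      exact ⟨_, total_d_of V _ _⟩
    · rw [if_neg h1, if_neg h1]
      split_ifs
      · exact ⟨_, total_sign_of V _ _ _⟩
      · exact ⟨_, rfl⟩
  choose w hw using h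
  simp only [hw]
  refine mk_mem_degree V _ _ w ?_
  rw [finsum_eq_sum_of_fintype] at hn ⊢
  have : ∀ c', (if c' = c then δ c' + 1 else δ c') = δ c' + if c' = c then 1 else 0 := by
    intro c'; split_ifs <;> simp
  simp only [this, Finset.sum_add_distrib, hn]
  simpa using hm

theorem prodEquiv_degree (C C' : Type) [Finite C] [Finite C'] {i j n : ℤ} (hn : i + j = n)
    {x : Unordered V C} (hx : x ∈ degree V C i) {y : Unordered V C'} (hy : y ∈ degree V C' j) :
    prodEquiv V C C' (x ⊗ₜ y) ∈ degree V (C ⊕ C') n := by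
  have := Fintype.ofFinite C
  have := Fintype.ofFinite C'
  refine degree_le_comap V (someArrangement C)
    ((prodEquiv V C C').toLinearMap.comp ((TensorProduct.mk K _ _).flip y)) i
    (degree V (C ⊕ C') n) ?_ hx
  intro δ v hi
  refine degree_le_comap V (someArrangement C')
    ((prodEquiv V C C').toLinearMap.comp (TensorProduct.mk K _ _ _)) j
    (degree V (C ⊕ C') n) ?_ hy
  intro δ' v' hj
  simp only [prodEquiv, LinearMap.comp_apply, LinearEquiv.coe_coe, TensorProduct.mk_apply,
    LinearEquiv.trans_apply, TensorProduct.congr_tmul, arrange_symm_mk, reorder_self,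
    PiTensorProduct.tmulEquiv_apply, arrange_apply]
  have := mk_mem_degree V (sumArrangement (someArrangement C) (someArrangement C'))
    (Sum.elim δ δ') (fun c => match c with | .inl c => v c | .inr c => v' c) (n := n) (by
      rw [finsum_eq_sum_of_fintype] at hi hj ⊢
      simp [hi, hj, hn])
  convert this using 3
  funext c
  cases c <;> rfl

theorem prodEquiv_symm_degree (C C' : Type) [Finite C] [Finite C'] (n : ℤ) {M : Type*}
    [AddCommGroup M] [Module K M] (f : Unordered V C ⊗[K] Unordered V C' →ₗ[K] M)
    (N : Submodule K M)
    (h : ∀ (i j : ℤ) (_ : i + j = n), ∀ x ∈ degree V C i, ∀ y ∈ degree V C' j, f (x ⊗ₜ y) ∈ N) :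
    degree V (C ⊕ C') n ≤ N.comap (f.comp (prodEquiv V C C').symm.toLinearMap) := by
  have := Fintype.ofFinite C
  have := Fintype.ofFinite C'
  apply degree_le_comap V (sumArrangement (someArrangement C) (someArrangement C'))
  intro δ v hn
  have : (prodEquiv V C C').symm (mk V (sumArrangement (someArrangement C) (someArrangement C'))
      (PiTensorProduct.tprod K fun c => DGTotal.of V (δ c) (v c))) =
      mk V (someArrangement C)
        (PiTensorProduct.tprod K fun c => DGTotal.of V (δ (.inl c)) (v (.inl c))) ⊗ₜ
      mk V (someArrangement C')
        (PiTensorProduct.tprod K fun c => DGTotal.of V (δ (.inr c)) (v (.inr c))) := by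
    rw [LinearEquiv.symm_apply_eq]
    simp only [prodEquiv, LinearEquiv.trans_apply, TensorProduct.congr_tmul, arrange_symm_mk,
      reorder_self, PiTensorProduct.tmulEquiv_apply, arrange_apply]
    congr 2
    funext c
    cases c <;> rfl
  rw [LinearMap.comp_apply, LinearEquiv.coe_coe, this]
  refine h (∑ᶠ c, δ (.inl c)) (∑ᶠ c, δ (.inr c)) ?_ _ (mk_mem_degree V _ _ _ rfl) _
    (mk_mem_degree V _ _ _ rfl)
  rw [finsum_eq_sum_of_fintype] at hn ⊢
  rw [finsum_eq_sum_of_fintype, ← hn, Fintype.sum_sum_type]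

/-- The linear maps `⨀_D V → ⨀_C V` of degree `n`. -/
noncomputable def homDegree (D C : Type) (n : ℤ) :
    Submodule K (Unordered V D →ₗ[K] Unordered V C) where
  carrier := {f | ∀ i : ℤ, ∀ x ∈ degree V D i, f x ∈ degree V C (i + n)}
  add_mem' hf hg i x hx := (degree V C (i + n)).add_mem (hf i x hx) (hg i x hx)
  zero_mem' i _ _ := (degree V C (i + n)).zero_mem
  smul_mem' c _ hf i x hx := (degree V C (i + n)).smul_mem c (hf i x hx)

/-- The map `id ⊗ f : ⨀_{E ⊔ D} V → ⨀_{E ⊔ C} V` for a map `f : ⨀_D V → ⨀_C V` of degree `j`: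
`(id ⊗ f)(x ⊗ y) = (-1) ^ (j |x|) x ⊗ f y`. -/
noncomputable def idTensor (E : Type) {D C : Type} [Finite E] [Finite D] [Finite C] (j : ℤ) :
    (Unordered V D →ₗ[K] Unordered V C) →ₗ[K]
      (Unordered V (E ⊕ D) →ₗ[K] Unordered V (E ⊕ C)) where
  toFun f := (prodEquiv V E C).toLinearMap.comp
    ((TensorProduct.map (sign V E j) f).comp (prodEquiv V E D).symm.toLinearMap)
  map_add' f g := by
    simp only [TensorProduct.map_add_right, LinearMap.add_comp, LinearMap.comp_add]
  map_smul' c f := by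
    simp only [TensorProduct.map_smul_right, LinearMap.smul_comp, LinearMap.comp_smul,
      RingHom.id_apply]

/-- The map `g ⊗ id : ⨀_{D ⊔ E} V → ⨀_{C ⊔ E} V` for a map `g : ⨀_D V → ⨀_C V`. -/
noncomputable def tensorId (E : Type) {D C : Type} [Finite E] [Finite D] [Finite C] :
    (Unordered V D →ₗ[K] Unordered V C) →ₗ[K]
      (Unordered V (D ⊕ E) →ₗ[K] Unordered V (C ⊕ E)) where
  toFun g := (prodEquiv V C E).toLinearMap.comp
    ((TensorProduct.map g LinearMap.id).comp (prodEquiv V D E).symm.toLinearMap)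
  map_add' f g := by
    simp only [TensorProduct.map_add_left, LinearMap.add_comp, LinearMap.comp_add]
  map_smul' c f := by
    simp only [TensorProduct.map_smul_left, LinearMap.smul_comp, LinearMap.comp_smul,
      RingHom.id_apply]

variable {V}

theorem idTensor_mem {E D C : Type} [Finite E] [Finite D] [Finite C] {j : ℤ}
    {f : Unordered V D →ₗ[K] Unordered V C} (hf : f ∈ homDegree V D C j) :
    idTensor V E j f ∈ homDegree V (E ⊕ D) (E ⊕ C) j := by
  refine fun n => prodEquiv_symm_degree V E D n
    ((prodEquiv V E C).toLinearMap.comp (TensorProduct.map (sign V E j) f))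
    (degree V (E ⊕ C) (n + j)) ?_
  intro a b hab x hx y hy
  rw [LinearMap.comp_apply, TensorProduct.map_tmul]
  exact prodEquiv_degree V E C (by omega) (sign_degree V E j a hx) (hf b y hy)

theorem tensorId_mem {E D C : Type} [Finite E] [Finite D] [Finite C] {j : ℤ}
    {g : Unordered V D →ₗ[K] Unordered V C} (hg : g ∈ homDegree V D C j) :
    tensorId V E g ∈ homDegree V (D ⊕ E) (C ⊕ E) j := by
  refine fun n => prodEquiv_symm_degree V D E n
    ((prodEquiv V C E).toLinearMap.comp (TensorProduct.map g LinearMap.id))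
    (degree V (C ⊕ E) (n + j)) ?_
  intro a b hab x hx y hy
  rw [LinearMap.comp_apply, TensorProduct.map_tmul]
  exact prodEquiv_degree V C E (by omega) (hg a x hx) hy

theorem comp_mem {D C E : Type} {i j n : ℤ} (hn : i + j = n)
    {g : Unordered V C →ₗ[K] Unordered V E} (hg : g ∈ homDegree V C E i)
    {f : Unordered V D →ₗ[K] Unordered V C} (hf : f ∈ homDegree V D C j) :
    g.comp f ∈ homDegree V D E n := by
  refine fun a x hx => ?_
  have := hg _ _ (hf a x hx)
  rw [show a + n = a + j + i by omega]
  exact this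

theorem relabel_mem {D C : Type} [Finite D] (e : D ≃ C) : relabel V e ∈ homDegree V D C 0 := by
  refine fun a x hx => ?_
  rw [add_zero]
  exact relabel_degree V e a hx

theorem d_mem {C : Type} [Finite C] : d V C ∈ homDegree V C C 1 :=
  fun _ _ hx => d_degree V C rfl hx

end Unordered

/-! ## The endomorphism properad and algebras -/

/-- The reordering `D₁ ⊔ (C₂ ⊔ A) ≃ (D₁ ⊔ B) ⊔ C₂` given by `η⁻¹ : A ≃ B`. -/
def glueEquiv (D₁ C₂ : Type) {B A : Type} (η : B ≃ A) : D₁ ⊕ (C₂ ⊕ A) ≃ (D₁ ⊕ B) ⊕ C₂ :=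
  (Equiv.sumCongr (Equiv.refl D₁)
    ((Equiv.sumComm C₂ A).trans (Equiv.sumCongr η.symm (Equiv.refl C₂)))).trans
    (Equiv.sumAssoc D₁ B C₂).symm

/-- The endomorphism properad of a dg vector space `V`, with
`E_V(C, D, χ) = Hom(⨀_D V, ⨀_C V)`, the differential `f ↦ d f - (-1) ^ |f| f d`, the action
`f ↦ ρ f σ⁻¹` of pairs of bijections, and the composition
`⨀_{D₁ ⊔ D₂} → ⨀_{D₁ ⊔ (C₂ ⊔ A)} ≅ ⨀_{(D₁ ⊔ B) ⊔ C₂} → ⨀_{C₁ ⊔ C₂}` of `id ⊗ f`, the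
identification by `η⁻¹`, and `g ⊗ id`. The components do not depend on the genus; the genus
grading is composed by the given law. -/
noncomputable def endomorphismProperad (law : GenusLaw) : ProperadData.{k, max k w} K law where
  obj X n := Unordered.homDegree V X.inp X.out n
  addCommGroup X n := inferInstance
  module X n := inferInstance
  d X n m h :=
    { toFun := fun f => ⟨(Unordered.d V X.out).comp f.1 -
          koszul K n • f.1.comp (Unordered.d V X.inp),
        Submodule.sub_mem _ (Unordered.comp_mem (by omega) Unordered.d_mem f.2)
          (Submodule.smul_mem _ _ (Unordered.comp_mem h f.2 Unordered.d_mem))⟩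
      map_add' := fun f g => by
        ext : 1
        simp only [Submodule.coe_add, LinearMap.comp_add, LinearMap.add_comp, smul_add]
        abel
      map_smul' := fun c f => by
        ext : 1
        simp only [Submodule.coe_smul, LinearMap.comp_smul, LinearMap.smul_comp, smul_sub,
          RingHom.id_apply, smul_comm c] }
  act {X Y} ρ σ _ n :=
    { toFun := fun f => ⟨(Unordered.relabel V ρ).comp (f.1.comp (Unordered.relabel V σ.symm)),
        Unordered.comp_mem (zero_add n) (Unordered.relabel_mem ρ)
          (Unordered.comp_mem (add_zero n) f.2 (Unordered.relabel_mem σ.symm))⟩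
      map_add' := fun f g => by
        ext : 1
        simp only [Submodule.coe_add, LinearMap.comp_add, LinearMap.add_comp]
      map_smul' := fun c f => by
        ext : 1
        simp only [Submodule.coe_smul, LinearMap.comp_smul, LinearMap.smul_comp,
          RingHom.id_apply] }
  comp {C₁ D₁ C₂ D₂ B A} _ _ _ _ _ _ _ η {G₁ G₂} h₁ h₂ {i j n} hn :=
    LinearMap.mk₂ K
      (fun g f => ⟨(Unordered.tensorId V C₂ g.1).comp
          ((Unordered.relabel V (glueEquiv D₁ C₂ η)).comp (Unordered.idTensor V D₁ j f.1)),
        Unordered.comp_mem hn (Unordered.tensorId_mem g.2)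
          (Unordered.comp_mem (zero_add j) (Unordered.relabel_mem _)
            (Unordered.idTensor_mem f.2))⟩)
      (fun g g' f => by
        ext : 1
        simp only [Submodule.coe_add, map_add, LinearMap.add_comp])
      (fun c g f => by
        ext : 1
        simp only [Submodule.coe_smul, map_smul, LinearMap.smul_comp])
      (fun g f f' => by
        ext : 1
        simp only [Submodule.coe_add, map_add, LinearMap.comp_add])
      (fun c g f => by
        ext : 1
        simp only [Submodule.coe_smul, map_smul, LinearMap.comp_smul])

end Unordered

/-- An algebra over a properad `Q` on a dg vector space `V`: a morphism of properads from `Q` to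
the endomorphism properad of `V`. -/
abbrev AlgebraOver {K : Type k} [Field K] {law : GenusLaw} (Q : ProperadData.{k, u} K law)
    (V : CochainComplex (ModuleCat.{w} K) ℤ) : Type (max 1 k u w) :=
  Q.Hom (endomorphismProperad V law)

/-- The restriction `α(C, D, χ) φ = F (↑φ)` of an algebra `F` over the cobar complex to the
generators, i.e. to the graphs with one vertex. -/
noncomputable def AlgebraOver.onGenerators {K : Type k} [Field K] {law : GenusLaw}
    {P : Properad.{k, u} K law} [P.FiniteDimensional] {V : CochainComplex (ModuleCat.{w} K) ℤ}
    (F : AlgebraOver (cobar P) V) :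
    DegreeOneMaps P.toProperadData (endomorphismProperad V law) :=
  fun X _ m h => (F.app X m).comp (FreeProperad.gen h)

/-!
The cobar complex is free as a graded properad, so the proof has two ingredients.

* **Universal property.** A formal expression in the generators can be evaluated in any collection
  `Q` of dg vector spaces with operations (`FreeProperad.eval`). If `Q` satisfies the axioms of a
  properad and the values `α` of the generators are equivariant, the evaluation respects all
  relations (`FreeProperad.eval_sound`) and gives a morphism of graded properads
  `FreeProperad.lift`, the only one with the given values on the generators. Both `∂` followed by
  this morphism and this morphism followed by the differential of `Q` are derivations along it, so
  they agree as soon as they agree on generators (`FreeProperad.lift_d`). On a generator `↑φ` the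
  equality is the master equation for `α` at `φ`, because morphisms carry the quadratic part of
  `∂ ↑φ` to the quadratic operator of `α` (`map_quadratic`). Conversely, a morphism of dg properads
  restricts to an equivariant solution of the master equation for the same reason.

* **The endomorphism properad is a properad** (`endomorphismProperad.ax`,
  `endomorphismProperad.d_act`, `endomorphismProperad.d_comp`). The Koszul signs are confined to
  three facts about `⨀_C V`: the exchange of two factors of `⨀_C V ⊗ ⨀_{C'} V ≅ ⨀_{C ⊔ C'} V`
  (`Unordered.relabel_sumComm_prodEquiv`), the derivation rule for the differential
  (`Unordered.d_prodEquiv`), and the interchange law for maps `f`, `f'` of degrees `i`, `j`,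
  `(f ⊗ id)(id ⊗ f') = (-1) ^ (i j) (id ⊗ f')(f ⊗ id)` (`Unordered.tensorId_relabel_tensorId`).
  For `f` of degree `j` the map `id ⊗ f` is the conjugate of `f ⊗ id` by the exchange of the two
  factors (`Unordered.idTensor_eq`). Hence every composition is a word in operators `f ⊗ id` and
  permutations of the factors, in which no sign is visible. Equivariance and associativity then
  amount to the equality of some bijections of finite sets, and the interchange law is used
  exactly once in each of the two axioms that exchange two elements, where it produces the sign.
-/

/-! ### Koszul signs -/

section Koszul

variable {K : Type k} [Field K]

theorem koszul_eq_ite (n : ℤ) : koszul K n = if Odd n then -1 else 1 := by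
  split_ifs with h
  · simp [koszul, Int.negOnePow_odd n h]
  · simp [koszul, Int.negOnePow_even n (Int.not_odd_iff_even.mp h)]

theorem koszul_zero : koszul K 0 = 1 := by simp [koszul]

theorem koszul_sum {ι : Type*} (s : Finset ι) (f : ι → ℤ) :
    koszul K (∑ i ∈ s, f i) = ∏ i ∈ s, koszul K (f i) := by
  classical
  induction s using Finset.induction_on with
  | empty => simp [koszul_zero]
  | insert a s ha ih => rw [Finset.sum_insert ha, Finset.prod_insert ha, FreeProperad.koszul_add, ih]

end Koszul

section Reorder

variable {K : Type k} [Field K]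

/-- The Koszul sign of a change of ordering, as a product over the inversions. -/
theorem reorderSign_eq_prod {C : Type} [Fintype C] (ω ω' : Arrangement C) (δ : C → ℤ) :
    reorderSign K ω ω' (fun c => decide (Odd (δ c))) =
      ∏ c, ∏ c', if ω c < ω c' ∧ ω' c' < ω' c then koszul K (δ c * δ c') else 1 := by
  classical
  let _ : LinearOrder C := LinearOrder.lift' ω ω.injective
  have hlt : ∀ a b : C, a < b ↔ ω a < ω b := fun a b => Iff.rfl
  set F : Sym2 C → K := fun p => p.lift ⟨fun c c' =>
    if decide (Odd (δ c)) = true ∧ decide (Odd (δ c')) = true ∧ ¬ (ω c < ω c' ↔ ω' c < ω' c')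
    then -1 else 1, _⟩ with hF
  have h0 : reorderSign K ω ω' (fun c => decide (Odd (δ c))) = ∏ p, F p := by
    rw [reorderSign, finprod_eq_prod_of_fintype]
  have h1 : ∏ p, F p = ∏ p ∈ (Finset.univ : Finset C).sym2 with ¬ p.IsDiag, F p := by
    rw [Finset.sym2_univ, Finset.prod_filter]
    refine Finset.prod_congr rfl fun p _ => ?_
    induction p with
    | _ c c' =>
      by_cases h : c = c'
      · subst h; simp [hF]
      · simp [h]
  have h2 := Finset.sum_sym2_filter_not_isDiag (M := Additive K) (Finset.univ : Finset C)
    (fun p => Additive.ofMul (F p))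
  have h3 : ∏ p ∈ (Finset.univ : Finset C).sym2 with ¬ p.IsDiag, F p =
      ∏ p ∈ (Finset.univ : Finset C).offDiag with p.1 < p.2, F s(p.1, p.2) := h2
  rw [h0, h1, h3, ← Finset.prod_product']
  refine Finset.prod_subset_one_on_sdiff (Finset.subset_univ _) ?_ ?_
  · rintro ⟨c, c'⟩ h
    refine if_neg fun h' => ?_
    have : c < c' := (hlt _ _).2 h'.1
    simp [this, this.ne] at h
  · rintro ⟨c, c'⟩ h
    simp only [Finset.mem_filter, Finset.mem_offDiag, Finset.mem_univ, true_and] at h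
    have h1 : ω c < ω c' := h.2
    have h2 : ω' c ≠ ω' c' := fun e => h.1 (ω'.injective e)
    have h4 : ¬ ω' c < ω' c' ↔ ω' c' < ω' c :=
      ⟨fun h => lt_of_le_of_ne (not_lt.1 h) h2.symm, fun h => h.not_gt⟩
    simp only [hF, Sym2.lift_mk, h1, true_and, true_iff, h4, koszul_eq_ite,
      Int.odd_mul, decide_eq_true_eq]
    by_cases h5 : Odd (δ c) <;> by_cases h6 : Odd (δ c') <;> simp [h5, h6]

end Reorder

/-! ### Tensors of homogeneous elements -/

namespace Unordered

variable {K : Type k} [Field K] (V : CochainComplex (ModuleCat.{w} K) ℤ)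

/-- The class of the tensor product of the vectors `x c`, with its factors in the order `ω`. -/
noncomputable def pure {C : Type} (ω : Arrangement C) (x : C → DGTotal V) : Unordered V C :=
  mk V ω (PiTensorProduct.tprod K x)

variable {V}

/-- The vectors `x c` are homogeneous of degree `δ c`. -/
def Homogeneous {C : Type} (δ : C → ℤ) (x : C → DGTotal V) : Prop :=
  ∀ c, x c ∈ LinearMap.range (DGTotal.of V (δ c))

theorem Homogeneous.exists_eq {C : Type} {δ : C → ℤ} {x : C → DGTotal V} (hx : Homogeneous δ x) :
    ∃ v : ∀ c, V.X (δ c), x = fun c => DGTotal.of V (δ c) (v c) := by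
  choose v hv using hx
  exact ⟨v, funext fun c => (hv c).symm⟩

theorem homogeneous_of {C : Type} (δ : C → ℤ) (v : ∀ c, V.X (δ c)) :
    Homogeneous δ (fun c => DGTotal.of V (δ c) (v c)) := fun c => ⟨v c, rfl⟩

theorem pure_reorder {C : Type} [Fintype C] (ω ω' : Arrangement C) {δ : C → ℤ}
    {x : C → DGTotal V} (hx : Homogeneous δ x) :
    pure V ω x = (∏ c, ∏ c', if ω c < ω c' ∧ ω' c' < ω' c then koszul K (δ c * δ c') else 1) •
      pure V ω' x := by
  obtain ⟨v, rfl⟩ := hx.exists_eq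
  rw [pure, ← mk_reorder V ω ω', reorder_tprod_of, map_smul, reorderSign_eq_prod]
  rfl

theorem pure_mem_degree {C : Type} [Fintype C] (ω : Arrangement C) {δ : C → ℤ} {x : C → DGTotal V}
    (hx : Homogeneous δ x) {n : ℤ} (hn : ∑ c, δ c = n) : pure V ω x ∈ degree V C n := by
  obtain ⟨v, rfl⟩ := hx.exists_eq
  exact mk_mem_degree V ω δ v (by rwa [finsum_eq_sum_of_fintype])

/-- Linear maps on the unordered tensor product are determined by their values on tensors
of homogeneous elements in a given arrangement. -/
theorem ext_pure {C : Type} [Finite C] (ω : Arrangement C) {M : Type*} [AddCommGroup M] [Module K M]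
    {f g : Unordered V C →ₗ[K] M}
    (h : ∀ (δ : C → ℤ) (x : C → DGTotal V), Homogeneous δ x → f (pure V ω x) = g (pure V ω x)) :
    f = g := by
  have : f.comp (arrange V ω).toLinearMap = g.comp (arrange V ω).toLinearMap :=
    tensorOver_ext fun δ v => h δ _ (homogeneous_of δ v)
  refine LinearMap.ext fun x => ?_
  obtain ⟨y, rfl⟩ := (arrange V ω).surjective x
  exact LinearMap.congr_fun this y

theorem arrange_symm_pure {C : Type} [Finite C] (ω : Arrangement C) (x : C → DGTotal V) :
    (arrange V ω).symm (pure V ω x) = PiTensorProduct.tprod K x := by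
  rw [pure, arrange_symm_mk, reorder_self]

theorem relabel_pure {C C' : Type} [Finite C] (e : C ≃ C') (ω : Arrangement C) {δ : C → ℤ}
    {x : C → DGTotal V} (hx : Homogeneous δ x) :
    relabel V e (pure V ω x) = pure V (mapArrangement e ω) (x ∘ e.symm) := by
  have := Fintype.ofFinite C
  have := Fintype.ofEquiv C e
  have hx' : Homogeneous (δ ∘ e.symm) (x ∘ e.symm) := fun c => hx _
  rw [pure_reorder ω (someArrangement C) hx,
    pure_reorder (mapArrangement e ω) (mapArrangement e (someArrangement C)) hx', map_smul]
  congr 1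
  · refine Fintype.prod_equiv e _ _ fun c => Fintype.prod_equiv e _ _ fun c' => ?_
    simp [mapArrangement]
  · rw [relabel, LinearMap.comp_apply, LinearMap.comp_apply, LinearEquiv.coe_coe,
      LinearEquiv.coe_coe, arrange_symm_pure, PiTensorProduct.reindex_tprod]
    rfl

theorem Homogeneous.sumElim {C C' : Type} {δ : C → ℤ} {δ' : C' → ℤ} {x : C → DGTotal V}
    {y : C' → DGTotal V} (hx : Homogeneous δ x) (hy : Homogeneous δ' y) :
    Homogeneous (Sum.elim δ δ') (Sum.elim x y) := by
  rintro (c | c)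
  · exact hx c
  · exact hy c

theorem sumArrangement_inl_lt_inl {C C' : Type} [Finite C] [Finite C'] (ω : Arrangement C)
    (ω' : Arrangement C') (a b : C) :
    sumArrangement ω ω' (.inl a) < sumArrangement ω ω' (.inl b) ↔ ω a < ω b := by
  rw [Fin.lt_def, Fin.lt_def]
  simp [sumArrangement]

theorem sumArrangement_inr_lt_inr {C C' : Type} [Finite C] [Finite C'] (ω : Arrangement C)
    (ω' : Arrangement C') (a b : C') :
    sumArrangement ω ω' (.inr a) < sumArrangement ω ω' (.inr b) ↔ ω' a < ω' b := by
  rw [Fin.lt_def, Fin.lt_def]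
  simp [sumArrangement]

theorem sumArrangement_inl_lt_inr {C C' : Type} [Finite C] [Finite C'] (ω : Arrangement C)
    (ω' : Arrangement C') (a : C) (b : C') :
    sumArrangement ω ω' (.inl a) < sumArrangement ω ω' (.inr b) := by
  simp only [sumArrangement, Fin.lt_def, Equiv.trans_apply, Equiv.sumCongr_apply, Sum.map_inl,
    Sum.map_inr, finSumFinEquiv_apply_left, finSumFinEquiv_apply_right, finCongr_apply,
    Fin.val_cast, Fin.val_castAdd, Fin.val_natAdd]
  have := (ω a).2
  omega

theorem prodEquiv_pure {C C' : Type} [Finite C] [Finite C'] (ω : Arrangement C)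
    (ω' : Arrangement C') {δ : C → ℤ} {δ' : C' → ℤ} {x : C → DGTotal V} {y : C' → DGTotal V}
    (hx : Homogeneous δ x) (hy : Homogeneous δ' y) :
    prodEquiv V C C' (pure V ω x ⊗ₜ pure V ω' y) = pure V (sumArrangement ω ω') (Sum.elim x y) := by
  have := Fintype.ofFinite C
  have := Fintype.ofFinite C'
  rw [pure_reorder ω (someArrangement C) hx, pure_reorder ω' (someArrangement C') hy,
    pure_reorder (sumArrangement ω ω') (sumArrangement (someArrangement C) (someArrangement C'))
      (hx.sumElim hy), TensorProduct.smul_tmul_smul, map_smul]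
  congr 1
  · simp only [Fintype.prod_sum_type, sumArrangement_inl_lt_inl, sumArrangement_inr_lt_inr,
      sumArrangement_inl_lt_inr, (sumArrangement_inl_lt_inr _ _ _ _).not_gt, Sum.elim_inl,
      Sum.elim_inr, and_false, false_and, if_false, Finset.prod_const_one, mul_one, one_mul]
  · simp only [prodEquiv, LinearEquiv.trans_apply, TensorProduct.congr_tmul, arrange_symm_pure,
      PiTensorProduct.tmulEquiv_apply, arrange_apply]
    rfl

theorem sign_of_mem_degree {C : Type} [Finite C] (j : ℤ) {n : ℤ} {x : Unordered V C}
    (hx : x ∈ degree V C n) : sign V C j x = koszul K (j * n) • x := by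
  have := Fintype.ofFinite C
  rw [← sub_eq_zero]
  refine degree_le_comap V (someArrangement C) (sign V C j - koszul K (j * n) • LinearMap.id) n ⊥
    ?_ hx
  intro δ v hn
  rw [finsum_eq_sum_of_fintype] at hn
  subst hn
  rw [Submodule.mem_bot, LinearMap.sub_apply, sub_eq_zero]
  simp only [sign, LinearMap.comp_apply, LinearEquiv.coe_coe, arrange_symm_mk, reorder_self,
    PiTensorProduct.map_tprod, total_sign_of, LinearMap.smul_apply, LinearMap.id_apply, map_smul]
  rw [MultilinearMap.map_smul_univ, map_smul, Finset.mul_sum, koszul_sum]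

end Unordered

/-! ### Relabelling, products and the differential of unordered tensor products -/

namespace Unordered

variable {K : Type k} [Field K] {V : CochainComplex (ModuleCat.{w} K) ℤ}

theorem Homogeneous.comp {C C' : Type} {δ : C → ℤ} {x : C → DGTotal V} (hx : Homogeneous δ x)
    (f : C' → C) : Homogeneous (δ ∘ f) (x ∘ f) := fun c => hx (f c)

theorem Homogeneous.update {C : Type} [DecidableEq C] {δ : C → ℤ} {x : C → DGTotal V}
    (hx : Homogeneous δ x) (c : C) :
    Homogeneous (Function.update δ c (δ c + 1)) (Function.update x c (DGTotal.d V (x c))) := by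
  intro c'
  by_cases h : c' = c
  · subst h
    obtain ⟨v, hv⟩ := hx c'
    rw [Function.update_self, Function.update_self, ← hv, total_d_of]
    exact ⟨_, rfl⟩
  · rw [Function.update_of_ne h, Function.update_of_ne h]
    exact hx c'

/-- The tensors of homogeneous elements in a given arrangement span the unordered tensor product. -/
theorem induction_pure {C : Type} [Finite C] (ω : Arrangement C) {p : Unordered V C → Prop}
    (pure : ∀ (δ : C → ℤ) (x : C → DGTotal V), Homogeneous δ x → p (pure V ω x))
    (add : ∀ x y, p x → p y → p (x + y)) (smul : ∀ (c : K) x, p x → p (c • x))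
    (x : Unordered V C) : p x := by
  let S : Submodule K (Unordered V C) :=
    Submodule.span K {t | ∃ (δ : C → ℤ) (x : C → DGTotal V), Homogeneous δ x ∧ t = .pure V ω x}
  have hS : S.mkQ = 0 := ext_pure ω fun δ x hx =>
    (Submodule.Quotient.mk_eq_zero S).2 (Submodule.subset_span ⟨δ, x, hx, rfl⟩)
  have hx : x ∈ S := (Submodule.Quotient.mk_eq_zero S).1 (LinearMap.congr_fun hS x)
  have hzero : p 0 := by
    have := smul 0 _ (pure 0 0 fun _ => zero_mem _)
    rwa [zero_smul] at this
  induction hx using Submodule.span_induction with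
  | mem t ht =>
    obtain ⟨δ, x, hx, rfl⟩ := ht
    exact pure δ x hx
  | zero => exact hzero
  | add x y _ _ hx hy => exact add x y hx hy
  | smul c x _ hx => exact smul c x hx

/-- Linear maps agree on the elements of degree `n` if they agree on the tensors of homogeneous
elements of total degree `n` in a given arrangement. -/
theorem eqOn_degree {C : Type} [Fintype C] (ω : Arrangement C) {M : Type*} [AddCommGroup M]
    [Module K M] {f g : Unordered V C →ₗ[K] M} {n : ℤ}
    (h : ∀ (δ : C → ℤ) (x : C → DGTotal V), Homogeneous δ x → ∑ c, δ c = n →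
      f (pure V ω x) = g (pure V ω x)) {x : Unordered V C} (hx : x ∈ degree V C n) : f x = g x := by
  rw [← sub_eq_zero]
  refine degree_le_comap V ω (f - g) n ⊥ ?_ hx
  intro δ v hn
  rw [finsum_eq_sum_of_fintype] at hn
  rw [Submodule.mem_bot, LinearMap.sub_apply, sub_eq_zero]
  exact h δ _ (homogeneous_of δ v) hn

theorem mapArrangement_mapArrangement {C C' C'' : Type} (e : C ≃ C') (e' : C' ≃ C'')
    (ω : Arrangement C) :
    mapArrangement e' (mapArrangement e ω) = mapArrangement (e.trans e') ω := by
  ext c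
  simp [mapArrangement]

theorem relabel_refl {C : Type} [Finite C] (x : Unordered V C) :
    relabel V (Equiv.refl C) x = x := by
  have : relabel V (Equiv.refl C) = LinearMap.id := by
    refine ext_pure (someArrangement C) fun δ x hx => ?_
    rw [relabel_pure _ _ hx]
    rfl
  exact LinearMap.congr_fun this x

theorem relabel_relabel {C C' C'' : Type} [Finite C] [Finite C'] (e : C ≃ C') (e' : C' ≃ C'')
    (x : Unordered V C) : relabel V e' (relabel V e x) = relabel V (e.trans e') x := by
  have : (relabel V e').comp (relabel V e) = relabel V (e.trans e') := by
    refine ext_pure (someArrangement C) fun δ x hx => ?_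
    rw [LinearMap.comp_apply, relabel_pure _ _ hx, relabel_pure _ _ hx,
      relabel_pure _ _ (hx.comp e.symm), mapArrangement_mapArrangement]
    rfl
  exact LinearMap.congr_fun this x

/-- Linear maps on `⨀_{C ⊔ C'} V` are determined by their values on the products of homogeneous
elements. -/
theorem ext_prodEquiv {C C' : Type} [Finite C] [Finite C'] {M : Type*} [AddCommGroup M]
    [Module K M] {f g : Unordered V (C ⊕ C') →ₗ[K] M}
    (h : ∀ (i j : ℤ), ∀ x ∈ degree V C i, ∀ y ∈ degree V C' j,
      f (prodEquiv V C C' (x ⊗ₜ y)) = g (prodEquiv V C C' (x ⊗ₜ y))) : f = g := by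
  have := Fintype.ofFinite C
  have := Fintype.ofFinite C'
  refine ext_pure (sumArrangement (someArrangement C) (someArrangement C')) fun δ x hx => ?_
  have hx₁ : Homogeneous (δ ∘ Sum.inl) (x ∘ Sum.inl) := fun c => hx _
  have hx₂ : Homogeneous (δ ∘ Sum.inr) (x ∘ Sum.inr) := fun c => hx _
  have := h _ _ _ (pure_mem_degree (someArrangement C) hx₁ rfl) _
    (pure_mem_degree (someArrangement C') hx₂ rfl)
  rwa [prodEquiv_pure _ _ hx₁ hx₂, Sum.elim_comp_inl_inr] at this

/-- Bilinear maps are determined by their values on tensors of homogeneous elements. -/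
theorem ext_tmul {C C' : Type} [Finite C] [Finite C'] {M : Type*} [AddCommGroup M]
    [Module K M] {f g : Unordered V C ⊗[K] Unordered V C' →ₗ[K] M}
    (h : ∀ (δ : C → ℤ) (x : C → DGTotal V) (δ' : C' → ℤ) (x' : C' → DGTotal V), Homogeneous δ x →
      Homogeneous δ' x' →
      f (pure V (someArrangement C) x ⊗ₜ pure V (someArrangement C') x') =
        g (pure V (someArrangement C) x ⊗ₜ pure V (someArrangement C') x')) : f = g := by
  apply TensorProduct.ext
  refine ext_pure (someArrangement C) fun δ x hx => ?_
  exact ext_pure (someArrangement C') fun δ' x' hx' => h δ x δ' x' hx hx'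

theorem relabel_prodEquiv {C C' E E' : Type} [Finite C] [Finite C'] [Finite E] [Finite E']
    (e : C ≃ C') (e' : E ≃ E') (x : Unordered V C) (y : Unordered V E) :
    relabel V (Equiv.sumCongr e e') (prodEquiv V C E (x ⊗ₜ y)) =
      prodEquiv V C' E' (relabel V e x ⊗ₜ relabel V e' y) := by
  have : (relabel V (Equiv.sumCongr e e')).comp (prodEquiv V C E).toLinearMap =
      (prodEquiv V C' E').toLinearMap.comp (TensorProduct.map (relabel V e) (relabel V e')) := by
    refine ext_tmul fun δ x δ' x' hx hx' => ?_
    simp only [LinearMap.comp_apply, LinearEquiv.coe_coe, TensorProduct.map_tmul]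
    rw [prodEquiv_pure _ _ hx hx', relabel_pure _ _ (hx.sumElim hx'), relabel_pure _ _ hx,
      relabel_pure _ _ hx', prodEquiv_pure _ _ (hx.comp e.symm) (hx'.comp e'.symm)]
    congr 1
    · ext c
      rcases c with c | c <;> simp [mapArrangement, sumArrangement, Nat.card_congr e]
    · funext c
      rcases c with c | c <;> rfl
  exact LinearMap.congr_fun this (x ⊗ₜ y)

theorem relabel_sumAssoc_prodEquiv {C C' C'' : Type} [Finite C] [Finite C'] [Finite C'']
    (x : Unordered V C) (y : Unordered V C') (z : Unordered V C'') :
    relabel V (Equiv.sumAssoc C C' C'')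
        (prodEquiv V (C ⊕ C') C'' (prodEquiv V C C' (x ⊗ₜ y) ⊗ₜ z)) =
      prodEquiv V C (C' ⊕ C'') (x ⊗ₜ prodEquiv V C' C'' (y ⊗ₜ z)) := by
  induction x using induction_pure (someArrangement C) with
  | add x x' hx hx' => simp only [TensorProduct.add_tmul, map_add, hx, hx']
  | smul c x hx => simp only [← TensorProduct.smul_tmul', map_smul, hx]
  | pure δ x hx =>
  induction y using induction_pure (someArrangement C') with
  | add y y' hy hy' => simp only [TensorProduct.add_tmul, TensorProduct.tmul_add, map_add, hy, hy']
  | smul c y hy =>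
    simp only [← TensorProduct.smul_tmul', TensorProduct.tmul_smul, map_smul, hy]
  | pure δ' y hy =>
  induction z using induction_pure (someArrangement C'') with
  | add z z' hz hz' => simp only [TensorProduct.tmul_add, map_add, hz, hz']
  | smul c z hz => simp only [TensorProduct.tmul_smul, map_smul, hz]
  | pure δ'' z hz =>
  rw [prodEquiv_pure _ _ hx hy, prodEquiv_pure _ _ (hx.sumElim hy) hz, prodEquiv_pure _ _ hy hz,
    prodEquiv_pure _ _ hx (hy.sumElim hz), relabel_pure _ _ ((hx.sumElim hy).sumElim hz)]
  congr 1
  · ext c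
    rcases c with c | c | c <;> simp [mapArrangement, sumArrangement, add_assoc]
  · funext c
    rcases c with c | c | c <;> rfl

/-- The Koszul sign rule for the exchange of two factors. -/
theorem relabel_sumComm_prodEquiv {C C' : Type} [Finite C] [Finite C'] {i j : ℤ}
    {x : Unordered V C} (hx : x ∈ degree V C i) {y : Unordered V C'} (hy : y ∈ degree V C' j) :
    relabel V (Equiv.sumComm C C') (prodEquiv V C C' (x ⊗ₜ y)) =
      koszul K (i * j) • prodEquiv V C' C (y ⊗ₜ x) := by
  have := Fintype.ofFinite C
  have := Fintype.ofFinite C'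
  let f₁ : Unordered V C →ₗ[K] Unordered V C' →ₗ[K] Unordered V (C' ⊕ C) :=
    (TensorProduct.mk K _ _).compr₂
      ((relabel V (Equiv.sumComm C C')).comp (prodEquiv V C C').toLinearMap)
  let f₂ : Unordered V C →ₗ[K] Unordered V C' →ₗ[K] Unordered V (C' ⊕ C) :=
    koszul K (i * j) • ((TensorProduct.mk K _ _).compr₂ (prodEquiv V C' C).toLinearMap).flip
  change f₁ x y = f₂ x y
  change f₁.flip y x = f₂.flip y x
  refine eqOn_degree (someArrangement C) (fun δ x hx hi => ?_) hx
  change f₁ _ y = f₂ _ y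
  refine eqOn_degree (someArrangement C') (fun δ' y hy hj => ?_) hy
  change relabel V (Equiv.sumComm C C') (prodEquiv V C C' (_ ⊗ₜ _)) =
      koszul K (i * j) • prodEquiv V C' C (_ ⊗ₜ _)
  rw [prodEquiv_pure _ _ hx hy, prodEquiv_pure _ _ hy hx, relabel_pure _ _ (hx.sumElim hy),
    pure_reorder _ (sumArrangement (someArrangement C') (someArrangement C))
      ((hx.sumElim hy).comp (Equiv.sumComm C C').symm)]
  have h : ∀ c : C' ⊕ C, mapArrangement (Equiv.sumComm C C')
      (sumArrangement (someArrangement C) (someArrangement C')) c =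
      finCongr (Nat.card_congr (Equiv.sumComm C C'))
        (sumArrangement (someArrangement C) (someArrangement C') c.swap) := fun c => rfl
  congr 1
  · simp only [Fintype.prod_sum_type, h, finCongr_apply, Fin.cast_lt_cast, Sum.swap_inl,
      Sum.swap_inr, sumArrangement_inl_lt_inl, sumArrangement_inr_lt_inr,
      sumArrangement_inl_lt_inr, (sumArrangement_inl_lt_inr _ _ _ _).not_gt, Function.comp_apply,
      Equiv.sumComm_symm, Equiv.sumComm_apply, Sum.elim_inl, Sum.elim_inr]
    have h1 : ∀ {n : ℕ} (a b : Fin n), ¬ (a < b ∧ b < a) := fun a b h => h.1.asymm h.2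
    simp only [h1, and_self, if_true, if_false, Finset.prod_const_one, one_mul, mul_one]
    subst hi hj
    simp only [← koszul_sum, Finset.sum_mul_sum]
  · congr 1
    funext c
    rcases c with c | c <;> rfl

/-- The differential of a tensor of homogeneous elements in an arbitrary arrangement. -/
theorem d_pure {C : Type} [Fintype C] [DecidableEq C] (ω : Arrangement C) {δ : C → ℤ}
    {x : C → DGTotal V} (hx : Homogeneous δ x) :
    d V C (pure V ω x) = ∑ c, (∏ c', if ω c' < ω c then koszul K (δ c') else 1) •
      pure V ω (Function.update x c (DGTotal.d V (x c))) := by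
  have h0 : d V C (pure V (someArrangement C) x) = ∑ c, (∏ c',
      if someArrangement C c' < someArrangement C c then koszul K (δ c') else 1) •
      pure V (someArrangement C) (Function.update x c (DGTotal.d V (x c))) := by
    obtain ⟨v, rfl⟩ := hx.exists_eq
    simp only [d, LinearMap.comp_apply, LinearEquiv.coe_coe, arrange_symm_pure,
      finsum_eq_sum_of_fintype, LinearMap.sum_apply, PiTensorProduct.map_tprod, map_sum]
    refine Finset.sum_congr rfl fun c _ => ?_
    rw [pure, ← map_smul, ← MultilinearMap.map_smul_univ]
    congr 2
    funext c'
    by_cases h : c' = c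
    · subst h
      simp
    · rw [if_neg h, Function.update_of_ne h]
      split_ifs with h'
      · rw [total_sign_of, one_mul, map_smul]
      · simp
  rw [pure_reorder ω (someArrangement C) hx, map_smul, h0, Finset.smul_sum]
  refine Finset.sum_congr rfl fun a _ => ?_
  rw [pure_reorder ω (someArrangement C) (hx.update a), smul_smul, smul_smul]
  congr 1
  generalize someArrangement C = ω'
  -- The sign of the reordering is quadratic in the degrees; raising the degree at `a` by one
  -- multiplies it by the two factors that are linear in the degrees at the other places.
  have h1 : ∀ c c', (if ω c < ω c' ∧ ω' c' < ω' c then koszul K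
      (Function.update δ a (δ a + 1) c * Function.update δ a (δ a + 1) c') else 1) =
      (if ω c < ω c' ∧ ω' c' < ω' c then koszul K (δ c * δ c') else 1) *
      (if c = a then if ω a < ω c' ∧ ω' c' < ω' a then koszul K (δ c') else 1 else 1) *
      (if c' = a then if ω c < ω a ∧ ω' a < ω' c then koszul K (δ c) else 1 else 1) := by
    intro c c'
    by_cases hc : c = a
    · subst hc
      by_cases hc' : c' = c
      · subst hc'; simp
      · simp only [hc', if_true, if_false, mul_one, Function.update_self,
          Function.update_of_ne hc', add_mul, one_mul, FreeProperad.koszul_add]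
        split_ifs <;> simp
    · by_cases hc' : c' = a
      · subst hc'
        simp only [hc, if_true, if_false, mul_one, Function.update_self,
          Function.update_of_ne hc, mul_add, FreeProperad.koszul_add]
        split_ifs <;> simp
      · simp [hc, hc']
  simp only [h1, Finset.prod_mul_distrib]
  rw [Finset.prod_comm (f := fun c c' => if c = a then _ else _)]
  simp only [Finset.prod_ite_eq', Finset.mem_univ, if_true]
  -- An index `c` is in front of `a` in exactly one of the two orders if and only if `a` and `c`
  -- form an inversion.
  have h2 : (∏ c, if ω' c < ω' a then koszul K (δ c) else 1) =
      (∏ c, if ω a < ω c ∧ ω' c < ω' a then koszul K (δ c) else 1) *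
        ((∏ c, if ω c < ω a then koszul K (δ c) else 1) *
          ∏ c, if ω c < ω a ∧ ω' a < ω' c then koszul K (δ c) else 1) := by
    rw [← Finset.prod_mul_distrib, ← Finset.prod_mul_distrib]
    refine Finset.prod_congr rfl fun c _ => ?_
    by_cases h : c = a
    · subst h; simp
    · have hω : ω c ≠ ω a := fun e => h (ω.injective e)
      have hω' : ω' c ≠ ω' a := fun e => h (ω'.injective e)
      have hs := FreeProperad.koszul_mul_self (K := K) (δ c)
      rcases lt_or_gt_of_ne hω with h1 | h1 <;> rcases lt_or_gt_of_ne hω' with h2 | h2 <;>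
        simp [h1, h2, h1.not_gt, h2.not_gt, hs]
  rw [h2]
  ring

end Unordered

namespace Unordered

variable {K : Type k} [Field K] {V : CochainComplex (ModuleCat.{w} K) ℤ}

theorem d_relabel {C C' : Type} [Finite C] [Finite C'] (e : C ≃ C') (x : Unordered V C) :
    d V C' (relabel V e x) = relabel V e (d V C x) := by
  classical
  have := Fintype.ofFinite C
  have := Fintype.ofFinite C'
  have : (d V C').comp (relabel V e) = (relabel V e).comp (d V C) := by
    refine ext_pure (someArrangement C) fun δ x hx => ?_
    rw [LinearMap.comp_apply, LinearMap.comp_apply, relabel_pure _ _ hx,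
      d_pure _ (hx.comp e.symm), d_pure _ hx, map_sum]
    refine (Fintype.sum_equiv e _ _ fun c => ?_).symm
    rw [map_smul, relabel_pure _ _ (hx.update c)]
    congr 1
    · refine Fintype.prod_equiv e _ _ fun c' => ?_
      simp [mapArrangement]
    · congr 1
      funext c'
      by_cases h : c' = e c
      · subst h; simp
      · have h' : e.symm c' ≠ c := fun h' => h (by rw [← h', e.apply_symm_apply])
        simp [h, h']
  exact LinearMap.congr_fun this x

/-- The differential of the product is a derivation. -/
theorem d_prodEquiv {C C' : Type} [Finite C] [Finite C'] {i : ℤ}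
    {x : Unordered V C} (hx : x ∈ degree V C i) (y : Unordered V C') :
    d V (C ⊕ C') (prodEquiv V C C' (x ⊗ₜ y)) =
      prodEquiv V C C' (d V C x ⊗ₜ y) + koszul K i • prodEquiv V C C' (x ⊗ₜ d V C' y) := by
  classical
  have := Fintype.ofFinite C
  have := Fintype.ofFinite C'
  let f₁ : Unordered V C →ₗ[K] Unordered V C' →ₗ[K] Unordered V (C ⊕ C') :=
    (TensorProduct.mk K _ _).compr₂ ((d V (C ⊕ C')).comp (prodEquiv V C C').toLinearMap)
  let f₂ : Unordered V C →ₗ[K] Unordered V C' →ₗ[K] Unordered V (C ⊕ C') :=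
    (TensorProduct.mk K _ _).compr₂ ((prodEquiv V C C').toLinearMap.comp
      (TensorProduct.map (d V C) LinearMap.id + koszul K i • TensorProduct.map LinearMap.id (d V C')))
  suffices f₁ x y = f₂ x y by
    simpa [f₁, f₂] using this
  change f₁.flip y x = f₂.flip y x
  refine eqOn_degree (someArrangement C) (fun δ x hx hi => ?_) hx
  change f₁ _ y = f₂ _ y
  refine LinearMap.congr_fun (ext_pure (someArrangement C') fun δ' y hy => ?_) y
  simp only [f₁, f₂, LinearMap.compr₂_apply, TensorProduct.mk_apply, LinearMap.comp_apply,
    LinearEquiv.coe_coe, LinearMap.add_apply, LinearMap.smul_apply, TensorProduct.map_tmul,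
    LinearMap.id_apply, map_add, map_smul]
  rw [prodEquiv_pure _ _ hx hy, d_pure _ (hx.sumElim hy), d_pure _ hx, d_pure _ hy,
    Fintype.sum_sum_type, TensorProduct.sum_tmul, TensorProduct.tmul_sum, map_sum, map_sum,
    Finset.smul_sum]
  congr 1
  · refine Finset.sum_congr rfl fun c _ => ?_
    rw [← TensorProduct.smul_tmul', map_smul, prodEquiv_pure _ _ (hx.update c) hy]
    simp only [Fintype.prod_sum_type, sumArrangement_inl_lt_inl,
      (sumArrangement_inl_lt_inr _ _ _ _).not_gt, if_false, Finset.prod_const_one, mul_one,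
      Sum.elim_inl, Sum.update_elim_inl]
  · refine Finset.sum_congr rfl fun c _ => ?_
    rw [TensorProduct.tmul_smul, map_smul, prodEquiv_pure _ _ hx (hy.update c), smul_smul]
    simp only [Fintype.prod_sum_type, sumArrangement_inr_lt_inr, sumArrangement_inl_lt_inr,
      if_true, Sum.elim_inl, Sum.elim_inr, Sum.update_elim_inr, ← hi, koszul_sum]

/-! ### The operators `f ⊗ id` and `id ⊗ f` -/

section Operators

variable {C D E C' D' E' : Type} [Finite C] [Finite D] [Finite E] [Finite C'] [Finite D']
  [Finite E']

theorem tensorId_prodEquiv (E : Type) [Finite E] (f : Unordered V D →ₗ[K] Unordered V C)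
    (x : Unordered V D) (y : Unordered V E) :
    tensorId V E f (prodEquiv V D E (x ⊗ₜ y)) = prodEquiv V C E (f x ⊗ₜ y) := by
  simp [tensorId]

theorem idTensor_prodEquiv (E : Type) [Finite E] (j : ℤ) (f : Unordered V D →ₗ[K] Unordered V C)
    {i : ℤ} {x : Unordered V E} (hx : x ∈ degree V E i) (y : Unordered V D) :
    idTensor V E j f (prodEquiv V E D (x ⊗ₜ y)) =
      koszul K (j * i) • prodEquiv V E C (x ⊗ₜ f y) := by
  simp [idTensor, sign_of_mem_degree j hx, ← TensorProduct.smul_tmul']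

theorem induction_prodEquiv {p : Unordered V (D ⊕ E) → Prop}
    (tmul : ∀ x y, p (prodEquiv V D E (x ⊗ₜ y))) (add : ∀ x y, p x → p y → p (x + y)) (x) : p x := by
  obtain ⟨t, rfl⟩ := (prodEquiv V D E).surjective x
  induction t with
  | zero => simpa using tmul 0 0
  | tmul x y => exact tmul x y
  | add x y hx hy => rw [map_add]; exact add _ _ hx hy

theorem tensorId_comp (f : Unordered V D →ₗ[K] Unordered V C)
    (g : Unordered V C →ₗ[K] Unordered V C') (x : Unordered V (D ⊕ E)) :
    tensorId V E (g.comp f) x = tensorId V E g (tensorId V E f x) := by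
  induction x using induction_prodEquiv with
  | tmul x y => simp only [tensorId_prodEquiv, LinearMap.comp_apply]
  | add x y hx hy => simp only [map_add, hx, hy]

theorem tensorId_relabel (e : D ≃ C) (x : Unordered V (D ⊕ E)) :
    tensorId V E (relabel V e) x = relabel V (Equiv.sumCongr e (Equiv.refl E)) x := by
  induction x using induction_prodEquiv with
  | tmul x y => rw [tensorId_prodEquiv, relabel_prodEquiv, relabel_refl]
  | add x y hx hy => simp only [map_add, hx, hy]

theorem relabel_tensorId (e : E ≃ E') (f : Unordered V D →ₗ[K] Unordered V C)
    (x : Unordered V (D ⊕ E)) :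
    relabel V (Equiv.sumCongr (Equiv.refl C) e) (tensorId V E f x) =
      tensorId V E' f (relabel V (Equiv.sumCongr (Equiv.refl D) e) x) := by
  induction x using induction_prodEquiv with
  | tmul x y => simp only [relabel_prodEquiv, tensorId_prodEquiv, relabel_refl]
  | add x y hx hy => simp only [map_add, hx, hy]

/-- Change of the idle factors along `e : E ≃ E'`: `f ⊗ id_E` is the conjugate of `f ⊗ id_{E'}`. -/
theorem tensorId_eq_relabel (e : E ≃ E') (f : Unordered V D →ₗ[K] Unordered V C)
    (x : Unordered V (D ⊕ E)) :
    tensorId V E f x = relabel V (Equiv.sumCongr (Equiv.refl C) e.symm)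
      (tensorId V E' f (relabel V (Equiv.sumCongr (Equiv.refl D) e) x)) := by
  rw [← relabel_tensorId, relabel_relabel]
  convert (relabel_refl _).symm using 3
  ext c
  rcases c with c | c <;> simp

theorem tensorId_tensorId (f : Unordered V D →ₗ[K] Unordered V C) (x : Unordered V ((D ⊕ E) ⊕ E')) :
    tensorId V E' (tensorId V E f) x = relabel V (Equiv.sumAssoc C E E').symm
      (tensorId V (E ⊕ E') f (relabel V (Equiv.sumAssoc D E E') x)) := by
  suffices h : relabel V (Equiv.sumAssoc C E E') (tensorId V E' (tensorId V E f) x) =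
      tensorId V (E ⊕ E') f (relabel V (Equiv.sumAssoc D E E') x) by
    rw [← h, relabel_relabel, Equiv.self_trans_symm, relabel_refl]
  induction x using induction_prodEquiv with
  | tmul x z =>
    induction x using induction_prodEquiv with
    | tmul x y => simp only [tensorId_prodEquiv, relabel_sumAssoc_prodEquiv]
    | add x y hx hy => simp only [TensorProduct.add_tmul, map_add, hx, hy]
  | add x y hx hy => simp only [map_add, hx, hy]

/-- For a map `f` of degree `j`, the Koszul signs of `id ⊗ f` are those of the exchange of the two
factors before and after the application of `f ⊗ id`. -/
theorem idTensor_eq {j : ℤ} {f : Unordered V D →ₗ[K] Unordered V C} (hf : f ∈ homDegree V D C j)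
    (x : Unordered V (E ⊕ D)) :
    idTensor V E j f x = relabel V (Equiv.sumComm C E)
      (tensorId V E f (relabel V (Equiv.sumComm E D) x)) := by
  refine LinearMap.congr_fun (g := (relabel V (Equiv.sumComm C E)).comp
    ((tensorId V E f).comp (relabel V (Equiv.sumComm E D)))) (ext_prodEquiv ?_) x
  intro a b x hx y hy
  rw [LinearMap.comp_apply, LinearMap.comp_apply, relabel_sumComm_prodEquiv hx hy, map_smul,
    map_smul, tensorId_prodEquiv, relabel_sumComm_prodEquiv (hf b y hy) hx,
    idTensor_prodEquiv E j f hx, smul_smul, add_mul, FreeProperad.koszul_add, ← mul_assoc,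
    mul_comm b a, FreeProperad.koszul_mul_self, one_mul]

/-- The interchange law of maps of degrees `i` and `j` on two factors, with the Koszul sign. -/
theorem tensorId_relabel_tensorId {i j : ℤ} {f : Unordered V D →ₗ[K] Unordered V C}
    (hf : f ∈ homDegree V D C i) {f' : Unordered V D' →ₗ[K] Unordered V C'}
    (hf' : f' ∈ homDegree V D' C' j) (x : Unordered V (D ⊕ D')) :
    tensorId V C' f (relabel V (Equiv.sumComm C' D)
        (tensorId V D f' (relabel V (Equiv.sumComm D D') x))) =
      koszul K (i * j) • relabel V (Equiv.sumComm C' C) (tensorId V C f'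
        (relabel V (Equiv.sumComm C D') (tensorId V D' f x))) := by
  rw [← idTensor_eq hf', ← idTensor_eq hf']
  refine LinearMap.congr_fun (f := (tensorId V C' f).comp (idTensor V D j f'))
    (g := koszul K (i * j) • (idTensor V C j f').comp (tensorId V D' f)) (ext_prodEquiv ?_) x
  intro a b x hx y hy
  rw [LinearMap.smul_apply, LinearMap.comp_apply, LinearMap.comp_apply, tensorId_prodEquiv,
    idTensor_prodEquiv _ _ _ hx, idTensor_prodEquiv _ _ _ (hf a x hx), map_smul,
    tensorId_prodEquiv, smul_smul, mul_add, FreeProperad.koszul_add, mul_comm j i, mul_left_comm,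
    FreeProperad.koszul_mul_self, mul_one]

/-- `d` on `⨀_{D ⊔ E} V` is `d ⊗ id + id ⊗ d`, with `id ⊗ d` written as a conjugate of `d ⊗ id`. -/
theorem d_sum (x : Unordered V (D ⊕ E)) :
    d V (D ⊕ E) x = tensorId V E (d V D) x + relabel V (Equiv.sumComm E D)
      (tensorId V D (d V E) (relabel V (Equiv.sumComm D E) x)) := by
  rw [← idTensor_eq d_mem]
  refine LinearMap.congr_fun (g := tensorId V E (d V D) + idTensor V D 1 (d V E))
    (ext_prodEquiv ?_) x
  intro a b x hx y hy
  rw [LinearMap.add_apply, tensorId_prodEquiv, idTensor_prodEquiv _ _ _ hx, d_prodEquiv hx, one_mul]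

/-- The operator `f ↦ f ⊗ id` commutes with the differential of maps `f` of degree `i`. -/
theorem d_tensorId {i : ℤ} {f : Unordered V D →ₗ[K] Unordered V C} (hf : f ∈ homDegree V D C i)
    (x : Unordered V (D ⊕ E)) :
    d V (C ⊕ E) (tensorId V E f x) =
      tensorId V E ((d V C).comp f - koszul K i • f.comp (d V D)) x +
        koszul K i • tensorId V E f (d V (D ⊕ E) x) := by
  have h := tensorId_relabel_tensorId hf (d_mem (V := V) (C := E)) x
  rw [mul_one] at h
  have hs : ∀ y : Unordered V (C ⊕ E), koszul K i • koszul K i • y = y := fun y => by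
    rw [smul_smul, FreeProperad.koszul_mul_self, one_smul]
  rw [LinearMap.map_sub, LinearMap.map_smul, LinearMap.sub_apply, LinearMap.smul_apply,
    tensorId_comp, tensorId_comp, d_sum x, d_sum, LinearMap.map_add, h, smul_add, hs]
  abel

end Operators

end Unordered

/-! ### Associativity of the composition of multilinear operations -/

namespace Unordered

variable {K : Type k} [Field K] {V : CochainComplex (ModuleCat.{w} K) ℤ}

theorem relabel_congr {C C' : Type} [Finite C] {e e' : C ≃ C'} (h : ∀ c, e c = e' c)
    {x y : Unordered V C} (hxy : x = y) : relabel V e x = relabel V e' y := by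
  rw [Equiv.ext h, hxy]

/-- The interchange law in the presence of further factors indexed by `E`. -/
theorem tensorId_sumLeftComm_tensorId {C D C' D' E : Type} [Finite C] [Finite D] [Finite C']
    [Finite D'] [Finite E] {i j : ℤ} {f : Unordered V D →ₗ[K] Unordered V C}
    (hf : f ∈ homDegree V D C i) {f' : Unordered V D' →ₗ[K] Unordered V C'}
    (hf' : f' ∈ homDegree V D' C' j) (v : Unordered V (D' ⊕ (D ⊕ E))) :
    tensorId V (C' ⊕ E) f (relabel V (sumLeftComm C' D E) (tensorId V (D ⊕ E) f' v)) =
      koszul K (i * j) • relabel V (sumLeftComm C' C E) (tensorId V (C ⊕ E) f'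
        (relabel V (sumLeftComm C D' E) (tensorId V (D' ⊕ E) f
          (relabel V (sumLeftComm D' D E) v)))) := by
  have h : (tensorId V C' f).comp ((relabel V (Equiv.sumComm C' D)).comp
      ((tensorId V D f').comp (relabel V (Equiv.sumComm D D')))) =
      koszul K (i * j) • (relabel V (Equiv.sumComm C' C)).comp ((tensorId V C f').comp
        ((relabel V (Equiv.sumComm C D')).comp (tensorId V D' f))) :=
    LinearMap.ext (tensorId_relabel_tensorId hf hf')
  have h' := LinearMap.congr_fun (congrArg (tensorId V E) h) (relabel V
    ((Equiv.sumAssoc D' D E).symm.trans (Equiv.sumCongr (Equiv.sumComm D' D) (Equiv.refl E))) v)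
  simp only [LinearMap.map_smul, LinearMap.smul_apply, tensorId_comp, tensorId_relabel,
    tensorId_tensorId, relabel_relabel] at h'
  have h'' := congrArg (relabel V (Equiv.sumAssoc C C' E)) h'
  simp only [LinearMap.map_smul, relabel_relabel] at h''
  refine Eq.trans ?_ (h''.trans (congrArg _ ?_))
  · rw [← relabel_refl (tensorId V (C' ⊕ E) f _)]
    refine relabel_congr ?_ (congrArg _ (relabel_congr ?_ (congrArg _ ?_)))
    · rintro (c | c | c) <;> simp
    · rintro (c | c | c) <;> simp [sumLeftComm]
    · rw [← relabel_refl v, relabel_relabel]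
      refine relabel_congr ?_ rfl
      rintro (c | c | c) <;> simp
  · refine relabel_congr ?_ (congrArg _ (relabel_congr ?_ (congrArg _ (relabel_congr ?_ rfl))))
    · rintro (c | c | c) <;> simp [sumLeftComm]
    · rintro (c | c | c) <;> simp [sumLeftComm]
    · rintro (c | c | c) <;> simp [sumLeftComm]

section Composite

variable {C₁ D₁ C₂ D₂ C₃ D₃ B A B₁ A₁ B₂ A₂ B₃ A₃ : Type} [Finite C₁] [Finite D₁] [Finite C₂]
  [Finite D₂] [Finite C₃] [Finite D₃] [Finite B] [Finite A] [Finite B₁] [Finite A₁] [Finite B₂]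
  [Finite A₂] [Finite B₃] [Finite A₃]

/-- The composition of `g` and a homogeneous map `f` in the endomorphism properad, written without
Koszul signs in terms of `g ⊗ id`, `f ⊗ id` and permutations of the factors. -/
noncomputable def composite (η : B ≃ A) (g : Unordered V (D₁ ⊕ B) →ₗ[K] Unordered V C₁)
    (f : Unordered V D₂ →ₗ[K] Unordered V (C₂ ⊕ A)) :
    Unordered V (D₁ ⊕ D₂) →ₗ[K] Unordered V (C₁ ⊕ C₂) :=
  (tensorId V C₂ g).comp ((relabel V ((Equiv.sumComm (C₂ ⊕ A) D₁).trans (glueEquiv D₁ C₂ η))).comp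
    ((tensorId V D₁ f).comp (relabel V (Equiv.sumComm D₁ D₂))))

/-- Conjugation by bijections. -/
noncomputable def conj {C D C' D' : Type} [Finite C] [Finite D] [Finite C'] [Finite D']
    (ρ : C ≃ C') (σ : D ≃ D') (f : Unordered V D →ₗ[K] Unordered V C) :
    Unordered V D' →ₗ[K] Unordered V C' :=
  (relabel V ρ).comp (f.comp (relabel V σ.symm))

/-- Equivariance of the composition. -/
theorem composite_conj {C₁' D₁' C₂' D₂' B' A' : Type} [Finite C₁'] [Finite D₁'] [Finite C₂']
    [Finite D₂'] [Finite B'] [Finite A'] (η : B ≃ A)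
    (ρ₁ : C₁ ≃ C₁') (σ₁ : D₁ ≃ D₁') (σB : B ≃ B') (ρ₂ : C₂ ≃ C₂') (ρA : A ≃ A') (σ₂ : D₂ ≃ D₂')
    (g : Unordered V (D₁ ⊕ B) →ₗ[K] Unordered V C₁)
    (f : Unordered V D₂ →ₗ[K] Unordered V (C₂ ⊕ A)) :
    conj (Equiv.sumCongr ρ₁ ρ₂) (Equiv.sumCongr σ₁ σ₂) (composite η g f) =
      composite ((σB.symm.trans η).trans ρA) (conj ρ₁ (Equiv.sumCongr σ₁ σB) g)
        (conj (Equiv.sumCongr ρ₂ ρA) σ₂ f) := by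
  refine LinearMap.ext fun v => ?_
  simp only [composite, conj, LinearMap.comp_apply, tensorId_comp, tensorId_relabel,
    relabel_relabel]
  rw [tensorId_eq_relabel ρ₂ g, tensorId_eq_relabel σ₁ f]
  simp only [relabel_relabel]
  refine relabel_congr ?_ (congrArg _ (relabel_congr ?_ (congrArg _ (relabel_congr ?_ rfl))))
  · rintro (c | c) <;> simp
  · rintro ((c | c) | c) <;> simp [glueEquiv]
  · rintro (c | c) <;> simp

/-- Associativity when `x` and `z` may be glued to each other. After normalization both sides apply
`z`, `y`, `x` in this order. -/
theorem composite_assoc (η₁ : B₁ ≃ A₁) (η₂ : B₂ ≃ A₂) (η₃ : B₃ ≃ A₃)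
    (x : Unordered V ((D₁ ⊕ B₃) ⊕ B₁) →ₗ[K] Unordered V C₁)
    (y : Unordered V (D₂ ⊕ B₂) →ₗ[K] Unordered V (C₂ ⊕ A₁))
    (z : Unordered V D₃ →ₗ[K] Unordered V (C₃ ⊕ (A₃ ⊕ A₂))) :
    conj (Equiv.sumAssoc C₁ C₂ C₃) (Equiv.sumAssoc D₁ D₂ D₃)
        (composite (Equiv.sumCongr η₃ η₂)
          (conj (Equiv.refl _) (Equiv.sumSumSumComm D₁ B₃ D₂ B₂) (composite η₁ x y)) z) =
      composite (Equiv.sumCongr η₁ η₃)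
        (conj (Equiv.refl _) ((Equiv.sumAssoc D₁ B₃ B₁).trans
          (Equiv.sumCongr (Equiv.refl D₁) (Equiv.sumComm B₃ B₁))) x)
        (conj (Equiv.sumSumSumComm C₂ A₁ C₃ A₃) (Equiv.refl _)
          (composite η₂ y (conj (Equiv.sumAssoc C₃ A₃ A₂).symm (Equiv.refl _) z))) := by
  refine LinearMap.ext fun v => ?_
  simp only [composite, conj, LinearMap.comp_apply, tensorId_comp, tensorId_relabel,
    tensorId_tensorId, relabel_relabel]
  -- The idle factors next to `y` on the two sides are matched by means of `η₃`.
  rw [tensorId_eq_relabel (E := (D₁ ⊕ B₃) ⊕ C₃) (E' := (C₃ ⊕ A₃) ⊕ D₁)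
      (((Equiv.sumAssoc D₁ B₃ C₃).trans (Equiv.sumComm _ _)).trans
      (Equiv.sumCongr ((Equiv.sumComm _ _).trans (Equiv.sumCongr (Equiv.refl _) η₃))
        (Equiv.refl _))) y,
    tensorId_eq_relabel (Equiv.sumComm D₁ D₂) z]
  simp only [relabel_relabel]
  refine relabel_congr ?_ (congrArg _ (relabel_congr ?_ (congrArg _ (relabel_congr ?_
    (congrArg _ (relabel_congr ?_ rfl))))))
  · rintro (c | c | c) <;> simp
  · rintro ((c | c) | (c | c) | c) <;> simp [glueEquiv]
  · rintro ((c | c | c) | c | c) <;> simp [glueEquiv]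
  · rintro (c | c | c) <;> simp

/-- Associativity when `x` and `y` are glued to `z` only; they are exchanged by the interchange
law. -/
theorem composite_upper (η₁ : B₁ ≃ A₁) (η₂ : B₂ ≃ A₂) {i j : ℤ}
    {x : Unordered V (D₁ ⊕ B₁) →ₗ[K] Unordered V C₁} (hx : x ∈ homDegree V (D₁ ⊕ B₁) C₁ i)
    {y : Unordered V (D₂ ⊕ B₂) →ₗ[K] Unordered V C₂} (hy : y ∈ homDegree V (D₂ ⊕ B₂) C₂ j)
    (z : Unordered V D₃ →ₗ[K] Unordered V ((C₃ ⊕ A₁) ⊕ A₂)) :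
    conj (sumLeftComm C₁ C₂ C₃) (sumLeftComm D₁ D₂ D₃)
        (composite η₁ x (conj (Equiv.sumAssoc C₂ C₃ A₁).symm (Equiv.refl _) (composite η₂ y z))) =
      koszul K (i * j) • composite η₂ y (conj (Equiv.sumAssoc C₁ C₃ A₂).symm (Equiv.refl _)
        (composite η₁ x (conj (sumRightComm C₃ A₁ A₂) (Equiv.refl _) z))) := by
  refine LinearMap.ext fun v => ?_
  simp only [composite, conj, LinearMap.smul_apply, LinearMap.comp_apply, tensorId_comp,
    tensorId_relabel, tensorId_tensorId, relabel_relabel]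
  rw [tensorId_eq_relabel (E := (C₃ ⊕ A₁) ⊕ D₁) (E' := (D₁ ⊕ B₁) ⊕ C₃)
      (((Equiv.sumComm _ _).trans (Equiv.sumCongr (Equiv.refl _) ((Equiv.sumComm _ _).trans
        (Equiv.sumCongr η₁.symm (Equiv.refl _))))).trans (Equiv.sumAssoc D₁ B₁ C₃).symm) y,
    tensorId_eq_relabel (E := (C₃ ⊕ A₂) ⊕ D₂) (E' := (D₂ ⊕ B₂) ⊕ C₃)
      (((Equiv.sumComm _ _).trans (Equiv.sumCongr (Equiv.refl _) ((Equiv.sumComm _ _).trans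
        (Equiv.sumCongr η₂.symm (Equiv.refl _))))).trans (Equiv.sumAssoc D₂ B₂ C₃).symm) x,
    tensorId_eq_relabel (Equiv.sumComm D₂ D₁) z]
  simp only [relabel_relabel]
  refine (congrArg _ (congrArg _ (relabel_congr (e' := sumLeftComm C₂ (D₁ ⊕ B₁) C₃)
    ?_ rfl))).trans ?_
  · rintro (c | (c | c) | c) <;> simp [sumLeftComm, glueEquiv]
  rw [tensorId_sumLeftComm_tensorId hx hy, LinearMap.map_smul]
  simp only [relabel_relabel]
  refine congrArg _ ((relabel_congr (e' := Equiv.refl _) ?_ (congrArg _ (relabel_congr ?_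
    (congrArg _ (relabel_congr ?_ (congrArg _ (relabel_congr ?_ rfl))))))).trans (relabel_refl _))
  · rintro (c | c | c) <;> simp [sumLeftComm]
  · rintro (c | (c | c) | c) <;> simp [sumLeftComm, glueEquiv]
  · rintro (((c | c) | c) | c | c) <;> simp [sumLeftComm, sumRightComm, glueEquiv]
  · rintro (c | c | c) <;> simp [sumLeftComm]

/-- Associativity when `y` and `z` are glued to `x` only; they are exchanged by the interchange
law. -/
theorem composite_lower (η₁ : B₁ ≃ A₁) (η₂ : B₂ ≃ A₂) {j l : ℤ}
    (x : Unordered V ((D₁ ⊕ B₂) ⊕ B₁) →ₗ[K] Unordered V C₁)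
    {y : Unordered V D₂ →ₗ[K] Unordered V (C₂ ⊕ A₁)} (hy : y ∈ homDegree V D₂ (C₂ ⊕ A₁) j)
    {z : Unordered V D₃ →ₗ[K] Unordered V (C₃ ⊕ A₂)} (hz : z ∈ homDegree V D₃ (C₃ ⊕ A₂) l) :
    conj (sumRightComm C₁ C₂ C₃) (sumRightComm D₁ D₂ D₃)
        (composite η₂ (conj (Equiv.refl _) (sumRightComm D₁ B₂ D₂) (composite η₁ x y)) z) =
      koszul K (j * l) • composite η₁ (conj (Equiv.refl _) (sumRightComm D₁ B₁ D₃)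
        (composite η₂ (conj (Equiv.refl _) (sumRightComm D₁ B₂ B₁) x) z)) y := by
  refine LinearMap.ext fun v => ?_
  simp only [composite, conj, LinearMap.smul_apply, LinearMap.comp_apply, tensorId_comp,
    tensorId_relabel, tensorId_tensorId, relabel_relabel]
  rw [tensorId_eq_relabel (E := (D₁ ⊕ B₂) ⊕ C₃) (E' := (C₃ ⊕ A₂) ⊕ D₁)
      (((Equiv.sumAssoc D₁ B₂ C₃).trans (Equiv.sumComm _ _)).trans
      (Equiv.sumCongr ((Equiv.sumComm _ _).trans (Equiv.sumCongr (Equiv.refl _) η₂))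
        (Equiv.refl _))) y,
    tensorId_eq_relabel (E := (D₁ ⊕ B₁) ⊕ C₂) (E' := (C₂ ⊕ A₁) ⊕ D₁)
      (((Equiv.sumAssoc D₁ B₁ C₂).trans (Equiv.sumComm _ _)).trans
      (Equiv.sumCongr ((Equiv.sumComm _ _).trans (Equiv.sumCongr (Equiv.refl _) η₁))
        (Equiv.refl _))) z,
    tensorId_eq_relabel (Equiv.sumComm C₃ C₂) x, tensorId_eq_relabel (Equiv.sumComm D₁ D₂) z,
    tensorId_eq_relabel (Equiv.sumComm D₁ D₃) y]
  simp only [relabel_relabel]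
  refine (congrArg _ (congrArg _ (congrArg _ (congrArg _ (relabel_congr
    (e' := sumLeftComm (C₃ ⊕ A₂) D₂ D₁) ?_ rfl))))).trans ?_
  · rintro ((c | c) | c | c) <;> simp [sumLeftComm, sumRightComm, glueEquiv]
  rw [tensorId_sumLeftComm_tensorId hy hz, LinearMap.map_smul, LinearMap.map_smul,
    LinearMap.map_smul]
  simp only [relabel_relabel]
  refine congrArg _ (relabel_congr ?_ (congrArg _ (relabel_congr ?_ (congrArg _ (relabel_congr ?_
    (congrArg _ (relabel_congr ?_ rfl)))))))
  · rintro (c | c | c) <;> simp [sumRightComm]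
  · rintro ((c | c) | (c | c) | c) <;> simp [sumLeftComm, sumRightComm, glueEquiv]
  · rintro ((c | c) | c | c) <;> simp [sumLeftComm, sumRightComm, glueEquiv]
  · rintro ((c | c) | c) <;> simp [sumLeftComm, sumRightComm]

/-- The differential of maps is a derivation of the composition. -/
theorem d_composite (η : B ≃ A) {i j n : ℤ} (hn : i + j = n)
    {g : Unordered V (D₁ ⊕ B) →ₗ[K] Unordered V C₁} (hg : g ∈ homDegree V (D₁ ⊕ B) C₁ i)
    {f : Unordered V D₂ →ₗ[K] Unordered V (C₂ ⊕ A)} (hf : f ∈ homDegree V D₂ (C₂ ⊕ A) j) :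
    (d V (C₁ ⊕ C₂)).comp (composite η g f) -
        koszul K n • (composite η g f).comp (d V (D₁ ⊕ D₂)) =
      composite η ((d V C₁).comp g - koszul K i • g.comp (d V (D₁ ⊕ B))) f +
        koszul K i • composite η g ((d V (C₂ ⊕ A)).comp f - koszul K j • f.comp (d V D₂)) := by
  rw [sub_eq_iff_eq_add]
  refine LinearMap.ext fun v => ?_
  simp only [composite, LinearMap.comp_apply, LinearMap.add_apply, LinearMap.smul_apply]
  rw [d_tensorId hg, d_relabel, d_tensorId hf, d_relabel]
  simp only [LinearMap.map_add, LinearMap.map_smul, smul_add, add_assoc, ← mul_smul, ← hn,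
    FreeProperad.koszul_add]

end Composite

end Unordered

/-! ### The endomorphism properad -/

namespace endomorphismProperad

open Unordered

variable {K : Type k} [Field K] {V : CochainComplex (ModuleCat.{w} K) ℤ} {law : GenusLaw}

/-- The linear map underlying an element of the endomorphism properad. -/
noncomputable def hom {X : Corolla} {n : ℤ} :
    (endomorphismProperad V law).obj X n →ₗ[K] Unordered V X.inp →ₗ[K] Unordered V X.out :=
  (homDegree V X.inp X.out n).subtype

theorem hom_injective {X : Corolla} {n : ℤ} {f g : (endomorphismProperad V law).obj X n}
    (h : hom f = hom g) : f = g :=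
  Subtype.ext h

theorem hom_smul {X : Corolla} {n : ℤ} (c : K) (f : (endomorphismProperad V law).obj X n) :
    hom (c • f) = c • hom f :=
  rfl

theorem hom_mem {X : Corolla} {n : ℤ} (f : (endomorphismProperad V law).obj X n) :
    hom f ∈ homDegree V X.inp X.out n :=
  f.2

theorem hom_act {X Y : Corolla} (ρ : X.out ≃ Y.out) (σ : X.inp ≃ Y.inp) (hG : X.genus = Y.genus)
    (n : ℤ) (f : (endomorphismProperad V law).obj X n) :
    hom ((endomorphismProperad V law).act ρ σ hG n f) = conj ρ σ (hom f) :=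
  rfl

theorem hom_d (X : Corolla) {n m : ℤ} (h : n + 1 = m) (f : (endomorphismProperad V law).obj X n) :
    hom ((endomorphismProperad V law).d X h f) =
      (d V X.out).comp (hom f) - koszul K n • (hom f).comp (d V X.inp) :=
  rfl

theorem hom_comp {C₁ D₁ C₂ D₂ B A : Type} [Finite C₁] [Finite D₁] [Finite C₂]
    [Finite D₂] [Finite B] [Finite A] [Nonempty B] (η : B ≃ A) {G₁ G₂ : ℕ}
    (h₁ : 0 < eulerChar C₁ (D₁ ⊕ B) G₁) (h₂ : 0 < eulerChar (C₂ ⊕ A) D₂ G₂)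
    {i j n : ℤ} (hn : i + j = n)
    (g : (endomorphismProperad V law).obj ⟨C₁, D₁ ⊕ B, G₁, h₁⟩ i)
    (f : (endomorphismProperad V law).obj ⟨C₂ ⊕ A, D₂, G₂, h₂⟩ j) :
    hom ((endomorphismProperad V law).comp η h₁ h₂ hn g f) = composite η (hom g) (hom f) := by
  refine LinearMap.ext fun v => ?_
  change tensorId V C₂ g.1 (relabel V (glueEquiv D₁ C₂ η) (idTensor V D₁ j f.1 v)) = _
  rw [idTensor_eq f.2, relabel_relabel]
  rfl

/-- The endomorphism properad satisfies the axioms of a properad. -/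
theorem ax {X : Corolla} {n : ℤ} (x y : (endomorphismProperad V law).toOperations.obj X n)
    (h : (endomorphismProperad V law).toOperations.Axiom x y) : x = y := by
  refine hom_injective (law := law) ?_
  cases h with
  | act_id x =>
    refine LinearMap.ext fun v => ?_
    exact (relabel_refl _).trans (congrArg _ (relabel_refl _))
  | act_act ρ σ hG ρ' σ' hG' x =>
    dsimp only [ProperadData.toOperations] at x ⊢
    rw [hom_act, hom_act, hom_act]
    refine LinearMap.ext fun v => ?_
    simp only [conj, LinearMap.comp_apply, relabel_relabel]
    rfl
  | equivariance η h₁ h₂ h₁' h₂' ρ₁ σ₁ σB ρ₂ ρA σ₂ hn x y =>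
    dsimp only [ProperadData.toOperations] at x y ⊢
    rw [hom_act, hom_comp, hom_comp, hom_act, hom_act]
    exact composite_conj η ρ₁ σ₁ σB ρ₂ ρA σ₂ _ _
  | assoc η₁ η₂ η₃ h₁ h₁' h₂ h₃ h₃' h₁₂ h₂₃ hij hjl hn hn' x y z =>
    dsimp only [ProperadData.toOperations] at x y z ⊢
    rw [hom_act, hom_comp, hom_act, hom_comp, hom_comp, hom_act, hom_act, hom_comp, hom_act]
    exact composite_assoc η₁ η₂ η₃ _ _ _
  | upper η₁ η₂ h₁ h₂ h₃ h₃' h₂₃ h₁₃ hjl hil hn hn' x y z =>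
    dsimp only [ProperadData.toOperations] at x y z ⊢
    rw [hom_smul, hom_act, hom_comp, hom_act, hom_comp, hom_comp, hom_act, hom_comp, hom_act]
    have h := composite_upper η₁ η₂ (hom_mem x) (hom_mem y) (hom z)
    convert h using 2
  | lower η₁ η₂ h₁ h₁' h₂ h₃ h₁₂ h₁₃ hij hil hn hn' x y z =>
    dsimp only [ProperadData.toOperations] at x y z ⊢
    rw [hom_smul, hom_act, hom_comp, hom_act, hom_comp, hom_comp, hom_act, hom_comp, hom_act]
    have h := composite_lower η₁ η₂ (hom x) (hom_mem y) (hom_mem z)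
    convert h using 2

theorem d_act {X Y : Corolla} (ρ : X.out ≃ Y.out) (σ : X.inp ≃ Y.inp)
    (hG : X.genus = Y.genus) {n m : ℤ} (h : n + 1 = m) (x : (endomorphismProperad V law).obj X n) :
    (endomorphismProperad V law).d Y h ((endomorphismProperad V law).act ρ σ hG n x) =
      (endomorphismProperad V law).act ρ σ hG m ((endomorphismProperad V law).d X h x) := by
  refine hom_injective (LinearMap.ext fun v => ?_)
  simp only [hom_act, hom_d, conj, LinearMap.comp_apply, LinearMap.sub_apply, LinearMap.smul_apply,
    LinearMap.map_sub, LinearMap.map_smul, d_relabel]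

theorem d_comp {C₁ D₁ C₂ D₂ B A : Type} [Finite C₁] [Finite D₁] [Finite C₂]
    [Finite D₂] [Finite B] [Finite A] [Nonempty B] (η : B ≃ A) {G₁ G₂ : ℕ}
    (h₁ : 0 < eulerChar C₁ (D₁ ⊕ B) G₁) (h₂ : 0 < eulerChar (C₂ ⊕ A) D₂ G₂)
    {i i' j j' n m : ℤ} (hi : i + 1 = i') (hj : j + 1 = j') (hn : i + j = n) (hm : n + 1 = m)
    (x : (endomorphismProperad V law).obj ⟨C₁, D₁ ⊕ B, G₁, h₁⟩ i)
    (y : (endomorphismProperad V law).obj ⟨C₂ ⊕ A, D₂, G₂, h₂⟩ j) :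
    (endomorphismProperad V law).d _ hm ((endomorphismProperad V law).comp η h₁ h₂ hn x y) =
      (endomorphismProperad V law).comp η h₁ h₂ (by omega)
          ((endomorphismProperad V law).d _ hi x) y +
        koszul K i • (endomorphismProperad V law).comp η h₁ h₂ (by omega) x
          ((endomorphismProperad V law).d _ hj y) := by
  refine hom_injective ?_
  rw [LinearMap.map_add, LinearMap.map_smul, hom_d, hom_comp, hom_comp, hom_comp, hom_d, hom_d]
  exact d_composite η hn (hom_mem x) (hom_mem y)

end endomorphismProperad

/-! ### Naturality of the quadratic operator -/

/-- Only finitely many summands of a finite direct sum of modules are nonzero. -/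
theorem DirectSum.finite_setOf_nontrivial {K : Type*} [Field K] {ι : Type*} (M : ι → Type*)
    [∀ i, AddCommGroup (M i)] [∀ i, Module K (M i)] [Module.Finite K (⨁ i, M i)] :
    {i | Nontrivial (M i)}.Finite := by
  classical
  obtain ⟨S, hS⟩ := Module.Finite.fg_top (R := K) (M := ⨁ i, M i)
  have key : ∀ x : ⨁ i, M i, ∀ i ∉ S.biUnion fun y => DFinsupp.support y, x i = 0 := by
    intro x
    have hx : x ∈ Submodule.span K (S : Set (⨁ i, M i)) := hS ▸ Submodule.mem_top
    induction hx using Submodule.span_induction with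
    | mem x hx =>
      intro i hi
      by_contra h
      exact hi (Finset.mem_biUnion.2 ⟨x, hx, DFinsupp.mem_support_iff.2 h⟩)
    | zero => exact fun i _ => rfl
    | add x y _ _ hx hy => exact fun i hi => by rw [DirectSum.add_apply, hx i hi, hy i hi, add_zero]
    | smul c x _ hx => exact fun i hi => by rw [DirectSum.smul_apply, hx i hi, smul_zero]
  refine (S.biUnion fun y => DFinsupp.support y).finite_toSet.subset fun i hi => ?_
  by_contra h
  obtain ⟨v, hv⟩ := @exists_ne (M i) hi 0
  refine hv ?_
  have := key (DirectSum.lof K ι M i v) i h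
  rwa [DirectSum.lof_eq_of, DirectSum.of_eq_same] at this

section Quadratic

variable {K : Type k} [Field K] {law : GenusLaw}

theorem Splitting.map_comp {Q : ProperadData.{k, u} K law} {R : ProperadData.{k, v} K law}
    (F : ∀ (X : Corolla) (n : ℤ), Q.obj X n →ₗ[K] R.obj X n)
    (F_act : ∀ {X Y : Corolla} (ρ : X.out ≃ Y.out) (σ : X.inp ≃ Y.inp) (hG : X.genus = Y.genus)
      (n : ℤ) (x : Q.obj X n), F Y n (Q.act ρ σ hG n x) = R.act ρ σ hG n (F X n x))
    (F_comp : ∀ {C₁ D₁ C₂ D₂ B A : Type} [Finite C₁] [Finite D₁] [Finite C₂] [Finite D₂]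
      [Finite B] [Finite A] [Nonempty B] (η : B ≃ A) {G₁ G₂ : ℕ}
      (h₁ : 0 < eulerChar C₁ (D₁ ⊕ B) G₁) (h₂ : 0 < eulerChar (C₂ ⊕ A) D₂ G₂)
      {i j n : ℤ} (hn : i + j = n)
      (x : Q.obj ⟨C₁, D₁ ⊕ B, G₁, h₁⟩ i) (y : Q.obj ⟨C₂ ⊕ A, D₂, G₂, h₂⟩ j),
      F _ n (Q.comp η h₁ h₂ hn x y) = R.comp η h₁ h₂ hn (F _ i x) (F _ j y))
    {X : Corolla} (s : Splitting law X) {i j n : ℤ} (hn : i + j = n)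
    (t : Q.obj s.left i ⊗[K] Q.obj s.right j) :
    F X n (s.comp Q hn t) = s.comp R hn (TensorProduct.map (F s.left i) (F s.right j) t) := by
  induction t with
  | zero => simp
  | add a b ha hb => simp only [map_add, ha, hb]
  | tmul x y =>
    simp only [Splitting.comp, LinearMap.comp_apply, TensorProduct.lift.tmul,
      TensorProduct.map_tmul]
    rw [F_act, F_comp]

/-- For a given splitting, only finitely many bidegrees contribute to the quadratic operator. -/
theorem finite_support_quadraticTerm (P : ProperadData.{k, u} K law) [hP : P.FiniteDimensional]
    (Q : ProperadData.{k, v} K law) (α : DegreeOneMaps P Q) (X : Corolla) (s : Splitting law X)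
    {n m : ℤ} (hm : n + 2 = m) :
    (Function.support fun i : ℤ =>
      quadraticTerm P Q α X s (show i + (n - i) = n by omega) hm).Finite := by
  have := hP.finite s.left
  refine ((DirectSum.finite_setOf_nontrivial (K := K) (P.obj s.left)).preimage
    neg_injective.injOn).subset fun i hi => ?_
  by_contra h
  have h1 : Subsingleton (P.obj s.left (-i)) := not_nontrivial_iff_subsingleton.1 h
  have h2 : Subsingleton (P.Dual s.left i) := inferInstance
  have h3 : α s.left (rfl : i + 1 = i + 1) = 0 := Subsingleton.elim _ _
  refine hi ?_
  simp only [quadraticTerm, h3, TensorProduct.map_zero_left, LinearMap.comp_zero,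
    LinearMap.zero_comp, smul_zero]

/-- The quadratic operator is natural with respect to maps that commute with the operations. -/
theorem map_quadratic (P : ProperadData.{k, u} K law) [P.FiniteDimensional]
    {Q : ProperadData.{k, v} K law} {R : ProperadData.{k, w} K law}
    (F : ∀ (X : Corolla) (n : ℤ), Q.obj X n →ₗ[K] R.obj X n)
    (F_act : ∀ {X Y : Corolla} (ρ : X.out ≃ Y.out) (σ : X.inp ≃ Y.inp) (hG : X.genus = Y.genus)
      (n : ℤ) (x : Q.obj X n), F Y n (Q.act ρ σ hG n x) = R.act ρ σ hG n (F X n x))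
    (F_comp : ∀ {C₁ D₁ C₂ D₂ B A : Type} [Finite C₁] [Finite D₁] [Finite C₂] [Finite D₂]
      [Finite B] [Finite A] [Nonempty B] (η : B ≃ A) {G₁ G₂ : ℕ}
      (h₁ : 0 < eulerChar C₁ (D₁ ⊕ B) G₁) (h₂ : 0 < eulerChar (C₂ ⊕ A) D₂ G₂)
      {i j n : ℤ} (hn : i + j = n)
      (x : Q.obj ⟨C₁, D₁ ⊕ B, G₁, h₁⟩ i) (y : Q.obj ⟨C₂ ⊕ A, D₂, G₂, h₂⟩ j),
      F _ n (Q.comp η h₁ h₂ hn x y) = R.comp η h₁ h₂ hn (F _ i x) (F _ j y))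
    (α : DegreeOneMaps P Q) (X : Corolla) {n m : ℤ} (hm : n + 2 = m) (φ : P.Dual X n) :
    F X m (quadratic P Q α X hm φ) =
      quadratic P R (fun X _ m h => (F X m).comp (α X h)) X hm φ := by
  let Θ : (P.Dual X n →ₗ[K] Q.obj X m) →+ (P.Dual X n →ₗ[K] R.obj X m) :=
    AddMonoidHom.mk' (fun g => (F X m).comp g) fun g g' => LinearMap.comp_add _ _ _
  refine LinearMap.congr_fun (f := Θ (quadratic P Q α X hm)) ?_ φ
  rw [quadratic, quadratic, AddMonoidHom.map_finsum _ (Set.toFinite _)]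
  refine finsum_congr fun s => ?_
  rw [AddMonoidHom.map_finsum _ (finite_support_quadraticTerm P Q α X s hm)]
  refine finsum_congr fun i => LinearMap.ext fun φ => ?_
  change F X m (quadraticTerm P Q α X s _ hm φ) = _
  simp only [quadraticTerm, LinearMap.smul_apply, LinearMap.comp_apply, map_smul]
  rw [Splitting.map_comp F F_act F_comp, TensorProduct.map_map]

end Quadratic

/-! ### The universal property of the free properad -/

namespace FreeProperad

variable {K : Type k} [Field K] {law : GenusLaw} {P : ProperadData.{k, u} K law}
  {Q : ProperadData.{k, v} K law}

/-- The value of a formal expression in a properad `Q`, for given values of the generators. -/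
def eval (α : DegreeOneMaps P Q) : ∀ {X : Corolla} {n : ℤ}, FreeTerm P X n → Q.obj X n
  | X, _, .gen h φ => α X h φ
  | _, _, .zero => 0
  | _, _, .add x y => eval α x + eval α y
  | _, _, .smul c x => c • eval α x
  | _, _, .act ρ σ hG x => Q.act ρ σ hG _ (eval α x)
  | _, _, @FreeTerm.comp _ _ _ _ _ _ _ _ _ _ _ _ _ _ _ _ _ η _ _ h₁ h₂ _ _ _ hn x y =>
      Q.comp η h₁ h₂ hn (eval α x) (eval α y)

/-- Evaluation carries each axiom to the same axiom in `Q`. -/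
theorem eval_ax (α : DegreeOneMaps P Q) {X : Corolla} {n : ℤ}
    (x y : (FreeTerm.operations P).obj X n) (h : (FreeTerm.operations P).Axiom x y) :
    Q.toOperations.Axiom (eval α (x : FreeTerm P X n)) (eval α (y : FreeTerm P X n)) := by
  cases h with
  | act_id x => exact .act_id (Q := Q.toOperations) _
  | act_act ρ σ hG ρ' σ' hG' x => exact .act_act (Q := Q.toOperations) ρ σ hG ρ' σ' hG' _
  | equivariance η h₁ h₂ h₁' h₂' ρ₁ σ₁ σB ρ₂ ρA σ₂ hn x y =>
    exact .equivariance (Q := Q.toOperations) η h₁ h₂ h₁' h₂' ρ₁ σ₁ σB ρ₂ ρA σ₂ hn _ _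
  | assoc η₁ η₂ η₃ h₁ h₁' h₂ h₃ h₃' h₁₂ h₂₃ hij hjl hn hn' x y z =>
    exact .assoc (Q := Q.toOperations) η₁ η₂ η₃ h₁ h₁' h₂ h₃ h₃' h₁₂ h₂₃ hij hjl hn hn' _ _ _
  | upper η₁ η₂ h₁ h₂ h₃ h₃' h₂₃ h₁₃ hjl hil hn hn' x y z =>
    exact .upper (Q := Q.toOperations) η₁ η₂ h₁ h₂ h₃ h₃' h₂₃ h₁₃ hjl hil hn hn' _ _ _
  | lower η₁ η₂ h₁ h₁' h₂ h₃ h₁₂ h₁₃ hij hil hn hn' x y z =>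
    exact .lower (Q := Q.toOperations) η₁ η₂ h₁ h₁' h₂ h₃ h₁₂ h₁₃ hij hil hn hn' _ _ _

theorem eval_sound
    (hQ : ∀ {X : Corolla} {n : ℤ} (x y : Q.toOperations.obj X n), Q.toOperations.Axiom x y → x = y)
    {α : DegreeOneMaps P Q} (hα : α.Equivariant) {X : Corolla} {n : ℤ} {x y : FreeTerm P X n}
    (h : FreeTerm.Rel P x y) : eval α x = eval α y := by
  induction h with
  | refl x => rfl
  | symm _ ih => exact ih.symm
  | trans _ _ ih ih' => exact ih.trans ih'
  | add _ _ ih ih' => simp only [eval, ih, ih']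
  | smul c _ ih => simp only [eval, ih]
  | act ρ σ hG _ ih => simp only [eval, ih]
  | comp η h₁ h₂ hn hx hy ih ih' => simp only [eval, ih, ih']
  | add_assoc x y z => simp only [eval, add_assoc]
  | add_comm x y => simp only [eval, add_comm]
  | zero_add x => simp only [eval, zero_add]
  | one_smul x => simp only [eval, one_smul]
  | mul_smul a b x => simp only [eval, mul_smul]
  | smul_add a x y => simp only [eval, smul_add]
  | add_smul a b x => simp only [eval, add_smul]
  | zero_smul x => simp only [eval, zero_smul]
  | act_add ρ σ hG x y => simp only [eval, map_add]
  | act_smul ρ σ hG c x => simp only [eval, map_smul]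
  | add_comp η h₁ h₂ hn x x' y => simp only [eval, map_add, LinearMap.add_apply]
  | smul_comp η h₁ h₂ hn c x y => simp only [eval, map_smul, LinearMap.smul_apply]
  | comp_add η h₁ h₂ hn x y y' => simp only [eval, map_add]
  | comp_smul η h₁ h₂ hn c x y => simp only [eval, map_smul]
  | ax x y h => exact hQ _ _ (eval_ax α x y h)
  | gen_add h φ ψ => simp only [eval, map_add]
  | gen_smul h c φ => simp only [eval, map_smul]
  | gen_act ρ σ hG h φ => exact hα ρ σ hG h φ

/-- The extension of an equivariant collection of maps of degree `1` to the free properad. -/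
def lift
    (hQ : ∀ {X : Corolla} {n : ℤ} (x y : Q.toOperations.obj X n), Q.toOperations.Axiom x y → x = y)
    {α : DegreeOneMaps P Q} (hα : α.Equivariant) (X : Corolla) (n : ℤ) :
    FreeProperad P X n →ₗ[K] Q.obj X n where
  toFun := Quotient.lift (eval α) fun _ _ h => eval_sound hQ hα h
  map_add' x y := by
    induction x using ind; induction y using ind
    rfl
  map_smul' c x := by
    induction x using ind
    rfl

/-- If `α` satisfies the master equation, its extension commutes with the differentials. -/
theorem lift_d (P : Properad.{k, u} K law) [P.FiniteDimensional]
    (hQ : ∀ {X : Corolla} {n : ℤ} (x y : Q.toOperations.obj X n), Q.toOperations.Axiom x y → x = y)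
    (hd_act : ∀ {X Y : Corolla} (ρ : X.out ≃ Y.out) (σ : X.inp ≃ Y.inp) (hG : X.genus = Y.genus)
      {n m : ℤ} (h : n + 1 = m) (x : Q.obj X n),
      Q.d Y h (Q.act ρ σ hG n x) = Q.act ρ σ hG m (Q.d X h x))
    (hd_comp : ∀ {C₁ D₁ C₂ D₂ B A : Type} [Finite C₁] [Finite D₁] [Finite C₂] [Finite D₂]
      [Finite B] [Finite A] [Nonempty B] (η : B ≃ A) {G₁ G₂ : ℕ}
      (h₁ : 0 < eulerChar C₁ (D₁ ⊕ B) G₁) (h₂ : 0 < eulerChar (C₂ ⊕ A) D₂ G₂)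
      {i i' j j' n m : ℤ} (hi : i + 1 = i') (hj : j + 1 = j') (hn : i + j = n) (hm : n + 1 = m)
      (x : Q.obj ⟨C₁, D₁ ⊕ B, G₁, h₁⟩ i) (y : Q.obj ⟨C₂ ⊕ A, D₂, G₂, h₂⟩ j),
      Q.d _ hm (Q.comp η h₁ h₂ hn x y) = Q.comp η h₁ h₂ (by omega) (Q.d _ hi x) y +
        koszul K i • Q.comp η h₁ h₂ (by omega) x (Q.d _ hj y))
    {α : DegreeOneMaps P.toProperadData Q} (hα : α.Equivariant) (hα' : α.MasterEquation)
    (X : Corolla) {n m : ℤ} (h : n + 1 = m) (x : FreeProperad P.toProperadData X n) :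
    lift hQ hα X m (d P X h x) = Q.d X h (lift hQ hα X n x) := by
  subst h
  induction x using ind with
  | h x =>
  change lift hQ hα X _ (termD P.toProperadData x) = Q.d X rfl (eval α x)
  induction x with
  | gen h φ =>
    rw [termD, eval, hα' _ h rfl, map_add]
    refine congrArg₂ (· + ·) rfl ?_
    exact map_quadratic (Q := graded P.toProperadData) P.toProperadData (lift hQ hα)
      (fun ρ σ hG n x => by induction x using ind; rfl)
      (fun η _ _ h₁ h₂ _ _ _ hn x y => by
        induction x using ind; induction y using ind; rfl) _ _ _ φ
  | zero => rw [termD, eval, map_zero, map_zero]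
  | add x y hx hy => rw [termD, eval, map_add, map_add, hx, hy]
  | smul c x hx => rw [termD, eval, map_smul, map_smul, hx]
  | act ρ σ hG x hx =>
    rw [eval, hd_act, ← hx, termD]
    generalize termD P.toProperadData x = t
    induction t using ind; rfl
  | comp η h₁ h₂ hn x y hx hy =>
    rw [eval, hd_comp η h₁ h₂ rfl rfl hn rfl, ← hx, ← hy, termD, map_add, map_smul]
    generalize termD P.toProperadData x = t
    generalize termD P.toProperadData y = t'
    induction t using ind; induction t' using ind; rfl

end FreeProperad

/-! ### Algebras over the cobar complex -/

namespace AlgebraOver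

variable {K : Type k} [Field K] {law : GenusLaw} {P : Properad.{k, u} K law} [P.FiniteDimensional]
  {V : CochainComplex (ModuleCat.{w} K) ℤ}

theorem onGenerators_equivariant (F : AlgebraOver (cobar P) V) : F.onGenerators.Equivariant := by
  intro X Y ρ σ hG n m h φ
  refine (F.app_act ρ σ hG m (FreeProperad.gen h φ)).symm.trans ?_
  exact congrArg (F.app Y m) (FreeProperad.gen_equivariant ρ σ hG h φ)

theorem onGenerators_masterEquation (F : AlgebraOver (cobar P) V) :
    F.onGenerators.MasterEquation := by
  intro X n m l h h' φ
  subst h'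
  refine (F.app_d X rfl (FreeProperad.gen h φ)).symm.trans ?_
  refine (map_add (F.app X (m + 1)) (FreeProperad.gen rfl (P.dualD X h φ))
    (FreeProperad.quadraticGen P.toProperadData X (by omega) φ)).trans ?_
  refine congrArg₂ (· + ·) rfl ?_
  exact map_quadratic (Q := FreeProperad.graded P.toProperadData) P.toProperadData F.app
    (fun ρ σ hG n x => F.app_act ρ σ hG n x)
    (fun η _ _ h₁ h₂ _ _ _ hn x y => F.app_comp η h₁ h₂ hn x y) _ _ _ φ

/-- The algebra over the cobar complex given by a solution of the master equation. -/
noncomputable def ofGenerators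
    (α : DegreeOneMaps P.toProperadData (endomorphismProperad V law)) (hα : α.Equivariant)
    (hα' : α.MasterEquation) : AlgebraOver (cobar P) V where
  app := FreeProperad.lift endomorphismProperad.ax hα
  app_d X _ _ h x := FreeProperad.lift_d P endomorphismProperad.ax endomorphismProperad.d_act
    endomorphismProperad.d_comp hα hα' X h x
  app_act ρ σ hG n x := by
    induction x using FreeProperad.ind
    rfl
  app_comp η _ _ h₁ h₂ _ _ _ hn x y := by
    induction x using FreeProperad.ind; induction y using FreeProperad.ind
    rfl

theorem onGenerators_ofGenerators
    (α : DegreeOneMaps P.toProperadData (endomorphismProperad V law)) (hα : α.Equivariant)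
    (hα' : α.MasterEquation) : (ofGenerators α hα hα').onGenerators = α :=
  rfl

/-- A morphism on the free properad is determined by its values on the generators. -/
theorem onGenerators_injective {F F' : AlgebraOver (cobar P) V}
    (h : F.onGenerators = F'.onGenerators) : F = F' := by
  have key : ∀ (X : Corolla) (n : ℤ) (x : FreeTerm P.toProperadData X n),
      F.app X n (FreeProperad.mk x) = F'.app X n (FreeProperad.mk x) := by
    intro X n x
    induction x with
    | @gen X _ _ h' φ =>
      exact congrArg (fun α : DegreeOneMaps P.toProperadData (endomorphismProperad V law) =>
        α X h' φ) h
    | zero => exact (map_zero (F.app _ _)).trans (map_zero (F'.app _ _)).symm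
    | add x y hx hy =>
      exact (map_add (F.app _ _) _ _).trans ((congrArg₂ (· + ·) hx hy).trans
        (map_add (F'.app _ _) _ _).symm)
    | smul c x hx =>
      exact (map_smul (F.app _ _) c _).trans ((congrArg (c • ·) hx).trans
        (map_smul (F'.app _ _) c _).symm)
    | act ρ σ hG x hx =>
      exact (F.app_act ρ σ hG _ _).trans ((congrArg _ hx).trans (F'.app_act ρ σ hG _ _).symm)
    | comp η h₁ h₂ hn x y hx hy =>
      exact (F.app_comp η h₁ h₂ hn _ _).trans ((congrArg₂ (fun s t =>
        (endomorphismProperad V law).comp η h₁ h₂ hn s t) hx hy).trans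
          (F'.app_comp η h₁ h₂ hn _ _).symm)
  refine ProperadData.Hom.ext (funext fun X => funext fun n => LinearMap.ext fun x => ?_)
  induction x using FreeProperad.ind with
  | h x => exact key X n x

end AlgebraOver

theorem theorem27 {K : Type k} [Field K] [CharZero K] (law : GenusLaw)
    (P : Properad.{k, u} K law) [P.FiniteDimensional]
    (V : CochainComplex (ModuleCat.{w} K) ℤ) :
    (∀ F : AlgebraOver (cobar P) V,
      F.onGenerators.Equivariant ∧ F.onGenerators.MasterEquation) ∧
    ∀ α : DegreeOneMaps P.toProperadData (endomorphismProperad V law),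
      α.Equivariant → α.MasterEquation →
        ∃! F : AlgebraOver (cobar P) V, F.onGenerators = α := by
  refine ⟨fun F => ⟨F.onGenerators_equivariant, F.onGenerators_masterEquation⟩,
    fun α hα hα' => ⟨.ofGenerators α hα hα',
      AlgebraOver.onGenerators_ofGenerators α hα hα', fun F hF => ?_⟩⟩
  exact AlgebraOver.onGenerators_injective
    (hF.trans (AlgebraOver.onGenerators_ofGenerators α hα hα').symm)
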